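/- **Setting.** Let $M$ be a connected $C^\infty$-manifold of dimension $n\ge 2$ and let $(M,L,\mathfrak m)$ be a weighted Finsler spacetime. That is: $L:TM\to\mathbb R$ is $C^\infty$ on $TM\setminus\{0\}$, $L(cv)=c^2L(v)$ for $c>0$, and for every $v\neq 0$ the matrix $g_{ij}(v)=\frac{\partial^2L}{\partial v^i\partial v^j}(v)$ is non-degenerate with signature $(-,+,\dots,+)$ (write $g_v$ for the Lorentzian metric on $T_xM$ it defines, and $(g^{ij})$ for the inverse matrix); $M$ is time oriented by a smooth vector field $X$ with $L(X)<0$; and $\mathfrak m$ is a measure with a positive $C^\infty$ density $\mathrm e^{\Phi}$ in every chart. Let $\Omega'_x=\{v\in T_xM: L(v)<0\}$, let $\Omega_x$ be the set of $v\in\Omega'_x$ in the connected component of $\overline{\Omega'_x}\setminus\{0\}$ containing $X(x)$, and let $F=\sqrt{-2L}$ on causal vectors. Let $\Omega_x^*=\{\omega\in T_x^*M:\omega(v)<0\ \forall v\in\overline{\Omega}_x\setminus\{0\}\}$ and $L^*(\omega)=-\frac12\bigl(\sup_{v\in\Omega_x,F(v)=1}\omega(v)\bigr)^2$; for $\omega\in\Omega^*_x$,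 $\mathscr L^*(\omega)$ is the unique $v\in\Omega_x$ with $L(v)=L^*(\omega)=\omega(v)/2$. In local coordinates put $$\gamma^i_{jk}=\tfrac12\sum_l g^{il}\Bigl(\tfrac{\partial g_{lk}}{\partial x^j}+\tfrac{\partial g_{jl}}{\partial x^k}-\tfrac{\partial g_{jk}}{\partial x^l}\Bigr),\quad G^i=\sum_{j,k}\gamma^i_{jk}v^jv^k,\quad N^i_j=\tfrac12\tfrac{\partial G^i}{\partial v^j},$$ $$\Gamma^i_{jk}=\gamma^i_{jk}-\tfrac12\sum_{l,m}g^{il}\Bigl(\tfrac{\partial g_{lk}}{\partial v^m}N^m_j+\tfrac{\partial g_{jl}}{\partial v^m}N^m_k-\tfrac{\partial g_{jk}}{\partial v^m}N^m_l\Bigr),$$ $$R^i_j=\tfrac{\partial G^i}{\partial x^j}-\sum_k\Bigl(\tfrac{\partial N^i_j}{\partial x^k}v^k-\tfrac{\partial N^i_j}{\partial v^k}G^k+N^i_kN^k_j\Bigr),$$ all as functions of $v\in TM\setminus\{0\}$. Let $D^w_vV=\sum_{i,j}\bigl\{v^j\frac{\partial V^i}{\partial x^j}+\sum_k\Gamma^i_{jk}(w)v^jV^k\bigr\}\frac{\partial}{\partial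 x^i}$, let geodesics be the solutions of $D^{\dot\eta}_{\dot\eta}\dot\eta=0$, and let $\mathrm{Ric}(v)$ be the trace of $(R^i_j(v))$. Define $\psi_{\mathfrak m}$ by $\mathrm e^{\Phi}=\mathrm e^{-\psi_{\mathfrak m}(v)}\sqrt{-\det(g_{ij}(v))}$, and $\mathrm{Ric}_\infty(v)=\mathrm{Ric}(v)+(\psi_{\mathfrak m}\circ\dot\eta)''(0)$, where $\eta$ is the geodesic with $\dot\eta(0)=v$. For vector fields $V$, $\mathrm{div}_{\mathfrak m}V=\sum_i\bigl(\frac{\partial V^i}{\partial x^i}+V^i\frac{\partial\Phi}{\partial x^i}\bigr)$. **Proposition 4.3 (Bochner-type identity).** Let $U\subset M$ be open and $h\in C^3(U)$ such that $-h$ is temporal, i.e. $\mathrm dh(x)\in\Omega^*_x$ for all $x\in U$. Put $\nabla h=\mathscr L^*(\mathrm dh)$, $\nabla^2h(v)=\nabla^2_vh=D^{\nabla h}_v[\nabla h]$, and $\square_{\mathfrak m}h(x)=\mathrm{trace}[\nabla^2h]-(\psi_{\mathfrak m}\circ\dot\eta)'(0)$ with $\eta$ the geodesic with $\dot\eta(0)=\nabla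 h(x)$; for functions $u$ put $\nabla^{\nabla h}u=\sum_{i,j}g^{ij}(\nabla h)\frac{\partial u}{\partial x^j}\frac{\partial}{\partial x^i}$. Let $$\mathrm{HS}_{\nabla h}(\nabla^2h)=\sum_{i,j=1}^n g_{\nabla h}(\nabla^2_{e_i}h,e_j)^2\,g_{\nabla h}(e_i,e_i)\,g_{\nabla h}(e_j,e_j)$$ (a quantity that may be negative), where $(e_i)$ is an orthonormal basis of $(T_xM,g_{\nabla h})$ with $e_1=\nabla h(x)/F(\nabla h(x))$. Then at every $x\in U$ such bases exist, $\square_{\mathfrak m}h$ and the vector field $\nabla^{\nabla h}[F(\nabla h)^2/2]$ are differentiable at $x$, and in every local coordinate system around $x$ and for every such basis $$\mathrm{div}_{\mathfrak m}\Bigl(\nabla^{\nabla h}\Bigl[\frac{F(\nabla h)^2}{2}\Bigr]\Bigr)+\mathrm d(\square_{\mathfrak m}h)(\nabla h)+\mathrm{Ric}_\infty(\nabla h)+\mathrm{HS}_{\nabla h}(\nabla^2h)=0 .$$ -/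

import Mathlib

open scoped Manifold ContDiff Topology
open MeasureTheory

noncomputable section

namespace FinslerSpacetime

/-- The coordinate space `ℝⁿ`. -/
abbrev Coord (n : ℕ) : Type := EuclideanSpace ℝ (Fin n)

/-! ### Coordinate expressions

In this section `l p v` is a Lagrangian written in local coordinates, as a function of the base
coordinates `p = (xⁱ)` and of the fibre coordinates `v = (vⁱ)`. All the expressions below are only
used at `v ≠ 0`. -/

section Coordinates

variable {n : ℕ}

/-- `∂f/∂xⁱ` for a function `f (x, v)`. -/
def partialX (i : Fin n) (f : Coord n → Coord n → ℝ) (p v : Coord n) : ℝ :=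
  fderiv ℝ (fun q => f q v) p (EuclideanSpace.single i 1)

/-- `∂f/∂vⁱ` for a function `f (x, v)`. -/
def partialV (i : Fin n) (f : Coord n → Coord n → ℝ) (p v : Coord n) : ℝ :=
  fderiv ℝ (fun w => f p w) v (EuclideanSpace.single i 1)

/-- `∂u/∂xⁱ` for a function `u (x)`. -/
def partialBase (i : Fin n) (u : Coord n → ℝ) (p : Coord n) : ℝ :=
  fderiv ℝ u p (EuclideanSpace.single i 1)

variable (l : Coord n → Coord n → ℝ)

/-- `g_{ij}(v) = ∂²L/∂vⁱ∂vʲ`. -/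
def gLow (i j : Fin n) (p v : Coord n) : ℝ :=
  partialV i (partialV j l) p v

/-- The matrix `(g_{ij}(v))`. -/
def gMatrix (p v : Coord n) : Matrix (Fin n) (Fin n) ℝ :=
  Matrix.of fun i j => gLow l i j p v

/-- `g^{ij}(v)`, the entries of the inverse matrix of `(g_{ij}(v))`. -/
def gUp (i j : Fin n) (p v : Coord n) : ℝ :=
  (gMatrix l p v)⁻¹ i j

/-- The formal Christoffel symbols `γ^i_{jk}(v)`. -/
def formalChristoffel (i j k : Fin n) (p v : Coord n) : ℝ :=
  (1 / 2) * ∑ m, gUp l i m p v *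
    (partialX j (gLow l m k) p v + partialX k (gLow l j m) p v - partialX m (gLow l j k) p v)

/-- The geodesic spray coefficients `G^i(v) = ∑ γ^i_{jk}(v) vʲ vᵏ`. -/
def spray (i : Fin n) (p v : Coord n) : ℝ :=
  ∑ j, ∑ k, formalChristoffel l i j k p v * v j * v k

/-- The nonlinear connection `N^i_j(v) = ½ ∂G^i/∂vʲ`. -/
def nonlinConn (i j : Fin n) (p v : Coord n) : ℝ :=
  (1 / 2) * partialV j (spray l i) p v

/-- The coefficients `Γ^i_{jk}(v)` of the Chern connection. -/
def chern (i j k : Fin n) (p v : Coord n) : ℝ :=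
  formalChristoffel l i j k p v - (1 / 2) * ∑ a, ∑ m, gUp l i a p v *
    (partialV m (gLow l a k) p v * nonlinConn l m j p v
      + partialV m (gLow l j a) p v * nonlinConn l m k p v
      - partialV m (gLow l j k) p v * nonlinConn l m a p v)

/-- The coefficients `R^i_j(v)` of the curvature. -/
def curvature (i j : Fin n) (p v : Coord n) : ℝ :=
  partialX j (spray l i) p v
    - ∑ k, (partialX k (nonlinConn l i j) p v * v k
        - partialV k (nonlinConn l i j) p v * spray l k p v
        + nonlinConn l i k p v * nonlinConn l k j p v)

end Coordinates

/-! ### Finsler spacetimes -/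

section Structures

variable (n : ℕ) (M : Type*) [TopologicalSpace M] [ChartedSpace (Coord n) M]

/-- `g_v(a, b) = ∂²/∂s∂t L(v + s a + t b)` at `s = t = 0`, for `v, a, b ∈ T_x M`; in linear
coordinates of the fibre this is `∑ ∂²L/∂vⁱ∂vʲ(v) aⁱ bʲ`. -/
def fundamentalTensor {n : ℕ} {M : Type*} [TopologicalSpace M] [ChartedSpace (Coord n) M]
    (L : TangentBundle 𝓘(ℝ, Coord n) M → ℝ) {x : M} (v a b : TangentSpace 𝓘(ℝ, Coord n) x) : ℝ :=
  deriv (fun s : ℝ => deriv (fun t : ℝ => L ⟨x, v + s • a + t • b⟩) 0) 0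

/-- A Lorentz–Finsler structure `L : TM → ℝ`. -/
structure LorentzFinsler [IsManifold 𝓘(ℝ, Coord n) ∞ M] where
  L : TangentBundle 𝓘(ℝ, Coord n) M → ℝ
  smooth : ContMDiffOn 𝓘(ℝ, Coord n).tangent 𝓘(ℝ, ℝ) ∞ L {v | v.2 ≠ 0}
  homogeneous : ∀ (x : M) (v : TangentSpace 𝓘(ℝ, Coord n) x) (c : ℝ), 0 < c →
    L ⟨x, c • v⟩ = c ^ 2 * L ⟨x, v⟩
  /-- `g_v` is non-degenerate of signature `(-, +, …, +)` for every `v ≠ 0`. -/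
  signature : ∀ (x : M) (v : TangentSpace 𝓘(ℝ, Coord n) x), v ≠ 0 →
    ∃ b : Module.Basis (Fin n) ℝ (TangentSpace 𝓘(ℝ, Coord n) x), ∀ i j : Fin n,
      fundamentalTensor L v (b i) (b j) =
        if i = j then (if (i : ℕ) = 0 then -1 else 1) else 0

/-- A Finsler spacetime: a Lorentz–Finsler manifold time oriented by a smooth timelike vector
field `X`. -/
structure Spacetime [IsManifold 𝓘(ℝ, Coord n) ∞ M] extends LorentzFinsler n M where
  X : ∀ x : M, TangentSpace 𝓘(ℝ, Coord n) x
  smooth_X : ContMDiff 𝓘(ℝ, Coord n) 𝓘(ℝ, Coord n).tangent ∞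
    (fun x => (⟨x, X x⟩ : TangentBundle 𝓘(ℝ, Coord n) M))
  timelike_X : ∀ x : M, L ⟨x, X x⟩ < 0

/-- `ρ` is a positive `C^∞` density of `m` in the chart `e`: `m = ρ dx¹ ⋯ dxⁿ` on the domain of
the chart. -/
def IsSmoothDensity {n : ℕ} {M : Type*} [TopologicalSpace M] [MeasurableSpace M]
    (m : Measure M) (e : OpenPartialHomeomorph M (Coord n)) (ρ : Coord n → ℝ) : Prop :=
  ContDiffOn ℝ ∞ ρ e.target ∧ (∀ p ∈ e.target, 0 < ρ p) ∧
    ∀ s : Set M, MeasurableSet s → s ⊆ e.source → m s = ∫⁻ p in e '' s, ENNReal.ofReal (ρ p)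

/-- A weighted Finsler spacetime: a Finsler spacetime with a positive `C^∞` measure. -/
structure WeightedSpacetime [IsManifold 𝓘(ℝ, Coord n) ∞ M] [MeasurableSpace M]
    extends Spacetime n M where
  m : Measure M
  smooth_m : ∀ e ∈ IsManifold.maximalAtlas 𝓘(ℝ, Coord n) ∞ M, ∃ ρ, IsSmoothDensity m e ρ

end Structures

section Intrinsic

variable {n : ℕ} {M : Type*} [TopologicalSpace M] [ChartedSpace (Coord n) M]
  [IsManifold 𝓘(ℝ, Coord n) ∞ M]

namespace LorentzFinsler

variable (S : LorentzFinsler n M)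

/-- `F(v) = √(-2L(v))` (used for causal `v`). -/
def F (v : TangentBundle 𝓘(ℝ, Coord n) M) : ℝ := Real.sqrt (-2 * S.L v)

/-- `Ω'_x`, the set of timelike vectors at `x`. -/
def timelike (x : M) : Set (TangentSpace 𝓘(ℝ, Coord n) x) := {v | S.L ⟨x, v⟩ < 0}

/-- The Lorentzian metric `g_v` on `T_x M`. -/
def g {x : M} (v a b : TangentSpace 𝓘(ℝ, Coord n) x) : ℝ := fundamentalTensor S.L v a b

end LorentzFinsler

namespace Spacetime

variable (S : Spacetime n M)

/-- `Ω_x`, the future-directed timelike vectors: those timelike vectors which lie in the connected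
component of `closure Ω'_x ∖ {0}` containing `X(x)`. -/
def future (x : M) : Set (TangentSpace 𝓘(ℝ, Coord n) x) :=
  S.timelike x ∩ connectedComponentIn (closure (S.timelike x) \ {0}) (S.X x)

/-- The polar cone `Ω*_x`. -/
def polarCone (x : M) : Set (TangentSpace 𝓘(ℝ, Coord n) x →L[ℝ] ℝ) :=
  {α | ∀ v ∈ closure (S.future x) \ {0}, α v < 0}

/-- `L*(α) = -½ (sup {α(v) | v ∈ Ω_x, F(v) = 1})²`. -/
def Lstar {x : M} (α : TangentSpace 𝓘(ℝ, Coord n) x →L[ℝ] ℝ) : ℝ :=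
  -(1 / 2) * (sSup ((fun v => α v) '' {v | v ∈ S.future x ∧ S.F ⟨x, v⟩ = 1})) ^ 2

/-- The Legendre transform: for `α ∈ Ω*_x`, the unique `v ∈ Ω_x` with
`L(v) = L*(α) = α(v) / 2`. -/
def legendre {x : M} (α : TangentSpace 𝓘(ℝ, Coord n) x →L[ℝ] ℝ) : TangentSpace 𝓘(ℝ, Coord n) x :=
  Classical.epsilon fun v =>
    v ∈ S.future x ∧ S.L ⟨x, v⟩ = S.Lstar α ∧ S.Lstar α = α v / 2

/-- The differential `dh(x) ∈ T*_x M`. -/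
def diff (h : M → ℝ) (x : M) : TangentSpace 𝓘(ℝ, Coord n) x →L[ℝ] ℝ :=
  mfderiv 𝓘(ℝ, Coord n) 𝓘(ℝ, ℝ) h x

/-- `f` is temporal on the open set `U`: it is `C¹` and `-df(x) ∈ Ω*_x` for all `x ∈ U`. -/
def IsTemporalOn (f : M → ℝ) (U : Set M) : Prop :=
  ContMDiffOn 𝓘(ℝ, Coord n) 𝓘(ℝ, ℝ) 1 f U ∧ ∀ x ∈ U, -diff f x ∈ S.polarCone x

/-- The gradient vector field `∇h(x) = ℒ*(dh(x))` (for `-h` temporal). -/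
def grad (h : M → ℝ) (x : M) : TangentSpace 𝓘(ℝ, Coord n) x := S.legendre (diff h x)

end Spacetime

end Intrinsic

/-! ### Objects defined in a local coordinate system `e` -/

section Chart

variable {n : ℕ} {M : Type*} [TopologicalSpace M] [ChartedSpace (Coord n) M]
  (e : OpenPartialHomeomorph M (Coord n))

/-- The components `(vⁱ)` of a tangent vector at `x`. -/
def toCoord (x : M) : TangentSpace 𝓘(ℝ, Coord n) x →L[ℝ] Coord n :=
  mfderiv 𝓘(ℝ, Coord n) 𝓘(ℝ, Coord n) e x

/-- The tangent vector `∑ vⁱ ∂/∂xⁱ` at the point with coordinates `p`. -/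
def ofCoord (p : Coord n) : Coord n →L[ℝ] TangentSpace 𝓘(ℝ, Coord n) (e.symm p) :=
  mfderiv 𝓘(ℝ, Coord n) 𝓘(ℝ, Coord n) e.symm p

/-- The tangent vector `∑ vⁱ ∂/∂xⁱ` at `x`. -/
def ofCoordAt (x : M) : Coord n →L[ℝ] TangentSpace 𝓘(ℝ, Coord n) x :=
  mfderiv 𝓘(ℝ, Coord n) 𝓘(ℝ, Coord n) e.symm (e x)

/-- The components `Vⁱ` of a vector field as functions of the coordinates. -/
def fieldCoord (V : ∀ x : M, TangentSpace 𝓘(ℝ, Coord n) x) (p : Coord n) : Coord n :=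
  toCoord e (e.symm p) (V (e.symm p))

/-- The endomorphism of `T_x M` whose matrix in the basis `∂/∂xⁱ` is `A`. -/
def endOfMatrix (x : M) (A : Matrix (Fin n) (Fin n) ℝ) :
    TangentSpace 𝓘(ℝ, Coord n) x →ₗ[ℝ] TangentSpace 𝓘(ℝ, Coord n) x :=
  (ofCoordAt e x).toLinearMap ∘ₗ Matrix.toEuclideanLin A ∘ₗ (toCoord e x).toLinearMap

/-- The velocity vector `η̇(t)` of a curve in `M`. -/
def velocity (η : ℝ → M) (t : ℝ) : TangentBundle 𝓘(ℝ, Coord n) M :=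
  ⟨η t, mfderiv 𝓘(ℝ, ℝ) 𝓘(ℝ, Coord n) η t (1 : ℝ)⟩

variable [IsManifold 𝓘(ℝ, Coord n) ∞ M]

namespace LorentzFinsler

variable (S : LorentzFinsler n M)

/-- The coordinate expression of `L`. -/
def coordL (p v : Coord n) : ℝ := S.L ⟨e.symm p, ofCoord e p v⟩

/-- The covariant derivative `v ↦ D_v^w V` at `x` of a vector field `V`, with reference vector
`w ∈ T_x M`, as a linear map in `v`. -/
def covDeriv (x : M) (w : TangentSpace 𝓘(ℝ, Coord n) x)
    (V : ∀ x : M, TangentSpace 𝓘(ℝ, Coord n) x) :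
    TangentSpace 𝓘(ℝ, Coord n) x →ₗ[ℝ] TangentSpace 𝓘(ℝ, Coord n) x :=
  endOfMatrix e x <| Matrix.of fun i j =>
    partialBase j (fun p => fieldCoord e V p i) (e x)
      + ∑ k, chern (S.coordL e) i j k (e x) (toCoord e x w) * fieldCoord e V (e x) k

/-- The curvature endomorphism `R_v` of `T_x M`. -/
def curvatureEnd (x : M) (v : TangentSpace 𝓘(ℝ, Coord n) x) :
    TangentSpace 𝓘(ℝ, Coord n) x →ₗ[ℝ] TangentSpace 𝓘(ℝ, Coord n) x :=
  endOfMatrix e x <| Matrix.of fun i j => curvature (S.coordL e) i j (e x) (toCoord e x v)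

/-- The Ricci curvature `Ric(v) = trace R_v`. -/
def ricci (x : M) (v : TangentSpace 𝓘(ℝ, Coord n) x) : ℝ :=
  LinearMap.trace ℝ (TangentSpace 𝓘(ℝ, Coord n) x) (S.curvatureEnd e x v)

/-- `η : (-ε, ε) → M` is a geodesic contained in the domain of the chart `e`, that is,
`D^{η̇}_{η̇} η̇ = 0`. -/
def IsGeodesicIn (η : ℝ → M) (ε : ℝ) : Prop :=
  ContMDiffOn 𝓘(ℝ, ℝ) 𝓘(ℝ, Coord n) 2 η (Set.Ioo (-ε) ε) ∧
    ∀ t ∈ Set.Ioo (-ε) ε, η t ∈ e.source ∧ ∀ i : Fin n,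
      deriv (deriv fun s => e (η s)) t i
        + ∑ j, ∑ k, chern (S.coordL e) i j k (e (η t)) (deriv (fun s => e (η s)) t)
            * deriv (fun s => e (η s)) t j * deriv (fun s => e (η s)) t k = 0

/-- The geodesic `η : (-ε, ε) → M` with `η̇(0) = v`; only its germ at `0` is used, and this is
unique. -/
def geodesic (v : TangentBundle 𝓘(ℝ, Coord n) M) : ℝ → M :=
  @Classical.epsilon (ℝ → M) ⟨fun _ => v.1⟩ fun η =>
    ∃ ε : ℝ, 0 < ε ∧ S.IsGeodesicIn e η ε ∧ velocity (n := n) η 0 = v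

/-- The vector field `∇^W u = ∑ g^{ij}(W) ∂u/∂xʲ ∂/∂xⁱ` for a nowhere vanishing vector
field `W`. -/
def linGrad (W : ∀ x : M, TangentSpace 𝓘(ℝ, Coord n) x) (u : M → ℝ) (x : M) :
    TangentSpace 𝓘(ℝ, Coord n) x :=
  ofCoordAt e x <| WithLp.toLp 2 fun i => ∑ j,
    gUp (S.coordL e) i j (e x) (toCoord e x (W x)) * partialBase j (fun p => u (e.symm p)) (e x)

end LorentzFinsler

namespace Spacetime

variable (S : Spacetime n M)

/-- The Hessian `∇²h(v) = D_v^{∇h}[∇h]` at `x`. -/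
def hessian (h : M → ℝ) (x : M) :
    TangentSpace 𝓘(ℝ, Coord n) x →ₗ[ℝ] TangentSpace 𝓘(ℝ, Coord n) x :=
  S.covDeriv e x (S.grad h x) (S.grad h)

/-- The d'Alembertian `□h = trace ∇²h`. -/
def dAlembertian (h : M → ℝ) (x : M) : ℝ :=
  LinearMap.trace ℝ (TangentSpace 𝓘(ℝ, Coord n) x) (S.hessian e h x)

/-- `(e_i)` is an orthonormal basis of `(T_x M, g_{∇h})` with first member
`e_1 = ∇h(x) / F(∇h(x))`. -/
def IsAdaptedBasis (h : M → ℝ) (x : M)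
    (b : Module.Basis (Fin n) ℝ (TangentSpace 𝓘(ℝ, Coord n) x)) : Prop :=
  (∀ i j, i ≠ j → S.g (S.grad h x) (b i) (b j) = 0) ∧
  (∀ i, |S.g (S.grad h x) (b i) (b i)| = 1) ∧
  ∀ i : Fin n, (i : ℕ) = 0 → b i = (S.F ⟨x, S.grad h x⟩)⁻¹ • S.grad h x

/-- `HS_{∇h}(∇²h) = ∑ g_{∇h}(∇²_{e_i} h, e_j)² g_{∇h}(e_i, e_i) g_{∇h}(e_j, e_j)`. -/
def HS (h : M → ℝ) (x : M) (b : Module.Basis (Fin n) ℝ (TangentSpace 𝓘(ℝ, Coord n) x)) : ℝ :=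
  ∑ i, ∑ j, S.g (S.grad h x) (S.hessian e h x (b i)) (b j) ^ 2
    * S.g (S.grad h x) (b i) (b i) * S.g (S.grad h x) (b j) (b j)

end Spacetime

namespace WeightedSpacetime

variable [MeasurableSpace M] (S : WeightedSpacetime n M)

/-- The density of the measure in the chart `e`. -/
def density : Coord n → ℝ := Classical.epsilon (IsSmoothDensity S.m e)

/-- The function `Φ` with `m = e^Φ dx¹ ⋯ dxⁿ` on the domain of the chart `e`. -/
def logDensity (p : Coord n) : ℝ := Real.log (density e S p)

/-- The weight function `ψ_m(v)`, determined by
`m = e^{-ψ_m(v)} √(-det (g_{ij}(v))) dx¹ ⋯ dxⁿ`, that is,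
`ψ_m(v) = log √(-det (g_{ij}(v))) - Φ`. -/
def weight (v : TangentBundle 𝓘(ℝ, Coord n) M) : ℝ :=
  Real.log (Real.sqrt (-(gMatrix (S.coordL e) (e v.1) (toCoord e v.1 v.2)).det))
    - logDensity e S (e v.1)

/-- `ψ_m ∘ η̇` for the geodesic `η` with `η̇(0) = v`. -/
def weightAlong (v : TangentBundle 𝓘(ℝ, Coord n) M) (t : ℝ) : ℝ :=
  weight e S (velocity (S.geodesic e v) t)

/-- The weighted Ricci curvature `Ric_∞(v) = Ric(v) + (ψ_m ∘ η̇)''(0)`. -/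
def ricciInfty (x : M) (v : TangentSpace 𝓘(ℝ, Coord n) x) : ℝ :=
  S.ricci e x v + deriv (deriv (weightAlong e S ⟨x, v⟩)) 0

/-- The weighted d'Alembertian `□_m h = □h - (ψ_m ∘ η̇)'(0)`, where `η̇(0) = ∇h(x)`. -/
def wDAlembertian (h : M → ℝ) (x : M) : ℝ :=
  S.dAlembertian e h x - deriv (weightAlong e S ⟨x, S.grad h x⟩) 0

/-- The divergence `div_m V = ∑ (∂Vⁱ/∂xⁱ + Vⁱ ∂Φ/∂xⁱ)`. -/
def divergence (V : ∀ x : M, TangentSpace 𝓘(ℝ, Coord n) x) (x : M) : ℝ :=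
  ∑ i, (partialBase i (fun p => fieldCoord e V p i) (e x)
    + fieldCoord e V (e x) i * partialBase i (logDensity e S) (e x))

end WeightedSpacetime

end Chart

end FinslerSpacetime

end

/-!
# The Bochner-type identity on weighted Finsler spacetimes

In a chart the identity involves only the components `W` of `∇h`, the spray `G`, the nonlinear
connection `N` and `Φ`. With `H = (∂_j Wⁱ + Nⁱ_j(W))` the matrix of the Hessian, its four terms are

* the divergence of the field with components `-(Wʲ ∂_j Wⁱ + Gⁱ(W))`, the negative acceleration
  of `∇h` (`Spacetime.fieldCoord_linGrad`);
* the derivative along `W` of `□_m h = ∑ (∂_i Wⁱ + Wⁱ ∂_i Φ)`, the divergence of `∇h`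
  (`WeightedSpacetime.wDAlembertian_eq`);
* `Ric_∞(W)`, made of first derivatives of `G` and `N`, products of the `Nⁱ_j`, and derivatives of
  `Φ` up to order two (`LorentzFinsler.ricci_eq`, `WeightedSpacetime.weightAlong_derivs`);
* `HS = trace H²` (`Spacetime.HS_eq`).

Their sum vanishes for every non-vanishing field `W` of class `C²`, because second derivatives of
`W` commute; this is `IsCoordLagrangian.bochner_identity`. That `W` is a gradient field is used for
the first term and for the last: it makes `g_W H` symmetric, hence `H` self-adjoint, and
the trace of the square of a self-adjoint endomorphism is the signed sum of squares in any
orthonormal basis (`trace_comp_self_eq`). The expressions for the second and third terms come from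
Euler's identities for homogeneous functions, which give `Γⁱ_jk vᵏ = Nⁱ_j` and `Nⁱ_j vʲ = Gⁱ`, and
from Jacobi's formula, by which `log √(-det g)` changes by `∑ Nⁱ_i` along a geodesic.

It remains to see that `∇h` is of class `C²`, which rests on the Legendre transform being a well
defined inverse of `v ↦ dL_v`. Minimizing `L` on the slice `α = -1` of the causal cone gives
existence, and any vector satisfying the defining equations has `dL_v = α`. For uniqueness
(`IsLorentzNorm.fderiv_injOn`), every critical point of `L` on this compact connected slice is a
strict local minimum, and two strict local minima would force a further critical point of mountain
pass type (`fixedPoint_unique_of_descent`). As future-directed timelike vectors form an open subset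
of the tangent bundle (`Spacetime.eventually_mem_future`), the solution of `dL_v = dh` provided by
the inverse function theorem is the gradient (`Spacetime.contDiffAt_fieldCoord_grad`).
-/

open scoped Manifold ContDiff Topology
open MeasureTheory

set_option linter.unusedSectionVars false

namespace FinslerSpacetime

/-! ### Connectedness and a mountain pass lemma -/

/-- In a compact Hausdorff space, a directed intersection of closed preconnected sets is
preconnected. -/
lemma isPreconnected_iInter_of_directed {X ι : Type*} [TopologicalSpace X] [CompactSpace X]
    [T2Space X] [Nonempty ι] (S : ι → Set X) (hd : Directed (· ⊇ ·) S)
    (hc : ∀ i, IsClosed (S i)) (hp : ∀ i, IsPreconnected (S i)) :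
    IsPreconnected (⋂ i, S i) := by
  rw [isPreconnected_iff_subset_of_fully_disjoint_closed (isClosed_iInter hc)]
  intro u v hu hv huv hdisj
  obtain ⟨O, O', hO, hO', huO, hvO', hOO'⟩ := normal_separation hu hv hdisj
  obtain ⟨i, hi⟩ := exists_subset_nhds_of_isCompact hd (fun i => (hc i).isCompact)
    (U := O ∪ O') (fun x hx => (hO.union hO').mem_nhds
      (Set.union_subset_union huO hvO' (huv hx)))
  have hsub : (⋂ i, S i) ⊆ S i := Set.iInter_subset _ _
  rcases (hp i).subset_or_subset hO hO' hOO' hi with h | h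
  · left
    intro x hx
    refine (huv hx).resolve_right fun hxv => ?_
    exact Set.disjoint_left.1 hOO' (h (hsub hx)) (hvO' hxv)
  · right
    intro x hx
    refine (huv hx).resolve_left fun hxu => ?_
    exact Set.disjoint_left.1 hOO' (huO hxu) (h (hsub hx))

lemma closure_connectedComponentIn_inter_subset {X : Type*} [TopologicalSpace X] (Z : Set X)
    (a : X) : closure (connectedComponentIn Z a) ∩ Z ⊆ connectedComponentIn Z a := by
  by_cases ha : a ∈ Z
  · have hsub : connectedComponentIn Z a ⊆ closure (connectedComponentIn Z a) ∩ Z :=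
      fun x hx => ⟨subset_closure hx, connectedComponentIn_subset _ _ hx⟩
    exact (isPreconnected_connectedComponentIn.subset_closure hsub
      Set.inter_subset_left).subset_connectedComponentIn
      (hsub (mem_connectedComponentIn ha)) Set.inter_subset_right
  · simp [connectedComponentIn_eq_empty ha]

/-- A discrete mountain pass lemma. If `φ` strictly decreases `f` off its fixed points and every
fixed point is isolated in its sublevel set, then there is at most one fixed point: at the lowest
level joining two of them within a sublevel set, applying `φ` to the joining set would lower the
level. -/
lemma fixedPoint_unique_of_descent {X : Type*} [TopologicalSpace X] [CompactSpace X]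
    [T2Space X] [PreconnectedSpace X] {f : X → ℝ} (hf : Continuous f) {φ : X → X}
    (hφ : Continuous φ) (hle : ∀ x, φ x ≠ x → f (φ x) < f x)
    (hiso : ∀ x, φ x = x → ∀ᶠ u in 𝓝 x, f u ≤ f x → u = x) {a b : X}
    (ha : φ a = a) (hb : φ b = b) : a = b := by
  by_contra hab
  -- the levels at which `a` and `b` are joined
  let A : Set ℝ := {c | f a ≤ c ∧ b ∈ connectedComponentIn {x | f x ≤ c} a}
  have hle' : ∀ x, f (φ x) ≤ f x := fun x => by
    by_cases h : φ x = x
    · rw [h]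
    · exact (hle x h).le
  have hmemA : ∀ (T : Set X) (c : ℝ), IsPreconnected T → a ∈ T → b ∈ T → (∀ x ∈ T, f x ≤ c) →
      c ∈ A := fun T c hT haT hbT hTc =>
    ⟨hTc a haT, hT.subset_connectedComponentIn haT hTc hbT⟩
  have hAne : A.Nonempty := by
    obtain ⟨z, -, hz⟩ := isCompact_univ.exists_isMaxOn (s := (Set.univ : Set X)) ⟨a, trivial⟩
      hf.continuousOn
    exact ⟨f z, hmemA Set.univ _ isPreconnected_univ trivial trivial fun x hx => hz hx⟩
  have hAbdd : BddBelow A := ⟨f a, fun c hc => hc.1⟩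
  have : Nonempty A := hAne.to_subtype
  let S : A → Set X := fun c => connectedComponentIn {x | f x ≤ (c : ℝ)} a
  have hmono : ∀ c d : A, (c : ℝ) ≤ d → S c ⊆ S d := fun c d hcd =>
    connectedComponentIn_mono a fun x (hx : f x ≤ (c : ℝ)) => le_trans hx hcd
  have hSclosed : ∀ c, IsClosed (S c) := fun c =>
    isClosed_of_closure_subset fun x hx => closure_connectedComponentIn_inter_subset _ _
      ⟨hx, closure_minimal (connectedComponentIn_subset _ _)
        (isClosed_le hf continuous_const) hx⟩
  have hpre : IsPreconnected (⋂ c, S c) := by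
    refine isPreconnected_iInter_of_directed S ?_ hSclosed
      fun c => isPreconnected_connectedComponentIn
    intro c d
    rcases le_total (c : ℝ) d with h | h
    · exact ⟨c, subset_rfl, hmono c d h⟩
    · exact ⟨d, hmono d c h, subset_rfl⟩
  set K := ⋂ c, S c with hK
  have haK : a ∈ K := Set.mem_iInter.2 fun c => mem_connectedComponentIn c.2.1
  have hbK : b ∈ K := Set.mem_iInter.2 fun c => c.2.2
  have hKclosed : IsClosed K := isClosed_iInter hSclosed
  have hKle : ∀ x ∈ K, f x ≤ sInf A := fun x hx => le_csInf hAne fun c hc =>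
    connectedComponentIn_subset {x | f x ≤ c} a (Set.mem_iInter.1 hx ⟨c, hc⟩)
  -- a fixed point at the critical level would be an open and closed point of `K`, which is
  -- connected and contains two points
  have hlt : ∀ x ∈ K, f (φ x) < sInf A := by
    intro x hx
    by_cases hfx : φ x = x
    · rw [hfx]
      refine lt_of_le_of_ne (hKle x hx) fun heq => hab ?_
      obtain ⟨O, hO, hOo, hxO⟩ := eventually_nhds_iff.1 (hiso x hfx)
      have hKO : ∀ y ∈ K, y ∈ O → y = x := fun y hy hyO => hO y hyO (heq ▸ hKle y hy)
      have hcl : IsClosed ({x} : Set X) := isClosed_singleton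
      have hsub : K ⊆ {x} := by
        intro y hy
        by_contra hyx
        obtain ⟨w, hwK, hwO, hwx⟩ := hpre O {x}ᶜ hOo hcl.isOpen_compl
          (fun w _ => by
            by_cases hw : w = x
            · exact Or.inl (hw ▸ hxO)
            · exact Or.inr hw) ⟨x, hx, hxO⟩ ⟨y, hy, hyx⟩
        exact hwx (hKO w hwK hwO)
      rw [Set.mem_singleton_iff.1 (hsub haK), Set.mem_singleton_iff.1 (hsub hbK)]
    · exact (hle x hfx).trans_le (hKle x hx)
  obtain ⟨z, hzK, hz⟩ := hKclosed.isCompact.exists_isMaxOn ⟨a, haK⟩ (hf.comp hφ).continuousOn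
  have : f (φ z) ∈ A := hmemA (φ '' K) _ (hpre.image φ hφ.continuousOn) ⟨a, haK, ha⟩ ⟨b, hbK, hb⟩
    (by rintro _ ⟨y, hy, rfl⟩; exact hz hy)
  exact absurd (csInf_le hAbdd this) (not_le.2 (hlt z hzK))

/-! ### Lorentz norms on a vector space -/

section Fibre

variable {E : Type*} [NormedAddCommGroup E] [InnerProductSpace ℝ E]

/-- The properties of the restriction of a Lorentz–Finsler structure to one tangent space, the
signature of `g_v` entering through non-degeneracy and, at timelike `v`, positivity of `g_v` on the
`g_v`-orthogonal complement of `v`. -/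
structure IsLorentzNorm (L : E → ℝ) : Prop where
  contDiffOn : ContDiffOn ℝ ∞ L {0}ᶜ
  smul : ∀ v (c : ℝ), 0 < c → L (c • v) = c ^ 2 * L v
  nondegenerate : ∀ v ≠ 0, ∀ a, (∀ b, fderiv ℝ (fderiv ℝ L) v a b = 0) → a = 0
  pos_of_orthogonal : ∀ v ≠ 0, ∀ w ≠ 0, fderiv ℝ (fderiv ℝ L) v v v < 0 →
    fderiv ℝ (fderiv ℝ L) v v w = 0 → 0 < fderiv ℝ (fderiv ℝ L) v w w

/-- The non-zero causal vectors of `L` in the connected component of `X`. -/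
def causalCone (L : E → ℝ) (X : E) : Set E := connectedComponentIn {v | L v ≤ 0 ∧ v ≠ 0} X

/-- The future-directed timelike vectors of `L`, for the time orientation given by `X`. -/
def futureCone (L : E → ℝ) (X : E) : Set E :=
  {v | L v < 0} ∩ connectedComponentIn (closure {v | L v < 0} \ {0}) X

lemma hasDerivAt_smul_self {F : Type*} [NormedAddCommGroup F] [NormedSpace ℝ F] (v : F) :
    HasDerivAt (fun c : ℝ => c • v) v 1 := by
  simpa using (hasDerivAt_id (1 : ℝ)).smul_const v

namespace IsLorentzNorm

variable {L : E → ℝ}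

lemma map_zero (hL : IsLorentzNorm L) : L 0 = 0 := by
  have := hL.smul 0 2 two_pos
  rw [smul_zero] at this
  linarith

lemma ne_zero (hL : IsLorentzNorm L) {v : E} (hv : L v < 0) : v ≠ 0 := by
  rintro rfl
  exact absurd hL.map_zero hv.ne

lemma contDiffAt (hL : IsLorentzNorm L) {v : E} (hv : v ≠ 0) : ContDiffAt ℝ ∞ L v :=
  hL.contDiffOn.contDiffAt (isOpen_compl_singleton.mem_nhds hv)

lemma differentiableAt (hL : IsLorentzNorm L) {v : E} (hv : v ≠ 0) : DifferentiableAt ℝ L v :=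
  (hL.contDiffAt hv).differentiableAt (by simp)

lemma continuousAt (hL : IsLorentzNorm L) {v : E} (hv : v ≠ 0) : ContinuousAt L v :=
  (hL.contDiffAt hv).continuousAt

lemma contDiffAt_fderiv (hL : IsLorentzNorm L) {v : E} (hv : v ≠ 0) :
    ContDiffAt ℝ ∞ (fderiv ℝ L) v :=
  (hL.contDiffAt hv).fderiv_right (by simp)

lemma differentiableAt_fderiv (hL : IsLorentzNorm L) {v : E} (hv : v ≠ 0) :
    DifferentiableAt ℝ (fderiv ℝ L) v :=
  (hL.contDiffAt_fderiv hv).differentiableAt (by simp)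

lemma continuousAt_fderiv (hL : IsLorentzNorm L) {v : E} (hv : v ≠ 0) :
    ContinuousAt (fderiv ℝ L) v :=
  (hL.contDiffAt_fderiv hv).continuousAt

lemma continuousAt_fderiv_fderiv (hL : IsLorentzNorm L) {v : E} (hv : v ≠ 0) :
    ContinuousAt (fderiv ℝ (fderiv ℝ L)) v :=
  ((hL.contDiffAt_fderiv hv).fderiv_right (m := ∞) (by simp)).continuousAt

lemma fderiv_smul (hL : IsLorentzNorm L) {v : E} (hv : v ≠ 0) {c : ℝ} (hc : 0 < c) :
    fderiv ℝ L (c • v) = c • fderiv ℝ L v := by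
  have hcv : c • v ≠ 0 := smul_ne_zero hc.ne' hv
  have h1 : HasFDerivAt (fun w => L (c • w))
      ((fderiv ℝ L (c • v)).comp (c • ContinuousLinearMap.id ℝ E)) v :=
    (hL.differentiableAt hcv).hasFDerivAt.comp v ((hasFDerivAt_id v).const_smul c)
  have h2 : HasFDerivAt (fun w => L (c • w)) (c ^ 2 • fderiv ℝ L v) v := by
    have h3 : (fun w => L (c • w)) = fun w => c ^ 2 * L w := funext fun w => hL.smul w c hc
    rw [h3]
    exact (hL.differentiableAt hv).hasFDerivAt.const_mul (c ^ 2)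
  have h := h1.unique h2
  ext w
  have := congrArg (fun T => T w) h
  simp only [ContinuousLinearMap.comp_smul, ContinuousLinearMap.comp_id,
    smul_apply, smul_eq_mul] at this ⊢
  have h0 := hc.ne'
  field_simp at this
  linarith

lemma fderiv_self (hL : IsLorentzNorm L) {v : E} (hv : v ≠ 0) : fderiv ℝ L v v = 2 * L v := by
  have h1 : HasDerivAt (fun c : ℝ => L (c • v)) (fderiv ℝ L v v) 1 := by
    refine HasFDerivAt.comp_hasDerivAt (1 : ℝ) ?_ (hasDerivAt_smul_self v)
    simpa using (hL.differentiableAt hv).hasFDerivAt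
  have h2 : HasDerivAt (fun c : ℝ => c ^ 2 * L v) (2 * L v) 1 := by
    simpa using (hasDerivAt_pow 2 (1 : ℝ)).mul_const (L v)
  refine h1.unique (h2.congr_of_eventuallyEq ?_)
  filter_upwards [lt_mem_nhds (zero_lt_one (α := ℝ))] with c hc using hL.smul v c hc

lemma fderiv_fderiv_self (hL : IsLorentzNorm L) {v : E} (hv : v ≠ 0) :
    fderiv ℝ (fderiv ℝ L) v v = fderiv ℝ L v := by
  have h1 : HasDerivAt (fun c : ℝ => fderiv ℝ L (c • v)) (fderiv ℝ (fderiv ℝ L) v v) 1 := by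
    refine HasFDerivAt.comp_hasDerivAt (1 : ℝ) ?_ (hasDerivAt_smul_self v)
    simpa using (hL.differentiableAt_fderiv hv).hasFDerivAt
  have h2 : HasDerivAt (fun c : ℝ => c • fderiv ℝ L v) (fderiv ℝ L v) 1 :=
    hasDerivAt_smul_self (fderiv ℝ L v)
  refine h1.unique (h2.congr_of_eventuallyEq ?_)
  filter_upwards [lt_mem_nhds (zero_lt_one (α := ℝ))] with c hc using hL.fderiv_smul hv hc

lemma fderiv_ne_zero (hL : IsLorentzNorm L) {v : E} (hv : v ≠ 0) : fderiv ℝ L v ≠ 0 := fun h =>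
  hv (hL.nondegenerate v hv v fun b => by rw [hL.fderiv_fderiv_self hv, h]; rfl)

lemma hasDerivAt_line (hL : IsLorentzNorm L) (v w : E) (t : ℝ) (h : v + t • w ≠ 0) :
    HasDerivAt (fun s : ℝ => L (v + s • w)) (fderiv ℝ L (v + t • w) w) t := by
  have h1 : HasDerivAt (fun s : ℝ => v + s • w) w t := by
    simpa using ((hasDerivAt_id t).smul_const w).const_add v
  exact (hL.differentiableAt h).hasFDerivAt.comp_hasDerivAt t h1

/-- A uniform descent step along a vector field `Y` which `dL` bounds from below like a gradient. -/
lemma exists_descent_step (hL : IsLorentzNorm L) [FiniteDimensional ℝ E] {K : Set E}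
    (hK : IsCompact K) (hK0 : ∀ v ∈ K, v ≠ 0) {Y : E → E} (hY : ContinuousOn Y K)
    (hYd : ∀ v ∈ K, fderiv ℝ L v (Y v) = ‖Y v‖ ^ 2) :
    ∃ ε : ℝ, 0 < ε ∧ ∀ v ∈ K, ∀ t ∈ Set.Icc 0 ε,
      v - t • Y v ≠ 0 ∧ L (v - t • Y v) ≤ L v - t / 2 * ‖Y v‖ ^ 2 := by
  have : ProperSpace E := FiniteDimensional.proper ℝ E
  obtain ⟨r, hr, hrK⟩ := hK.exists_cthickening_subset_open
    (isOpen_compl_singleton (x := (0 : E))) hK0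
  obtain ⟨M, hM⟩ := hK.cthickening (r := r) |>.exists_bound_of_continuousOn
    (f := fderiv ℝ (fderiv ℝ L))
    fun u hu => (hL.continuousAt_fderiv_fderiv (hrK hu)).continuousWithinAt
  obtain ⟨R, hR⟩ := hK.exists_bound_of_continuousOn hY
  -- the first bound keeps `dL(Y)` above `‖Y‖² / 2` along the step, as `M` bounds `d²L` near `K`;
  -- the second keeps the step inside the neighbourhood of `K`
  refine ⟨min (1 / (2 * (|M| + 1))) (r / (|R| + 1)), by positivity, fun v hv t ht => ?_⟩
  have hball : ∀ s ∈ Set.Icc 0 t, v - s • Y v ∈ Metric.closedBall v r := fun s hs => by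
    rw [Metric.mem_closedBall, dist_eq_norm, sub_sub_cancel_left, norm_neg, norm_smul,
      Real.norm_of_nonneg hs.1]
    have h1 : s ≤ r / (|R| + 1) := hs.2.trans (ht.2.trans (min_le_right _ _))
    rw [le_div_iff₀ (by positivity)] at h1
    have h2 : ‖Y v‖ ≤ |R| + 1 := (hR v hv).trans ((le_abs_self R).trans (by linarith))
    exact (mul_le_mul_of_nonneg_left h2 hs.1).trans h1
  have hne : ∀ s ∈ Set.Icc 0 t, v - s • Y v ≠ 0 := fun s hs =>
    hrK (Metric.closedBall_subset_cthickening hv r (hball s hs))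
  have hlip : ∀ s ∈ Set.Icc 0 t, ‖fderiv ℝ L (v - s • Y v) - fderiv ℝ L v‖ ≤
      |M| * (s * ‖Y v‖) := fun s hs => by
    have := (convex_closedBall v r).norm_image_sub_le_of_norm_fderiv_le (𝕜 := ℝ)
      (f := fderiv ℝ L) (C := |M|)
      (fun u hu => hL.differentiableAt_fderiv
        (hrK (Metric.closedBall_subset_cthickening hv r hu)))
      (fun u hu => (hM u (Metric.closedBall_subset_cthickening hv r hu)).trans (le_abs_self M))
      (Metric.mem_closedBall_self hr.le) (hball s hs)
    rwa [sub_sub_cancel_left, norm_neg, norm_smul, Real.norm_of_nonneg hs.1] at this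
  refine ⟨hne t ⟨ht.1, le_rfl⟩, ?_⟩
  have hder : ∀ s ∈ Set.Icc 0 t, HasDerivAt (fun s : ℝ => L (v - s • Y v) + s / 2 * ‖Y v‖ ^ 2)
      (-fderiv ℝ L (v - s • Y v) (Y v) + 1 / 2 * ‖Y v‖ ^ 2) s := fun s hs => by
    have h1 := hL.hasDerivAt_line v (-Y v) s (by
      rw [smul_neg, ← sub_eq_add_neg]; exact hne s hs)
    simp only [smul_neg, ← sub_eq_add_neg, map_neg] at h1
    exact h1.add (((hasDerivAt_id s).div_const 2).mul_const _)
  have hanti : AntitoneOn (fun s : ℝ => L (v - s • Y v) + s / 2 * ‖Y v‖ ^ 2) (Set.Icc 0 t) := by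
    refine antitoneOn_of_deriv_nonpos (convex_Icc 0 t)
      (fun s hs => (hder s hs).continuousAt.continuousWithinAt)
      (fun s hs => (hder s (interior_subset hs)).differentiableAt.differentiableWithinAt)
      fun s hs => ?_
    have hs' := interior_subset hs
    rw [(hder s hs').deriv]
    have h1 : ‖(fderiv ℝ L (v - s • Y v) - fderiv ℝ L v) (Y v)‖ ≤ |M| * (s * ‖Y v‖) * ‖Y v‖ :=
      (ContinuousLinearMap.le_opNorm _ _).trans
        (mul_le_mul_of_nonneg_right (hlip s hs') (norm_nonneg _))
    rw [sub_apply, hYd v hv, Real.norm_eq_abs, abs_le] at h1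
    have h2 : s ≤ 1 / (2 * (|M| + 1)) := hs'.2.trans (ht.2.trans (min_le_left _ _))
    rw [le_div_iff₀ (by positivity)] at h2
    have h3 : |M| * s ≤ 1 / 2 := by nlinarith [hs'.1, abs_nonneg M]
    have h4 : |M| * s * ‖Y v‖ ^ 2 ≤ 1 / 2 * ‖Y v‖ ^ 2 :=
      mul_le_mul_of_nonneg_right h3 (by positivity)
    nlinarith [h1.1]
  have := hanti ⟨le_rfl, ht.1⟩ ⟨ht.1, le_rfl⟩ ht.1
  simp only [zero_smul, sub_zero, zero_div, zero_mul, add_zero] at this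
  linarith

end IsLorentzNorm

end Fibre

/-! ### Causal and future cones -/

section Fibre

variable {E : Type*} [NormedAddCommGroup E] [InnerProductSpace ℝ E]

namespace IsLorentzNorm

variable {L : E → ℝ} {X : E}

lemma isOpen_timelike (hL : IsLorentzNorm L) : IsOpen {v | L v < 0} :=
  isOpen_iff_mem_nhds.2 fun _ hv => (hL.continuousAt (hL.ne_zero hv)).eventually_lt_const hv

lemma exists_fderiv_neg (hL : IsLorentzNorm L) {v : E} (hv : v ≠ 0) : ∃ w, fderiv ℝ L v w < 0 := by
  obtain ⟨w, hw⟩ := DFunLike.ne_iff.1 (hL.fderiv_ne_zero hv)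
  rcases lt_or_gt_of_ne hw with h | h
  · exact ⟨w, h⟩
  · exact ⟨-w, by rw [map_neg]; exact neg_neg_of_pos h⟩

/-- A causal vector can be moved along a segment into the timelike vectors. -/
lemma exists_segment (hL : IsLorentzNorm L) {v : E} (hv : v ≠ 0) (hLv : L v ≤ 0) :
    ∃ w : E, ∃ δ : ℝ, 0 < δ ∧ ∀ t ∈ Set.Ioo 0 δ, L (v + t • w) < 0 := by
  obtain ⟨w, hw⟩ := hL.exists_fderiv_neg hv
  refine ⟨w, ?_⟩
  have hd : HasDerivAt (fun s : ℝ => L (v + s • w)) (fderiv ℝ L v w) 0 := by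
    simpa using hL.hasDerivAt_line v w 0 (by simpa using hv)
  have h1 : ∀ᶠ t in 𝓝[>] (0 : ℝ), slope (fun s : ℝ => L (v + s • w)) 0 t < 0 :=
    ((hasDerivAt_iff_tendsto_slope.1 hd).mono_left
      (nhdsWithin_mono _ fun t (ht : 0 < t) => ht.ne')).eventually_lt_const hw
  obtain ⟨δ, hδ, hsub⟩ := mem_nhdsGT_iff_exists_Ioo_subset.1 h1
  refine ⟨δ, hδ, fun t ht => ?_⟩
  have h2 := hsub ht
  simp only [Set.mem_ofPred_eq, slope_def_field, zero_smul, add_zero, sub_zero] at h2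
  rw [div_lt_iff₀ ht.1, zero_mul] at h2
  linarith

lemma mem_closure_of_segment {s : Set E} {v w : E} {δ : ℝ} (hδ : 0 < δ)
    (h : ∀ t ∈ Set.Ioo 0 δ, v + t • w ∈ s) : v ∈ closure s := by
  have hc : Filter.Tendsto (fun t : ℝ => v + t • w) (𝓝[>] 0) (𝓝 v) := by
    have : Continuous fun t : ℝ => v + t • w := by fun_prop
    simpa using (this.tendsto 0).mono_left nhdsWithin_le_nhds
  exact mem_closure_of_tendsto hc (Filter.eventually_of_mem (Ioo_mem_nhdsGT hδ) h)

lemma le_of_mem_closure (hL : IsLorentzNorm L) {s : Set E} (hs : ∀ v ∈ s, L v ≤ 0) {v : E}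
    (hv : v ≠ 0) (hvs : v ∈ closure s) : L v ≤ 0 := by
  have := mem_closure_iff_nhdsWithin_neBot.1 hvs
  exact le_of_tendsto ((hL.continuousAt hv).mono_left nhdsWithin_le_nhds)
    (eventually_mem_nhdsWithin.mono hs)

lemma closure_timelike_diff (hL : IsLorentzNorm L) :
    closure {v | L v < 0} \ {0} = {v | L v ≤ 0 ∧ v ≠ 0} := by
  ext v
  constructor
  · rintro ⟨h1, h2⟩
    exact ⟨hL.le_of_mem_closure (fun w (hw : L w < 0) => hw.le) h2 h1, h2⟩
  · rintro ⟨h1, h2⟩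
    obtain ⟨w, δ, hδ, h⟩ := hL.exists_segment h2 h1
    exact ⟨mem_closure_of_segment hδ h, h2⟩

lemma futureCone_eq (hL : IsLorentzNorm L) (X : E) :
    futureCone L X = {v | L v < 0} ∩ causalCone L X := by
  rw [futureCone, hL.closure_timelike_diff, causalCone]

lemma causalCone_subset : causalCone L X ⊆ {v | L v ≤ 0 ∧ v ≠ 0} :=
  connectedComponentIn_subset _ _

lemma subset_causalCone {T : Set E} (hT : IsPreconnected T) (hTZ : T ⊆ {v | L v ≤ 0 ∧ v ≠ 0})
    {v : E} (hvT : v ∈ T) (hv : v ∈ causalCone L X) : T ⊆ causalCone L X := by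
  rw [causalCone, connectedComponentIn_eq hv]
  exact hT.subset_connectedComponentIn hvT hTZ

lemma smul_mem_causalCone (hL : IsLorentzNorm L) {v : E} (hv : v ∈ causalCone L X) {c : ℝ}
    (hc : 0 < c) : c • v ∈ causalCone L X := by
  have hT : IsPreconnected ((fun t : ℝ => t • v) '' Set.Ioi 0) :=
    isPreconnected_Ioi.image _ (by fun_prop)
  refine subset_causalCone hT ?_ ⟨1, Set.mem_Ioi.2 one_pos, one_smul _ _⟩ hv ⟨c, hc, rfl⟩
  rintro _ ⟨t, ht, rfl⟩
  have h := causalCone_subset hv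
  exact ⟨by
    show L (t • v) ≤ 0
    rw [hL.smul v t ht]
    exact mul_nonpos_of_nonneg_of_nonpos (sq_nonneg t) h.1, smul_ne_zero (ne_of_gt ht) h.2⟩

lemma smul_mem_futureCone (hL : IsLorentzNorm L) {v : E} (hv : v ∈ futureCone L X) {c : ℝ}
    (hc : 0 < c) : c • v ∈ futureCone L X := by
  rw [hL.futureCone_eq] at hv ⊢
  exact ⟨by
    show L (c • v) < 0
    rw [hL.smul v c hc]
    exact mul_neg_of_pos_of_neg (pow_pos hc 2) hv.1, hL.smul_mem_causalCone hv.2 hc⟩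

/-- A preconnected set of timelike vectors meeting the future cone lies in it. -/
lemma subset_futureCone (hL : IsLorentzNorm L) {T : Set E} (hT : IsPreconnected T)
    (hTL : ∀ v ∈ T, L v < 0) {v : E} (hvT : v ∈ T) (hv : v ∈ futureCone L X) :
    T ⊆ futureCone L X := by
  rw [hL.futureCone_eq] at hv ⊢
  exact fun w hw => ⟨hTL w hw, subset_causalCone hT
    (fun u hu => ⟨(hTL u hu).le, hL.ne_zero (hTL u hu)⟩) hvT hv.2 hw⟩

lemma mem_futureCone_self (hL : IsLorentzNorm L) (hX : L X < 0) : X ∈ futureCone L X := by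
  rw [hL.futureCone_eq]
  exact ⟨hX, mem_connectedComponentIn ⟨hX.le, hL.ne_zero hX⟩⟩

lemma isOpen_futureCone (hL : IsLorentzNorm L) : IsOpen (futureCone L X) := by
  refine isOpen_iff_mem_nhds.2 fun v hv => ?_
  obtain ⟨r, hr, hball⟩ := Metric.isOpen_iff.1 hL.isOpen_timelike v hv.1
  exact Filter.mem_of_superset (Metric.ball_mem_nhds v hr)
    (hL.subset_futureCone (convex_ball v r).isPreconnected hball (Metric.mem_ball_self hr) hv)

lemma causalCone_subset_closure (hL : IsLorentzNorm L) :
    causalCone L X ⊆ closure (futureCone L X) := by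
  intro v hv
  have hv' := causalCone_subset hv
  obtain ⟨w, δ, hδ, h⟩ := hL.exists_segment hv'.2 hv'.1
  refine mem_closure_of_segment (w := w) hδ fun t ht => ?_
  rw [hL.futureCone_eq]
  refine ⟨h t ht, ?_⟩
  have hT : IsPreconnected ((fun t : ℝ => v + t • w) '' Set.Ico 0 δ) :=
    isPreconnected_Ico.image _ (by fun_prop)
  refine subset_causalCone hT ?_ ⟨0, ⟨le_rfl, hδ⟩, by simp⟩ hv ⟨t, ⟨ht.1.le, ht.2⟩, rfl⟩
  rintro _ ⟨s, hs, rfl⟩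
  rcases hs.1.eq_or_lt with h0 | h0
  · simpa [← h0] using hv'
  · exact ⟨(h s ⟨h0, hs.2⟩).le, hL.ne_zero (h s ⟨h0, hs.2⟩)⟩

lemma mem_causalCone_of_mem_closure (hL : IsLorentzNorm L) {v : E} (hv : v ≠ 0)
    (h : v ∈ closure (causalCone L X)) : v ∈ causalCone L X :=
  closure_connectedComponentIn_inter_subset _ _
    ⟨h, hL.le_of_mem_closure (fun _ hw => (causalCone_subset hw).1) hv h, hv⟩

lemma isClosed_causalCone_inter (hL : IsLorentzNorm L) {T : Set E} (hT : IsClosed T)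
    (h0 : (0 : E) ∉ T) : IsClosed (causalCone L X ∩ T) := by
  refine isClosed_of_closure_subset fun v hv => ?_
  have hvT : v ∈ T := hT.closure_subset_iff.2 Set.inter_subset_right hv
  exact ⟨hL.mem_causalCone_of_mem_closure (by rintro rfl; exact h0 hvT)
    (closure_mono Set.inter_subset_left hv), hvT⟩

/-- A section of the causal cone by radial rescaling is connected, as the cone is. -/
lemma isPreconnected_causalCone_inter_of_retract {T : Set E} {r : E → ℝ}
    (hr : ContinuousOn r (causalCone L X))
    (hmem : ∀ v ∈ causalCone L X, r v • v ∈ causalCone L X ∩ T)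
    (hone : ∀ v ∈ causalCone L X ∩ T, r v = 1) : IsPreconnected (causalCone L X ∩ T) := by
  have h : causalCone L X ∩ T = (fun v => r v • v) '' causalCone L X := by
    ext v
    constructor
    · intro hv
      exact ⟨v, hv.1, by simp only [hone v hv, one_smul]⟩
    · rintro ⟨w, hw, rfl⟩
      exact hmem w hw
  rw [h]
  exact isPreconnected_connectedComponentIn.image _ (hr.smul continuousOn_id)

section Sphere

variable [FiniteDimensional ℝ E]

lemma isCompact_causalCone_inter_sphere (hL : IsLorentzNorm L) :
    IsCompact (causalCone L X ∩ Metric.sphere 0 1) := by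
  have : ProperSpace E := FiniteDimensional.proper ℝ E
  exact (isCompact_sphere (0 : E) 1).of_isClosed_subset
    (hL.isClosed_causalCone_inter Metric.isClosed_sphere (by simp)) Set.inter_subset_right

lemma normalize_mem (hL : IsLorentzNorm L) {v : E} (hv : v ∈ causalCone L X) :
    ‖v‖⁻¹ • v ∈ causalCone L X ∩ Metric.sphere 0 1 := by
  have h0 : 0 < ‖v‖ := norm_pos_iff.2 (causalCone_subset hv).2
  refine ⟨hL.smul_mem_causalCone hv (inv_pos.2 h0), ?_⟩
  rw [mem_sphere_zero_iff_norm, norm_smul, norm_inv, norm_norm, inv_mul_cancel₀ h0.ne']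

/-- The future timelike vectors form a connected set: a gradient step maps the causal vectors of
norm one, a connected set, into it. -/
lemma isPreconnected_futureCone (hL : IsLorentzNorm L) (hX : L X < 0) :
    IsPreconnected (futureCone L X) := by
  have hC0 : ∀ v ∈ causalCone L X ∩ Metric.sphere 0 1, v ≠ 0 := fun v hv =>
    (causalCone_subset hv.1).2
  have hSpre : IsPreconnected (causalCone L X ∩ Metric.sphere 0 1) := by
    refine isPreconnected_causalCone_inter_of_retract (r := fun v => ‖v‖⁻¹) ?_
      (fun v hv => hL.normalize_mem hv) fun v hv => by simp [mem_sphere_zero_iff_norm.1 hv.2]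
    exact continuousOn_id.norm.inv₀ fun v hv => norm_ne_zero_iff.2 (causalCone_subset hv).2
  have : CompleteSpace E := FiniteDimensional.complete ℝ E
  let Y : E → E := fun v => (InnerProductSpace.toDual ℝ E).symm (fderiv ℝ L v)
  have hYc : ContinuousOn Y (causalCone L X ∩ Metric.sphere 0 1) := fun v hv =>
    ((InnerProductSpace.toDual ℝ E).symm.continuous.continuousAt.comp
      (hL.continuousAt_fderiv (hC0 v hv))).continuousWithinAt
  have hYd : ∀ v w, fderiv ℝ L v w = inner ℝ (Y v) w := fun v w => by
    simp only [Y, InnerProductSpace.toDual_symm_apply]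
  obtain ⟨ε, hε, hstep⟩ := hL.exists_descent_step hL.isCompact_causalCone_inter_sphere hC0 hYc
    fun v _ => by rw [hYd, real_inner_self_eq_norm_sq]
  have hYpos : ∀ v ≠ 0, 0 < ‖Y v‖ := fun v hv => norm_pos_iff.2 fun h =>
    hL.fderiv_ne_zero hv (by ext w; rw [hYd, h, inner_zero_left]; rfl)
  have hseg : ∀ v ∈ causalCone L X ∩ Metric.sphere 0 1,
      (fun t : ℝ => v - t • Y v) '' Set.Icc 0 ε ⊆ causalCone L X := fun v hv => by
    refine subset_causalCone (isPreconnected_Icc.image _ (by fun_prop)) ?_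
      ⟨0, ⟨le_rfl, hε.le⟩, by simp⟩ hv.1
    rintro _ ⟨t, ht, rfl⟩
    refine ⟨(hstep v hv t ht).2.trans ?_, (hstep v hv t ht).1⟩
    have := (causalCone_subset hv.1).1
    have h2 : 0 ≤ t / 2 * ‖Y v‖ ^ 2 := mul_nonneg (by linarith [ht.1]) (sq_nonneg _)
    linarith
  have hpush : ∀ v ∈ causalCone L X ∩ Metric.sphere 0 1, v - ε • Y v ∈ futureCone L X := by
    intro v hv
    rw [hL.futureCone_eq]
    refine ⟨(hstep v hv ε ⟨hε.le, le_rfl⟩).2.trans_lt ?_, hseg v hv ⟨ε, ⟨hε.le, le_rfl⟩, rfl⟩⟩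
    have := (causalCone_subset hv.1).1
    have h2 : 0 < ε / 2 * ‖Y v‖ ^ 2 := mul_pos (half_pos hε) (pow_pos (hYpos v (hC0 v hv)) 2)
    linarith
  set P := (fun v => v - ε • Y v) '' (causalCone L X ∩ Metric.sphere 0 1) with hP
  have hPpre : IsPreconnected P := hSpre.image _ (continuousOn_id.sub (hYc.const_smul ε))
  have hPsub : P ⊆ futureCone L X := by
    rintro _ ⟨v, hv, rfl⟩
    exact hpush v hv
  have hbase := hL.mem_futureCone_self hX
  rw [hL.futureCone_eq] at hbase
  refine isPreconnected_of_forall (‖X‖⁻¹ • X - ε • Y (‖X‖⁻¹ • X)) fun v hv => ?_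
  have hvC := hv
  rw [hL.futureCone_eq] at hvC
  have hv0 : 0 < ‖v‖ := norm_pos_iff.2 (hL.ne_zero hv.1)
  have hu := hL.normalize_mem hvC.2
  set u := ‖v‖⁻¹ • v with hu_def
  have hLu : L u < 0 := by
    rw [hu_def, hL.smul _ _ (inv_pos.2 hv0)]
    exact mul_neg_of_pos_of_neg (pow_pos (inv_pos.2 hv0) 2) hv.1
  have h1 : IsPreconnected ((fun t : ℝ => t • v) '' Set.Ioi 0) :=
    isPreconnected_Ioi.image _ (by fun_prop)
  have h2 : IsPreconnected ((fun t : ℝ => u - t • Y u) '' Set.Icc 0 ε) :=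
    isPreconnected_Icc.image _ (by fun_prop)
  refine ⟨((fun t : ℝ => t • v) '' Set.Ioi 0 ∪ (fun t : ℝ => u - t • Y u) '' Set.Icc 0 ε) ∪ P,
    ?_, Or.inr ⟨_, hL.normalize_mem hbase.2, rfl⟩,
    Or.inl (Or.inl ⟨1, Set.mem_Ioi.2 one_pos, one_smul _ _⟩), ?_⟩
  · refine Set.union_subset (Set.union_subset ?_ ?_) hPsub
    · rintro _ ⟨t, ht, rfl⟩
      exact hL.smul_mem_futureCone hv ht
    · rw [hL.futureCone_eq]
      intro w hw
      refine ⟨?_, hseg u hu hw⟩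
      obtain ⟨t, ht, rfl⟩ := hw
      refine (hstep u hu t ht).2.trans_lt ?_
      have h2 : 0 ≤ t / 2 * ‖Y u‖ ^ 2 := mul_nonneg (by linarith [ht.1]) (sq_nonneg _)
      linarith
  · exact IsPreconnected.union (u - ε • Y u) (Or.inr ⟨ε, ⟨hε.le, le_rfl⟩, rfl⟩) ⟨u, hu, rfl⟩
      (IsPreconnected.union u ⟨‖v‖⁻¹, Set.mem_Ioi.2 (inv_pos.2 hv0), rfl⟩
        ⟨0, ⟨le_rfl, hε.le⟩, by simp⟩ h1 h2) hPpre

end Sphere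

end IsLorentzNorm

end Fibre

/-! ### The Legendre transform -/

section Fibre

variable {E : Type*} [NormedAddCommGroup E] [InnerProductSpace ℝ E]

/-- The polar transform of `L`, as a function of a covector `α`. -/
noncomputable def dualValue (L : E → ℝ) (X : E) (α : E →L[ℝ] ℝ) : ℝ :=
  -(1 / 2) * (sSup ((fun v => α v) '' {v | v ∈ futureCone L X ∧ Real.sqrt (-2 * L v) = 1})) ^ 2

namespace IsLorentzNorm

variable {L : E → ℝ} {X : E} [FiniteDimensional ℝ E] {α : E →L[ℝ] ℝ}

lemma slice_mem (hL : IsLorentzNorm L) (hα : ∀ v ∈ causalCone L X, α v < 0) {v : E}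
    (hv : v ∈ causalCone L X) : (-α v)⁻¹ • v ∈ causalCone L X ∩ {v | α v = -1} := by
  have h0 : 0 < -α v := neg_pos.2 (hα v hv)
  refine ⟨hL.smul_mem_causalCone hv (inv_pos.2 h0), ?_⟩
  show α ((-α v)⁻¹ • v) = -1
  rw [map_smul, smul_eq_mul]
  have := (hα v hv).ne
  field_simp

lemma isPreconnected_slice (hL : IsLorentzNorm L) (hα : ∀ v ∈ causalCone L X, α v < 0) :
    IsPreconnected (causalCone L X ∩ {v | α v = -1}) := by
  refine isPreconnected_causalCone_inter_of_retract (r := fun v => (-α v)⁻¹) ?_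
    (fun v hv => hL.slice_mem hα hv) fun v hv => ?_
  · exact α.continuous.continuousOn.neg.inv₀ fun v hv => (neg_pos.2 (hα v hv)).ne'
  · have : α v = -1 := hv.2
    simp [this]

lemma isCompact_slice (hL : IsLorentzNorm L) (hα : ∀ v ∈ causalCone L X, α v < 0) :
    IsCompact (causalCone L X ∩ {v | α v = -1}) := by
  have : ProperSpace E := FiniteDimensional.proper ℝ E
  have hclosed : IsClosed (causalCone L X ∩ {v | α v = -1}) :=
    hL.isClosed_causalCone_inter (isClosed_eq α.continuous continuous_const) (by simp)
  rcases (causalCone L X ∩ Metric.sphere 0 1).eq_empty_or_nonempty with hemp | hne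
  · have : causalCone L X ∩ {v | α v = -1} = ∅ := by
      by_contra h
      obtain ⟨v, hv⟩ := Set.nonempty_iff_ne_empty.2 h
      exact hemp.subset (hL.normalize_mem hv.1)
    rw [this]
    exact isCompact_empty
  · obtain ⟨z, hz, hmax⟩ := hL.isCompact_causalCone_inter_sphere.exists_isMaxOn hne
      α.continuous.continuousOn
    have hαz : 0 < -α z := neg_pos.2 (hα z hz.1)
    refine (isCompact_closedBall (0 : E) (-α z)⁻¹).of_isClosed_subset hclosed fun v hv => ?_
    have hv0 : 0 < ‖v‖ := norm_pos_iff.2 (causalCone_subset hv.1).2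
    have h1 : α (‖v‖⁻¹ • v) ≤ α z := hmax (hL.normalize_mem hv.1)
    have hv1 : α v = -1 := hv.2
    rw [map_smul, smul_eq_mul, hv1] at h1
    rw [mem_closedBall_zero_iff, le_inv_comm₀ hv0 hαz]
    linarith

/-- The minimum of `L` on the slice `α = -1` of the causal cone controls `L` on the whole cone and
computes the polar transform. -/
lemma exists_dualValue_eq (hL : IsLorentzNorm L) (hX : L X < 0)
    (hα : ∀ v ∈ causalCone L X, α v < 0) :
    ∃ z ∈ futureCone L X, α z = -1 ∧ dualValue L X α = 1 / (4 * L z) ∧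
      ∀ w ∈ causalCone L X, L z * α w ^ 2 ≤ L w := by
  have hXf := hL.mem_futureCone_self hX
  have hXC : X ∈ causalCone L X := by
    rw [hL.futureCone_eq] at hXf
    exact hXf.2
  have hXs := hL.slice_mem hα hXC
  obtain ⟨z, hz, hmin⟩ := (hL.isCompact_slice hα).exists_isMinOn ⟨_, hXs⟩
    fun v hv => (hL.continuousAt (causalCone_subset hv.1).2).continuousWithinAt
  have hzneg : L z < 0 := by
    refine lt_of_le_of_lt (hmin hXs) ?_
    rw [hL.smul _ _ (inv_pos.2 (neg_pos.2 (hα X hXC)))]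
    exact mul_neg_of_pos_of_neg (pow_pos (inv_pos.2 (neg_pos.2 (hα X hXC))) 2) hX
  have hzf : z ∈ futureCone L X := by
    rw [hL.futureCone_eq]
    exact ⟨hzneg, hz.1⟩
  have hαz : α z = -1 := hz.2
  have hcone : ∀ w ∈ causalCone L X, L z * α w ^ 2 ≤ L w := fun w hw => by
    have h0 : 0 < -α w := neg_pos.2 (hα w hw)
    have h1 : L z ≤ L ((-α w)⁻¹ • w) := hmin (hL.slice_mem hα hw)
    rw [hL.smul _ _ (inv_pos.2 h0), inv_pow, ← div_eq_inv_mul, le_div_iff₀ (by positivity)] at h1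
    simpa using h1
  refine ⟨z, hzf, hαz, ?_, hcone⟩
  set a := Real.sqrt (-2 * L z) with ha
  have ha0 : 0 < a := Real.sqrt_pos.2 (by linarith)
  have ha2 : a ^ 2 = -2 * L z := Real.sq_sqrt (by linarith)
  -- the supremum is attained at `z / F(z)`
  have hsup : sSup ((fun v => α v) ''
      {v | v ∈ futureCone L X ∧ Real.sqrt (-2 * L v) = 1}) = -a⁻¹ := by
    refine IsGreatest.csSup_eq ⟨⟨a⁻¹ • z, ⟨hL.smul_mem_futureCone hzf (inv_pos.2 ha0), ?_⟩, ?_⟩, ?_⟩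
    · rw [hL.smul _ _ (inv_pos.2 ha0), show -2 * (a⁻¹ ^ 2 * L z) = 1 by
        field_simp
        rw [ha2]
        ring, Real.sqrt_one]
    · show α (a⁻¹ • z) = _
      rw [map_smul, hαz, smul_eq_mul, mul_neg_one]
    · rintro _ ⟨w, ⟨hw, hw1⟩, rfl⟩
      rw [hL.futureCone_eq] at hw
      have hLw : -2 * L w = 1 := by
        rw [Real.sqrt_eq_one] at hw1
        exact hw1
      have h1 := hcone w hw.2
      have h2 := hα w hw.2
      show α w ≤ -a⁻¹
      have h3 : a⁻¹ ^ 2 ≤ (-α w) ^ 2 := by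
        rw [inv_pow, inv_le_iff_one_le_mul₀ (by positivity), ha2]
        linarith
      have h4 := abs_le_of_sq_le_sq h3 (by linarith)
      linarith [le_abs_self a⁻¹]
  rw [dualValue, hsup, neg_sq, inv_pow, ha2]
  have := hzneg.ne
  field_simp
  norm_num

/-- Existence of the Legendre transform of a covector of the polar cone. -/
lemma exists_legendre (hL : IsLorentzNorm L) (hX : L X < 0)
    (hα : ∀ v ∈ causalCone L X, α v < 0) :
    ∃ v ∈ futureCone L X, L v = dualValue L X α ∧ dualValue L X α = α v / 2 := by
  obtain ⟨z, hz, hαz, hval, -⟩ := hL.exists_dualValue_eq hX hα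
  have hz0 : L z < 0 := hz.1
  have hc : 0 < (-2 * L z)⁻¹ := inv_pos.2 (by linarith)
  refine ⟨(-2 * L z)⁻¹ • z, hL.smul_mem_futureCone hz hc, ?_, ?_⟩
  · rw [hL.smul _ _ hc, hval]
    have := hz0.ne
    field_simp
    norm_num
  · rw [hval, map_smul, hαz, smul_eq_mul]
    have := hz0.ne
    field_simp
    norm_num

/-- The defining equations of the Legendre transform say that `α` is the differential of `L`:
`w ↦ α(w)² - 4 L*(α) L(w)` is minimal at such a vector. -/
lemma fderiv_eq_of_legendre (hL : IsLorentzNorm L) (hX : L X < 0)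
    (hα : ∀ v ∈ causalCone L X, α v < 0) {v : E} (hv : v ∈ futureCone L X)
    (h1 : L v = dualValue L X α) (h2 : dualValue L X α = α v / 2) : fderiv ℝ L v = α := by
  obtain ⟨z, hz, hαz, hval, hcone⟩ := hL.exists_dualValue_eq hX hα
  set D := dualValue L X α with hD
  have hz0 : L z < 0 := hz.1
  have hv0 : L v < 0 := hv.1
  have hvne := hL.ne_zero hv0
  have hD0 : D < 0 := h1 ▸ hv0
  have hmin : IsLocalMin (fun w => α w ^ 2 - 4 * D * L w) v := by
    filter_upwards [hL.isOpen_futureCone.mem_nhds hv] with w hw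
    rw [hL.futureCone_eq] at hw
    have h3 := hcone w hw.2
    have h4 : L z * (4 * D) = 1 := by
      rw [hval]
      have := hz0.ne
      field_simp
    have h5 : 4 * D * L w ≤ 4 * D * (L z * α w ^ 2) :=
      mul_le_mul_of_nonpos_left h3 (by linarith)
    have h6 : 4 * D * (L z * α w ^ 2) = α w ^ 2 := by
      rw [← mul_assoc, mul_comm (4 * D), h4, one_mul]
    have h7 : α v = 2 * D := by linarith
    have h8 : α v ^ 2 - 4 * D * L v = 0 := by rw [h1, h7]; ring
    show α v ^ 2 - 4 * D * L v ≤ _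
    rw [h8]
    linarith
  have hder : HasFDerivAt (fun w => α w ^ 2 - 4 * D * L w)
      ((2 * α v) • α - (4 * D) • fderiv ℝ L v) v := by
    refine HasFDerivAt.sub ?_ ((hL.differentiableAt hvne).hasFDerivAt.const_mul _)
    simpa using α.hasFDerivAt.pow 2
  have h := hmin.hasFDerivAt_eq_zero hder
  ext w
  have hw := congrArg (fun T => T w) h
  simp only [sub_apply, smul_apply, smul_eq_mul, zero_apply] at hw
  have h7 : α v = 2 * D := by linarith
  rw [h7] at hw
  have : 4 * D * (α w - fderiv ℝ L v w) = 0 := by linarith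
  rcases mul_eq_zero.1 this with h | h
  · linarith
  · linarith

/-- A critical point of `L` on a hyperplane `α = const` at a timelike vector is a strict local
minimum. -/
lemma eventually_eq_of_le (hL : IsLorentzNorm L) {v : E} (hv : L v < 0)
    (hcrit : ∀ w, α w = 0 → fderiv ℝ L v w = 0) :
    ∀ᶠ u in 𝓝 v, α u = α v → L u ≤ L v → u = v := by
  have : ProperSpace E := FiniteDimensional.proper ℝ E
  have hv0 := hL.ne_zero hv
  have hcomp : IsCompact (Metric.sphere (0 : E) 1 ∩ {w | α w = 0}) :=
    (isCompact_sphere 0 1).inter_right (isClosed_eq α.continuous continuous_const)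
  have hpos : ∀ᶠ u in 𝓝 v, ∀ w ∈ Metric.sphere (0 : E) 1 ∩ {w | α w = 0},
      0 < fderiv ℝ (fderiv ℝ L) u w w := by
    refine hcomp.eventually_forall_of_forall_eventually fun w hw => ?_
    have hw0 : w ≠ 0 := by
      rintro rfl
      simpa using hw.1
    have h1 : 0 < fderiv ℝ (fderiv ℝ L) v w w := by
      refine hL.pos_of_orthogonal v hv0 w hw0 ?_ ?_
      · rw [hL.fderiv_fderiv_self hv0, hL.fderiv_self hv0]
        linarith
      · rw [hL.fderiv_fderiv_self hv0]
        exact hcrit w hw.2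
    have hc : ContinuousAt (fun p : E × E => fderiv ℝ (fderiv ℝ L) p.1 p.2 p.2) (v, w) := by
      have h2 : ContinuousAt (fun p : E × E => fderiv ℝ (fderiv ℝ L) p.1) (v, w) :=
        ContinuousAt.comp (f := Prod.fst) (hL.continuousAt_fderiv_fderiv hv0) continuousAt_fst
      exact (h2.clm_apply continuousAt_snd).clm_apply continuousAt_snd
    exact hc.eventually_const_lt h1
  obtain ⟨r, hr, hball⟩ := Metric.eventually_nhds_iff_ball.1
    (hpos.and (isOpen_compl_singleton.eventually_mem hv0))
  filter_upwards [Metric.ball_mem_nhds v hr] with u hu hαu hLu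
  by_contra hne
  set w := u - v with hw
  have hw0 : w ≠ 0 := sub_ne_zero.2 hne
  have hαw : α w = 0 := by rw [hw, map_sub, hαu, sub_self]
  have hmem : ∀ t ∈ Set.Icc (0 : ℝ) 1, v + t • w ∈ Metric.ball v r := fun t ht => by
    have := (convex_ball v r).add_smul_sub_mem (Metric.mem_ball_self hr) hu ht
    exact this
  have hposw : ∀ t ∈ Set.Icc (0 : ℝ) 1, 0 < fderiv ℝ (fderiv ℝ L) (v + t • w) w w := fun t ht => by
    have h1 := (hball _ (hmem t ht)).1 (‖w‖⁻¹ • w) ⟨by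
      rw [mem_sphere_zero_iff_norm, norm_smul, norm_inv, norm_norm,
        inv_mul_cancel₀ (norm_ne_zero_iff.2 hw0)], by
      show α (‖w‖⁻¹ • w) = 0
      rw [map_smul, hαw, smul_zero]⟩
    simp only [map_smul, smul_apply, smul_eq_mul] at h1
    have h2 : 0 < ‖w‖⁻¹ := inv_pos.2 (norm_pos_iff.2 hw0)
    exact pos_of_mul_pos_right (pos_of_mul_pos_right h1 h2.le) h2.le
  have hd1 : ∀ t ∈ Set.Icc (0 : ℝ) 1,
      HasDerivAt (fun s : ℝ => L (v + s • w)) (fderiv ℝ L (v + t • w) w) t :=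
    fun t ht => hL.hasDerivAt_line v w t (hball _ (hmem t ht)).2
  have hd2 : ∀ t ∈ Set.Icc (0 : ℝ) 1, HasDerivAt (fun s : ℝ => fderiv ℝ L (v + s • w) w)
      (fderiv ℝ (fderiv ℝ L) (v + t • w) w w) t := fun t ht => by
    have h1 : HasDerivAt (fun s : ℝ => v + s • w) w t := by
      simpa using ((hasDerivAt_id t).smul_const w).const_add v
    have h2 := (hL.differentiableAt_fderiv (hball _ (hmem t ht)).2).hasFDerivAt.comp_hasDerivAt t h1
    have h3 := h2.clm_apply (hasDerivAt_const t w)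
    simpa using h3
  have hmono1 : StrictMonoOn (fun s : ℝ => fderiv ℝ L (v + s • w) w) (Set.Icc 0 1) := by
    refine strictMonoOn_of_deriv_pos (convex_Icc 0 1)
      (fun t ht => (hd2 t ht).continuousAt.continuousWithinAt) fun t ht => ?_
    rw [(hd2 t (interior_subset ht)).deriv]
    exact hposw t (interior_subset ht)
  have hmono2 : StrictMonoOn (fun s : ℝ => L (v + s • w)) (Set.Icc 0 1) := by
    refine strictMonoOn_of_deriv_pos (convex_Icc 0 1)
      (fun t ht => (hd1 t ht).continuousAt.continuousWithinAt) fun t ht => ?_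
    rw [(hd1 t (interior_subset ht)).deriv]
    rw [interior_Icc] at ht
    have := hmono1 ⟨le_rfl, zero_le_one⟩ ⟨ht.1.le, ht.2.le⟩ ht.1
    simpa [hcrit w hαw] using this
  have := hmono2 ⟨le_rfl, zero_le_one⟩ ⟨zero_le_one, le_rfl⟩ one_pos
  simp only [zero_smul, add_zero, one_smul, hw, add_sub_cancel] at this
  linarith

/-- Injectivity of `dL` on the future cone, over covectors of the polar cone. Two preimages would be
critical points of `L` on the compact connected slice `α = -1`, and all of these are strict local
minima, which the mountain pass lemma forbids. -/
lemma fderiv_injOn (hL : IsLorentzNorm L) (hα : ∀ v ∈ causalCone L X, α v < 0) {a b : E}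
    (ha : a ∈ futureCone L X) (hb : b ∈ futureCone L X) (haα : fderiv ℝ L a = α)
    (hbα : fderiv ℝ L b = α) : a = b := by
  have : CompleteSpace E := FiniteDimensional.complete ℝ E
  set K := causalCone L X ∩ {v | α v = -1} with hK
  have hK0 : ∀ v ∈ K, v ≠ 0 := fun v hv => (causalCone_subset hv.1).2
  have hKC : ∀ v ∈ K, L v ≤ 0 := fun v hv => (causalCone_subset hv.1).1
  -- `Y` is the gradient of `L` projected to the kernel of `α`
  let A : E := (InnerProductSpace.toDual ℝ E).symm α
  let G : E → E := fun v => (InnerProductSpace.toDual ℝ E).symm (fderiv ℝ L v)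
  let Y : E → E := fun v => G v - (inner ℝ A (G v) / ‖A‖ ^ 2) • A
  have hA : ∀ w, α w = inner ℝ A w := fun w => by
    simp only [A, InnerProductSpace.toDual_symm_apply]
  have hG : ∀ v w, fderiv ℝ L v w = inner ℝ (G v) w := fun v w => by
    simp only [G, InnerProductSpace.toDual_symm_apply]
  have haC : a ∈ causalCone L X := by rw [hL.futureCone_eq] at ha; exact ha.2
  have hbC : b ∈ causalCone L X := by rw [hL.futureCone_eq] at hb; exact hb.2
  have hA0 : ‖A‖ ^ 2 ≠ 0 := by
    refine pow_ne_zero 2 (norm_ne_zero_iff.2 fun h => ?_)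
    have := hα a haC
    rw [hA, h, inner_zero_left] at this
    exact lt_irrefl _ this
  have hαY : ∀ v, α (Y v) = 0 := fun v => by
    rw [hA, inner_sub_right, inner_smul_right, real_inner_self_eq_norm_sq, div_mul_cancel₀ _ hA0,
      sub_self]
  have hYd : ∀ v, fderiv ℝ L v (Y v) = ‖Y v‖ ^ 2 := fun v => by
    have h1 : G v = Y v + (inner ℝ A (G v) / ‖A‖ ^ 2) • A := by simp only [Y, sub_add_cancel]
    rw [hG, h1, inner_add_left, real_inner_self_eq_norm_sq, inner_smul_left, ← hA (Y v), hαY]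
    simp
  have hYc : ContinuousOn Y K := by
    have hGc : ContinuousOn G K := fun v hv =>
      ((InnerProductSpace.toDual ℝ E).symm.continuous.continuousAt.comp
        (hL.continuousAt_fderiv (hK0 v hv))).continuousWithinAt
    exact hGc.sub (((continuousOn_const.inner hGc).div_const _).smul continuousOn_const)
  have hKcomp : IsCompact K := hL.isCompact_slice hα
  have hKpre : IsPreconnected K := hL.isPreconnected_slice hα
  obtain ⟨ε, hε, hstep⟩ := hL.exists_descent_step hKcomp hK0 hYc fun v _ => hYd v
  have hmaps : ∀ v ∈ K, v - ε • Y v ∈ K := fun v hv => by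
    refine ⟨?_, ?_⟩
    · refine subset_causalCone (T := (fun t : ℝ => v - t • Y v) '' Set.Icc 0 ε)
        (isPreconnected_Icc.image _ (by fun_prop)) ?_
        ⟨0, ⟨le_rfl, hε.le⟩, by simp⟩ hv.1 ⟨ε, ⟨hε.le, le_rfl⟩, rfl⟩
      rintro _ ⟨t, ht, rfl⟩
      refine ⟨(hstep v hv t ht).2.trans ?_, (hstep v hv t ht).1⟩
      have := hKC v hv
      have h2 : 0 ≤ t / 2 * ‖Y v‖ ^ 2 := mul_nonneg (by linarith [ht.1]) (sq_nonneg _)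
      linarith
    · show α (v - ε • Y v) = -1
      rw [map_sub, map_smul, hαY, smul_zero, sub_zero]
      exact hv.2
  have hfix : ∀ v, v - ε • Y v = v ↔ Y v = 0 := fun v => by
    rw [sub_eq_self, smul_eq_zero, or_iff_right hε.ne']
  have : CompactSpace K := isCompact_iff_compactSpace.1 hKcomp
  have : PreconnectedSpace K := Subtype.preconnectedSpace hKpre
  let φ : K → K := fun v => ⟨v - ε • Y v, hmaps v v.2⟩
  have hφfix : ∀ v : K, φ v = v ↔ Y v = 0 := fun v => by rw [← hfix, Subtype.ext_iff]
  have hφc : Continuous φ := by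
    refine Continuous.subtype_mk ?_ _
    exact continuous_subtype_val.sub ((continuousOn_iff_continuous_domRestrict.1 hYc).const_smul ε)
  have hfc : Continuous fun v : K => L v := continuousOn_iff_continuous_domRestrict.1
    fun v hv => (hL.continuousAt (hK0 v hv)).continuousWithinAt
  have key := fun a b => fixedPoint_unique_of_descent hfc hφc (a := a) (b := b) (fun v hv => by
      have h1 : 0 < ‖Y v‖ := norm_pos_iff.2 (by rwa [Ne, hφfix] at hv)
      have h2 := (hstep v v.2 ε ⟨hε.le, le_rfl⟩).2
      have h3 : 0 < ε / 2 * ‖Y v‖ ^ 2 := by positivity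
      show L (v - ε • Y v) < L v
      linarith) (fun v hv => by
      rw [hφfix] at hv
      have hGv : G v = (inner ℝ A (G v) / ‖A‖ ^ 2) • A := sub_eq_zero.1 hv
      have hcrit : ∀ w, fderiv ℝ L v w = (inner ℝ A (G v) / ‖A‖ ^ 2) * α w := fun w => by
        rw [hG, hA]
        nth_rewrite 1 [hGv]
        rw [inner_smul_left]
        rfl
      have hneg : L v < 0 := by
        refine lt_of_le_of_ne (hKC v v.2) fun h0 => hL.fderiv_ne_zero (hK0 v v.2) ?_
        have h1 := hL.fderiv_self (hK0 v v.2)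
        have h2 : α v = -1 := v.2.2
        rw [hcrit, h0, h2] at h1
        ext w
        rw [hcrit, show inner ℝ A (G v) / ‖A‖ ^ 2 = 0 by linarith, zero_mul]
        rfl
      have h3 := hL.eventually_eq_of_le hneg (α := α) fun w hw => by rw [hcrit, hw, mul_zero]
      filter_upwards [continuous_subtype_val.continuousAt.eventually h3] with u hu hle
      exact Subtype.ext (hu (u.2.2.trans v.2.2.symm) hle))
  have hcritY : ∀ v, v ∈ futureCone L X → fderiv ℝ L v = α → ∀ c : ℝ, 0 < c → Y (c • v) = 0 := by
    intro v hv hvα c hc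
    have hGv : G (c • v) = c • A := by
      simp only [G, A]
      rw [hL.fderiv_smul (hL.ne_zero hv.1) hc, hvα]
      simp
    simp only [Y, hGv, inner_smul_right, real_inner_self_eq_norm_sq]
    rw [mul_div_assoc, div_self hA0, mul_one, sub_self]
  have hca : 0 < (-α a)⁻¹ := inv_pos.2 (neg_pos.2 (hα a haC))
  have hcb : 0 < (-α b)⁻¹ := inv_pos.2 (neg_pos.2 (hα b hbC))
  have h := key ⟨_, hL.slice_mem hα haC⟩ ⟨_, hL.slice_mem hα hbC⟩
    ((hφfix _).2 (hcritY a ha haα _ hca)) ((hφfix _).2 (hcritY b hb hbα _ hcb))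
  have h1 : (-α a)⁻¹ • a = (-α b)⁻¹ • b := congrArg Subtype.val h
  have h2 := congrArg (fderiv ℝ L) h1
  rw [hL.fderiv_smul (hL.ne_zero ha.1) hca, hL.fderiv_smul (hL.ne_zero hb.1) hcb, haα, hbα] at h2
  have h3 := congrArg (fun T => T a) h2
  simp only [smul_apply, smul_eq_mul] at h3
  have h4 := mul_right_cancel₀ (hα a haC).ne h3
  rw [h4] at h1
  exact smul_right_injective E hcb.ne' h1

end IsLorentzNorm

end Fibre

/-! ### Calculus on the slit tangent bundle -/

section CoordinateCalculus

variable {n : ℕ}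

/-- Smoothness of `f (x, v)` on the slit bundle `{(x, v) | x ∈ T, v ≠ 0}`. -/
def SmoothOnSlit (T : Set (Coord n)) (f : Coord n → Coord n → ℝ) : Prop :=
  ContDiffOn ℝ ∞ (fun z : Coord n × Coord n => f z.1 z.2) (T ×ˢ {0}ᶜ)

lemma sum_single (w : Coord n) : w = ∑ i, w i • EuclideanSpace.single i (1 : ℝ) := by
  ext j
  simp [Finset.sum_apply, Pi.single_apply]

namespace SmoothOnSlit

variable {T : Set (Coord n)} {f g : Coord n → Coord n → ℝ} {p v : Coord n}

lemma contDiffAt (hT : IsOpen T) (hf : SmoothOnSlit T f) (hp : p ∈ T) (hv : v ≠ 0) :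
    ContDiffAt ℝ ∞ (fun z : Coord n × Coord n => f z.1 z.2) (p, v) :=
  ContDiffOn.contDiffAt hf ((hT.prod isOpen_compl_singleton).mem_nhds ⟨hp, hv⟩)

lemma differentiableAt (hT : IsOpen T) (hf : SmoothOnSlit T f) (hp : p ∈ T) (hv : v ≠ 0) :
    DifferentiableAt ℝ (fun z : Coord n × Coord n => f z.1 z.2) (p, v) :=
  (hf.contDiffAt hT hp hv).differentiableAt (by simp)

lemma hasFDerivAt_fst (hT : IsOpen T) (hf : SmoothOnSlit T f) (hp : p ∈ T) (hv : v ≠ 0) :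
    HasFDerivAt (fun q => f q v) ((fderiv ℝ (fun z : Coord n × Coord n => f z.1 z.2) (p, v)).comp
      (ContinuousLinearMap.inl ℝ (Coord n) (Coord n))) p :=
  HasFDerivAt.comp (f := fun q : Coord n => (q, v)) p
    (hf.differentiableAt hT hp hv).hasFDerivAt (hasFDerivAt_prodMk_left p v)

lemma hasFDerivAt_snd (hT : IsOpen T) (hf : SmoothOnSlit T f) (hp : p ∈ T) (hv : v ≠ 0) :
    HasFDerivAt (fun w => f p w) ((fderiv ℝ (fun z : Coord n × Coord n => f z.1 z.2) (p, v)).comp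
      (ContinuousLinearMap.inr ℝ (Coord n) (Coord n))) v :=
  HasFDerivAt.comp (f := fun q : Coord n => (p, q)) v
    (hf.differentiableAt hT hp hv).hasFDerivAt (hasFDerivAt_prodMk_right p v)

lemma partialX_eq (hT : IsOpen T) (hf : SmoothOnSlit T f) (hp : p ∈ T) (hv : v ≠ 0) (i : Fin n) :
    partialX i f p v = fderiv ℝ (fun z : Coord n × Coord n => f z.1 z.2) (p, v)
      (EuclideanSpace.single i 1, 0) := by
  rw [partialX, (hf.hasFDerivAt_fst hT hp hv).fderiv]
  rfl

lemma partialV_eq (hT : IsOpen T) (hf : SmoothOnSlit T f) (hp : p ∈ T) (hv : v ≠ 0) (i : Fin n) :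
    partialV i f p v = fderiv ℝ (fun z : Coord n × Coord n => f z.1 z.2) (p, v)
      (0, EuclideanSpace.single i 1) := by
  rw [partialV, (hf.hasFDerivAt_snd hT hp hv).fderiv]
  rfl

lemma congr (hf : SmoothOnSlit T f) (h : ∀ p ∈ T, ∀ v ≠ 0, g p v = f p v) : SmoothOnSlit T g :=
  ContDiffOn.congr hf fun z hz => h z.1 hz.1 z.2 hz.2

lemma contDiffOn_fderiv (hT : IsOpen T) (hf : SmoothOnSlit T f) (a : Coord n × Coord n) :
    ContDiffOn ℝ ∞ (fun z => fderiv ℝ (fun z : Coord n × Coord n => f z.1 z.2) z a)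
      (T ×ˢ {0}ᶜ) :=
  (ContDiffOn.fderiv_of_isOpen hf (hT.prod isOpen_compl_singleton) (by simp)).clm_apply
    contDiffOn_const

lemma partialX (hT : IsOpen T) (hf : SmoothOnSlit T f) (i : Fin n) :
    SmoothOnSlit T (partialX i f) :=
  (hf.contDiffOn_fderiv hT (EuclideanSpace.single i 1, 0)).congr
    fun _ hz => hf.partialX_eq hT hz.1 hz.2 i

lemma partialV (hT : IsOpen T) (hf : SmoothOnSlit T f) (i : Fin n) :
    SmoothOnSlit T (partialV i f) :=
  (hf.contDiffOn_fderiv hT (0, EuclideanSpace.single i 1)).congr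
    fun _ hz => hf.partialV_eq hT hz.1 hz.2 i

lemma const (c : ℝ) : SmoothOnSlit T fun _ _ => c := contDiffOn_const

lemma fibreCoord (i : Fin n) : SmoothOnSlit T fun _ v => v i :=
  ((EuclideanSpace.proj i : Coord n →L[ℝ] ℝ).contDiff.comp contDiff_snd).contDiffOn

lemma add (hf : SmoothOnSlit T f) (hg : SmoothOnSlit T g) :
    SmoothOnSlit T fun p v => f p v + g p v := ContDiffOn.add hf hg

lemma sub (hf : SmoothOnSlit T f) (hg : SmoothOnSlit T g) :
    SmoothOnSlit T fun p v => f p v - g p v := ContDiffOn.sub hf hg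

lemma mul (hf : SmoothOnSlit T f) (hg : SmoothOnSlit T g) :
    SmoothOnSlit T fun p v => f p v * g p v := ContDiffOn.mul hf hg

lemma sum {ι : Type*} {s : Finset ι} {f : ι → Coord n → Coord n → ℝ}
    (hf : ∀ i ∈ s, SmoothOnSlit T (f i)) : SmoothOnSlit T fun p v => ∑ i ∈ s, f i p v :=
  ContDiffOn.sum hf

lemma prod {ι : Type*} {s : Finset ι} {f : ι → Coord n → Coord n → ℝ}
    (hf : ∀ i ∈ s, SmoothOnSlit T (f i)) : SmoothOnSlit T fun p v => ∏ i ∈ s, f i p v :=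
  contDiffOn_prod hf

lemma inv (hf : SmoothOnSlit T f) (h : ∀ p ∈ T, ∀ v ≠ 0, f p v ≠ 0) :
    SmoothOnSlit T fun p v => (f p v)⁻¹ := ContDiffOn.inv hf fun z hz => h z.1 hz.1 z.2 hz.2

/-- The chain rule in terms of the partial derivatives in `x` and in `v`. -/
lemma hasFDerivAt_comp {F : Type*} [NormedAddCommGroup F] [NormedSpace ℝ F] (hT : IsOpen T)
    (hf : SmoothOnSlit T f) {c u : F → Coord n} {c' u' : F →L[ℝ] Coord n} {q : F} (hp : c q ∈ T)
    (hv : u q ≠ 0) (hc : HasFDerivAt c c' q) (hu : HasFDerivAt u u' q) :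
    ∃ D : F →L[ℝ] ℝ, HasFDerivAt (fun q => f (c q) (u q)) D q ∧ ∀ w, D w =
      ∑ i, FinslerSpacetime.partialX i f (c q) (u q) * c' w i
        + ∑ i, FinslerSpacetime.partialV i f (c q) (u q) * u' w i := by
  refine ⟨_, HasFDerivAt.comp (f := fun q => (c q, u q)) q
    (hf.differentiableAt hT hp hv).hasFDerivAt (hc.prodMk hu), fun w => ?_⟩
  have h : (c' w, u' w) = ∑ i, c' w i • ((EuclideanSpace.single i (1 : ℝ) : Coord n), (0 : Coord n))
      + ∑ i, u' w i • ((0 : Coord n), (EuclideanSpace.single i (1 : ℝ) : Coord n)) := by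
    refine Prod.ext ?_ ?_
    · simpa [Prod.fst_sum] using sum_single (c' w)
    · simpa [Prod.snd_sum] using sum_single (u' w)
  simp only [ContinuousLinearMap.comp_apply, ContinuousLinearMap.prod_apply]
  rw [h, map_add, map_sum, map_sum]
  simp only [map_smul, smul_eq_mul, hf.partialX_eq hT hp hv, hf.partialV_eq hT hp hv]
  simp only [mul_comm]

lemma hasDerivAt_comp (hT : IsOpen T) (hf : SmoothOnSlit T f) {c u : ℝ → Coord n}
    {c' u' : Coord n} {t : ℝ} (hp : c t ∈ T) (hv : u t ≠ 0) (hc : HasDerivAt c c' t)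
    (hu : HasDerivAt u u' t) : HasDerivAt (fun t => f (c t) (u t))
      (∑ i, FinslerSpacetime.partialX i f (c t) (u t) * c' i
        + ∑ i, FinslerSpacetime.partialV i f (c t) (u t) * u' i) t := by
  obtain ⟨D, hD, hDw⟩ := hf.hasFDerivAt_comp hT hp hv hc.hasFDerivAt hu.hasFDerivAt
  have h := hD.hasDerivAt
  rw [hDw] at h
  simpa using h

end SmoothOnSlit

section Rules

variable {T : Set (Coord n)} {f g : Coord n → Coord n → ℝ} {p v : Coord n}

lemma partialX_congr (hT : IsOpen T) (h : ∀ p ∈ T, ∀ v ≠ 0, f p v = g p v) (hp : p ∈ T)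
    (hv : v ≠ 0) (i : Fin n) : partialX i f p v = partialX i g p v := by
  rw [partialX, partialX, Filter.EventuallyEq.fderiv_eq]
  filter_upwards [hT.mem_nhds hp] with q hq using h q hq v hv

lemma partialV_congr (h : ∀ v ≠ 0, f p v = g p v) (hv : v ≠ 0) (i : Fin n) :
    partialV i f p v = partialV i g p v := by
  rw [partialV, partialV, Filter.EventuallyEq.fderiv_eq]
  filter_upwards [isOpen_compl_singleton.mem_nhds hv] with q hq using h q hq

lemma fderiv_fderiv_comm (hT : IsOpen T) (hf : SmoothOnSlit T f) (hp : p ∈ T) (hv : v ≠ 0)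
    (a b : Coord n × Coord n) :
    fderiv ℝ (fun z => fderiv ℝ (fun z : Coord n × Coord n => f z.1 z.2) z a) (p, v) b =
      fderiv ℝ (fun z => fderiv ℝ (fun z : Coord n × Coord n => f z.1 z.2) z b) (p, v) a := by
  have h1 := hf.contDiffAt hT hp hv
  have h2 : DifferentiableAt ℝ (fderiv ℝ fun z : Coord n × Coord n => f z.1 z.2) (p, v) :=
    (h1.fderiv_right (m := ∞) (by simp)).differentiableAt (by simp)
  rw [fderiv_clm_apply h2 (differentiableAt_const _),
    fderiv_clm_apply h2 (differentiableAt_const _)]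
  have h3 := (h1.isSymmSndFDerivAt (by
    simpa using WithTop.coe_le_coe.2 (le_top : (2 : ℕ∞) ≤ ⊤))) a b
  simpa using h3.symm

lemma partialV_partialX (hT : IsOpen T) (hf : SmoothOnSlit T f) (hp : p ∈ T) (hv : v ≠ 0)
    (i j : Fin n) : partialV i (partialX j f) p v = partialX j (partialV i f) p v := by
  have hO := (hT.prod (isOpen_compl_singleton (x := (0 : Coord n)))).mem_nhds
    (show (p, v) ∈ _ from ⟨hp, hv⟩)
  rw [(hf.partialX hT j).partialV_eq hT hp hv, (hf.partialV hT i).partialX_eq hT hp hv,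
    Filter.EventuallyEq.fderiv_eq (Filter.mem_of_superset hO
      fun z hz => hf.partialX_eq hT hz.1 hz.2 j),
    Filter.EventuallyEq.fderiv_eq (Filter.mem_of_superset hO
      fun z hz => hf.partialV_eq hT hz.1 hz.2 i)]
  exact fderiv_fderiv_comm hT hf hp hv _ _

lemma partialV_partialV (hT : IsOpen T) (hf : SmoothOnSlit T f) (hp : p ∈ T) (hv : v ≠ 0)
    (i j : Fin n) : partialV i (partialV j f) p v = partialV j (partialV i f) p v := by
  have hO := (hT.prod (isOpen_compl_singleton (x := (0 : Coord n)))).mem_nhds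
    (show (p, v) ∈ _ from ⟨hp, hv⟩)
  rw [(hf.partialV hT j).partialV_eq hT hp hv, (hf.partialV hT i).partialV_eq hT hp hv,
    Filter.EventuallyEq.fderiv_eq (Filter.mem_of_superset hO
      fun z hz => hf.partialV_eq hT hz.1 hz.2 j),
    Filter.EventuallyEq.fderiv_eq (Filter.mem_of_superset hO
      fun z hz => hf.partialV_eq hT hz.1 hz.2 i)]
  exact fderiv_fderiv_comm hT hf hp hv _ _

lemma partialV_sum_mul (hT : IsOpen T) {a b : Fin n → Coord n → Coord n → ℝ}
    (ha : ∀ k, SmoothOnSlit T (a k)) (hb : ∀ k, SmoothOnSlit T (b k)) (hp : p ∈ T) (hv : v ≠ 0)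
    (i : Fin n) : partialV i (fun p v => ∑ k, a k p v * b k p v) p v =
      ∑ k, (partialV i (a k) p v * b k p v + a k p v * partialV i (b k) p v) := by
  have h : HasFDerivAt (fun w => ∑ k, a k p w * b k p w) _ v :=
    HasFDerivAt.fun_sum fun k _ => ((ha k).hasFDerivAt_snd hT hp hv).mul
      ((hb k).hasFDerivAt_snd hT hp hv)
  rw [partialV, h.fderiv, sum_apply]
  refine Finset.sum_congr rfl fun k _ => ?_
  rw [partialV, partialV, ((ha k).hasFDerivAt_snd hT hp hv).fderiv,
    ((hb k).hasFDerivAt_snd hT hp hv).fderiv]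
  simp only [add_apply, smul_apply, smul_eq_mul]
  ring

lemma partialX_sum_mul (hT : IsOpen T) {a b : Fin n → Coord n → Coord n → ℝ}
    (ha : ∀ k, SmoothOnSlit T (a k)) (hb : ∀ k, SmoothOnSlit T (b k)) (hp : p ∈ T) (hv : v ≠ 0)
    (i : Fin n) : partialX i (fun p v => ∑ k, a k p v * b k p v) p v =
      ∑ k, (partialX i (a k) p v * b k p v + a k p v * partialX i (b k) p v) := by
  have h : HasFDerivAt (fun w => ∑ k, a k w v * b k w v) _ p :=
    HasFDerivAt.fun_sum fun k _ => ((ha k).hasFDerivAt_fst hT hp hv).mul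
      ((hb k).hasFDerivAt_fst hT hp hv)
  rw [partialX, h.fderiv, sum_apply]
  refine Finset.sum_congr rfl fun k _ => ?_
  rw [partialX, partialX, ((ha k).hasFDerivAt_fst hT hp hv).fderiv,
    ((hb k).hasFDerivAt_fst hT hp hv).fderiv]
  simp only [add_apply, smul_apply, smul_eq_mul]
  ring

lemma partialV_sub (hT : IsOpen T) (hf : SmoothOnSlit T f) (hg : SmoothOnSlit T g) (hp : p ∈ T)
    (hv : v ≠ 0) (i : Fin n) : partialV i (fun p v => f p v - g p v) p v =
      partialV i f p v - partialV i g p v := by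
  rw [partialV, ((hf.hasFDerivAt_snd hT hp hv).fun_sub (hg.hasFDerivAt_snd hT hp hv)).fderiv,
    partialV,
    partialV, (hf.hasFDerivAt_snd hT hp hv).fderiv, (hg.hasFDerivAt_snd hT hp hv).fderiv]
  rfl

lemma partialV_const_mul (hT : IsOpen T) (hf : SmoothOnSlit T f) (hp : p ∈ T)
    (hv : v ≠ 0) (c : ℝ) (i : Fin n) : partialV i (fun p v => c * f p v) p v =
      c * partialV i f p v := by
  rw [partialV, ((hf.hasFDerivAt_snd hT hp hv).const_mul c).fderiv, partialV,
    (hf.hasFDerivAt_snd hT hp hv).fderiv]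
  rfl

lemma partialX_const_mul (hT : IsOpen T) (hf : SmoothOnSlit T f) (hp : p ∈ T)
    (hv : v ≠ 0) (c : ℝ) (i : Fin n) : partialX i (fun p v => c * f p v) p v =
      c * partialX i f p v := by
  rw [partialX, ((hf.hasFDerivAt_fst hT hp hv).const_mul c).fderiv, partialX,
    (hf.hasFDerivAt_fst hT hp hv).fderiv]
  rfl

lemma partialV_fibreCoord (i k : Fin n) (p v : Coord n) :
    partialV i (fun _ v => v k) p v = if k = i then 1 else 0 := by
  have h : HasFDerivAt (fun w : Coord n => w k) (EuclideanSpace.proj k : Coord n →L[ℝ] ℝ) v :=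
    (EuclideanSpace.proj k : Coord n →L[ℝ] ℝ).hasFDerivAt
  rw [partialV, h.fderiv]
  simp

lemma partialX_fibreCoord (i k : Fin n) (p v : Coord n) :
    partialX i (fun _ v => v k) p v = 0 := by
  simp [partialX]

lemma partialV_sum_fibreCoord_mul (hT : IsOpen T) {b : Fin n → Coord n → Coord n → ℝ}
    (hb : ∀ k, SmoothOnSlit T (b k)) (hp : p ∈ T) (hv : v ≠ 0) (i : Fin n) :
    partialV i (fun p v => ∑ k, v k * b k p v) p v =
      b i p v + ∑ k, v k * partialV i (b k) p v := by
  rw [partialV_sum_mul hT (a := fun k _ v => v k) SmoothOnSlit.fibreCoord hb hp hv,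
    Finset.sum_add_distrib]
  simp [partialV_fibreCoord]

lemma partialX_sum_fibreCoord_mul (hT : IsOpen T) {b : Fin n → Coord n → Coord n → ℝ}
    (hb : ∀ k, SmoothOnSlit T (b k)) (hp : p ∈ T) (hv : v ≠ 0) (i : Fin n) :
    partialX i (fun p v => ∑ k, v k * b k p v) p v = ∑ k, v k * partialX i (b k) p v := by
  rw [partialX_sum_mul hT (a := fun k _ v => v k) SmoothOnSlit.fibreCoord hb hp hv]
  simp [partialX_fibreCoord]

end Rules

end CoordinateCalculus

/-! ### The spray and the connections in coordinates -/

section CoordinateIdentities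

variable {n : ℕ}

/-- The coordinate expression of a Lorentz–Finsler structure over an open set `T`. Of the signature
of `g_v` only the sign of the determinant is recorded. -/
structure IsCoordLagrangian (T : Set (Coord n)) (l : Coord n → Coord n → ℝ) : Prop where
  isOpen : IsOpen T
  smooth : SmoothOnSlit T l
  smul : ∀ p ∈ T, ∀ v (c : ℝ), 0 < c → l p (c • v) = c ^ 2 * l p v
  det_neg : ∀ p ∈ T, ∀ v ≠ 0, (gMatrix l p v).det < 0

namespace IsCoordLagrangian

variable {T : Set (Coord n)} {l : Coord n → Coord n → ℝ} {p v : Coord n}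

/-! #### Smoothness -/

lemma smooth_gLow (H : IsCoordLagrangian T l) (i j : Fin n) : SmoothOnSlit T (gLow l i j) :=
  (H.smooth.partialV H.isOpen j).partialV H.isOpen i

lemma smooth_det (H : IsCoordLagrangian T l) : SmoothOnSlit T fun p v => (gMatrix l p v).det := by
  simp only [Matrix.det_apply']
  exact .sum fun σ _ => (SmoothOnSlit.const _).mul (.prod fun i _ => H.smooth_gLow _ _)

lemma smooth_gUp (H : IsCoordLagrangian T l) (i j : Fin n) : SmoothOnSlit T (gUp l i j) := by
  have h : ∀ p v, gUp l i j p v = ((gMatrix l p v).det)⁻¹ *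
      ((gMatrix l p v).updateRow j (Pi.single i 1)).det := fun p v => by
    rw [gUp, Matrix.inv_def, Matrix.smul_apply, Matrix.adjugate_apply, Ring.inverse_eq_inv',
      smul_eq_mul]
  refine SmoothOnSlit.congr (.mul (H.smooth_det.inv fun p hp v hv => (H.det_neg p hp v hv).ne) ?_)
    fun p _ v _ => h p v
  simp only [Matrix.det_apply']
  refine .sum fun σ _ => (SmoothOnSlit.const _).mul (.prod fun a _ => ?_)
  by_cases haj : σ a = j
  · simp only [haj, Matrix.updateRow_self]
    exact .const _
  · simp only [Matrix.updateRow_ne haj]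
    exact H.smooth_gLow _ _

lemma smooth_formalChristoffel (H : IsCoordLagrangian T l) (i j k : Fin n) :
    SmoothOnSlit T (formalChristoffel l i j k) :=
  (SmoothOnSlit.const _).mul (.sum fun m _ => (H.smooth_gUp i m).mul
    ((((H.smooth_gLow m k).partialX H.isOpen j).add ((H.smooth_gLow j m).partialX H.isOpen k)).sub
      ((H.smooth_gLow j k).partialX H.isOpen m)))

lemma smooth_spray (H : IsCoordLagrangian T l) (i : Fin n) : SmoothOnSlit T (spray l i) :=
  .sum fun j _ => .sum fun k _ => ((H.smooth_formalChristoffel i j k).mul (.fibreCoord j)).mul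
    (.fibreCoord k)

lemma smooth_nonlinConn (H : IsCoordLagrangian T l) (i j : Fin n) :
    SmoothOnSlit T (nonlinConn l i j) :=
  (SmoothOnSlit.const _).mul ((H.smooth_spray i).partialV H.isOpen j)

/-! #### Euler's identities -/

lemma gLow_symm (H : IsCoordLagrangian T l) (hp : p ∈ T) (hv : v ≠ 0) (i j : Fin n) :
    gLow l i j p v = gLow l j i p v :=
  partialV_partialV H.isOpen H.smooth hp hv i j

lemma partialX_gLow_symm (H : IsCoordLagrangian T l) (hp : p ∈ T) (hv : v ≠ 0) (i j k : Fin n) :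
    partialX k (gLow l i j) p v = partialX k (gLow l j i) p v :=
  partialX_congr H.isOpen (fun _ hp _ hv => H.gLow_symm hp hv i j) hp hv k

/-- The vertical derivatives of `g` are symmetric in the indices of `g`. -/
lemma partialV_gLow_symm (H : IsCoordLagrangian T l) (hp : p ∈ T) (hv : v ≠ 0) (i j k : Fin n) :
    partialV k (gLow l i j) p v = partialV k (gLow l j i) p v :=
  partialV_congr (fun _ hv => H.gLow_symm hp hv i j) hv k

/-- The vertical derivatives of `g` are symmetric in the index of the derivative and the
first index of `g`. -/
lemma partialV_gLow_comm (H : IsCoordLagrangian T l) (hp : p ∈ T) (hv : v ≠ 0) (i j k : Fin n) :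
    partialV k (gLow l i j) p v = partialV i (gLow l k j) p v :=
  partialV_partialV H.isOpen (H.smooth.partialV H.isOpen j) hp hv k i

lemma sum_mul_partialV (H : IsCoordLagrangian T l) (hp : p ∈ T) (hv : v ≠ 0) :
    ∑ k, v k * partialV k l p v = 2 * l p v := by
  have h1 : HasDerivAt (fun c : ℝ => l p (c • v)) (∑ k, v k * partialV k l p v) 1 := by
    have := H.smooth.hasDerivAt_comp H.isOpen (t := 1) (c := fun _ => p) (u := fun c : ℝ => c • v)
      hp (by simpa using hv) (hasDerivAt_const _ _) (hasDerivAt_smul_self v)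
    simpa [mul_comm] using this
  have h2 : HasDerivAt (fun c : ℝ => c ^ 2 * l p v) (2 * l p v) 1 := by
    simpa using (hasDerivAt_pow 2 (1 : ℝ)).mul_const (l p v)
  refine h1.unique (h2.congr_of_eventuallyEq ?_)
  filter_upwards [lt_mem_nhds (zero_lt_one (α := ℝ))] with c hc using H.smul p hp v c hc

lemma sum_mul_gLow (H : IsCoordLagrangian T l) (hp : p ∈ T) (hv : v ≠ 0) (i : Fin n) :
    ∑ k, v k * gLow l i k p v = partialV i l p v := by
  have h := partialV_congr (f := fun p v => ∑ k, v k * partialV k l p v)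
    (g := fun p v => 2 * l p v) (fun v hv => H.sum_mul_partialV hp hv) hv i
  rw [partialV_sum_fibreCoord_mul H.isOpen (fun k => H.smooth.partialV H.isOpen k) hp hv,
    partialV_const_mul H.isOpen H.smooth hp hv] at h
  simp only [gLow]
  linarith

lemma sum_mul_partialX_partialV (H : IsCoordLagrangian T l) (hp : p ∈ T) (hv : v ≠ 0) (i : Fin n) :
    ∑ k, v k * partialX i (partialV k l) p v = 2 * partialX i l p v := by
  have h := partialX_congr H.isOpen (f := fun p v => ∑ k, v k * partialV k l p v)
    (g := fun p v => 2 * l p v) (fun p hp v hv => H.sum_mul_partialV hp hv) hp hv i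
  rwa [partialX_sum_fibreCoord_mul H.isOpen (fun k => H.smooth.partialV H.isOpen k) hp hv,
    partialX_const_mul H.isOpen H.smooth hp hv] at h

lemma sum_mul_partialX_gLow (H : IsCoordLagrangian T l) (hp : p ∈ T) (hv : v ≠ 0) (i j : Fin n) :
    ∑ k, v k * partialX j (gLow l i k) p v = partialX j (partialV i l) p v := by
  have h := partialX_congr H.isOpen (f := fun p v => ∑ k, v k * gLow l i k p v)
    (g := partialV i l) (fun p hp v hv => H.sum_mul_gLow hp hv i) hp hv j
  rwa [partialX_sum_fibreCoord_mul H.isOpen (fun k => H.smooth_gLow i k) hp hv] at h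

lemma sum_mul_partialV_gLow (H : IsCoordLagrangian T l) (hp : p ∈ T) (hv : v ≠ 0) (i j : Fin n) :
    ∑ k, v k * partialV j (gLow l i k) p v = 0 := by
  have h := partialV_congr (f := fun p v => ∑ k, v k * gLow l i k p v)
    (g := partialV i l) (fun v hv => H.sum_mul_gLow hp hv i) hv j
  rw [partialV_sum_fibreCoord_mul H.isOpen (fun k => H.smooth_gLow i k) hp hv] at h
  have h2 := H.gLow_symm hp hv i j
  have h3 : partialV j (partialV i l) p v = gLow l j i p v := rfl
  linarith

/-! #### Raising and lowering indices -/

lemma sum_gLow_mul_sum_gUp_mul (H : IsCoordLagrangian T l) (hp : p ∈ T) (hv : v ≠ 0)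
    (c : Fin n → ℝ) (i : Fin n) :
    ∑ k, gLow l i k p v * ∑ m, gUp l k m p v * c m = c i := by
  have h : gMatrix l p v * (gMatrix l p v)⁻¹ = 1 :=
    Matrix.mul_nonsing_inv _ (H.det_neg p hp v hv).ne.isUnit
  have h2 : (gMatrix l p v).mulVec ((gMatrix l p v)⁻¹.mulVec c) = c := by
    rw [Matrix.mulVec_mulVec, h, Matrix.one_mulVec]
  exact congrFun h2 i

lemma eq_of_sum_gLow_mul_eq (H : IsCoordLagrangian T l) (hp : p ∈ T) (hv : v ≠ 0)
    {a b : Fin n → ℝ} (h : ∀ i, ∑ k, gLow l i k p v * a k = ∑ k, gLow l i k p v * b k) : a = b := by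
  have h2 : (gMatrix l p v).mulVec a = (gMatrix l p v).mulVec b := funext h
  exact Matrix.mulVec_injective_iff_isUnit.2
    ((Matrix.isUnit_iff_isUnit_det _).2 (H.det_neg p hp v hv).ne.isUnit) h2

lemma eq_sum_gUp_mul (H : IsCoordLagrangian T l) (hp : p ∈ T) (hv : v ≠ 0)
    {a c : Fin n → ℝ} (h : ∀ i, ∑ k, gLow l i k p v * a k = c i) (i : Fin n) :
    a i = ∑ m, gUp l i m p v * c m :=
  congrFun (g := fun i => ∑ m, gUp l i m p v * c m) (H.eq_of_sum_gLow_mul_eq hp hv fun i => by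
    rw [H.sum_gLow_mul_sum_gUp_mul hp hv, h]) i

lemma gUp_symm (H : IsCoordLagrangian T l) (hp : p ∈ T) (hv : v ≠ 0) (i j : Fin n) :
    gUp l i j p v = gUp l j i p v := by
  have h : (gMatrix l p v).transpose = gMatrix l p v := by
    ext i j
    exact H.gLow_symm hp hv j i
  have h2 : (gMatrix l p v)⁻¹.transpose = (gMatrix l p v)⁻¹ := by
    rw [Matrix.transpose_nonsing_inv, h]
  exact congrFun (congrFun h2 j) i

/-! #### The spray and the connections -/

lemma sum_gLow_mul_formalChristoffel (H : IsCoordLagrangian T l) (hp : p ∈ T) (hv : v ≠ 0)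
    (i j k : Fin n) : ∑ a, gLow l i a p v * formalChristoffel l a j k p v =
      1 / 2 * (partialX j (gLow l i k) p v + partialX k (gLow l j i) p v
        - partialX i (gLow l j k) p v) := by
  rw [← H.sum_gLow_mul_sum_gUp_mul hp hv (fun i => partialX j (gLow l i k) p v +
    partialX k (gLow l j i) p v - partialX i (gLow l j k) p v) i, Finset.mul_sum]
  refine Finset.sum_congr rfl fun a _ => ?_
  rw [formalChristoffel]
  ring

/-- The spray is the Euler–Lagrange spray. -/
lemma sum_gLow_mul_spray (H : IsCoordLagrangian T l) (hp : p ∈ T) (hv : v ≠ 0) (i : Fin n) :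
    ∑ a, gLow l i a p v * spray l a p v =
      ∑ k, v k * partialX k (partialV i l) p v - partialX i l p v := by
  have h1 : ∑ a, gLow l i a p v * spray l a p v =
      ∑ j, ∑ k, (∑ a, gLow l i a p v * formalChristoffel l a j k p v) * v j * v k := by
    simp only [spray, Finset.mul_sum, Finset.sum_mul]
    rw [Finset.sum_comm]
    refine Finset.sum_congr rfl fun j _ => ?_
    rw [Finset.sum_comm]
    refine Finset.sum_congr rfl fun k _ => Finset.sum_congr rfl fun a _ => ?_
    ring
  have h2 : ∑ j, ∑ k, partialX j (gLow l i k) p v * v j * v k =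
      ∑ k, v k * partialX k (partialV i l) p v := by
    refine Finset.sum_congr rfl fun j _ => ?_
    rw [← H.sum_mul_partialX_gLow hp hv i j, Finset.mul_sum]
    exact Finset.sum_congr rfl fun k _ => by ring
  have h3 : ∑ j, ∑ k, partialX k (gLow l j i) p v * v j * v k =
      ∑ k, v k * partialX k (partialV i l) p v := by
    rw [Finset.sum_comm, ← h2]
    refine Finset.sum_congr rfl fun k _ => Finset.sum_congr rfl fun j _ => ?_
    rw [H.partialX_gLow_symm hp hv j i k]
    ring
  have h4 : ∑ j, ∑ k, partialX i (gLow l j k) p v * v j * v k = 2 * partialX i l p v := by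
    rw [← H.sum_mul_partialX_partialV hp hv i]
    refine Finset.sum_congr rfl fun j _ => ?_
    rw [← H.sum_mul_partialX_gLow hp hv j i, Finset.mul_sum]
    exact Finset.sum_congr rfl fun k _ => by ring
  have h5 : ∑ a, gLow l i a p v * spray l a p v =
      1 / 2 * (∑ j, ∑ k, partialX j (gLow l i k) p v * v j * v k
        + ∑ j, ∑ k, partialX k (gLow l j i) p v * v j * v k
        - ∑ j, ∑ k, partialX i (gLow l j k) p v * v j * v k) := by
    rw [h1, ← Finset.sum_add_distrib, ← Finset.sum_sub_distrib, Finset.mul_sum]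
    refine Finset.sum_congr rfl fun j _ => ?_
    rw [← Finset.sum_add_distrib, ← Finset.sum_sub_distrib, Finset.mul_sum]
    refine Finset.sum_congr rfl fun k _ => ?_
    rw [H.sum_gLow_mul_formalChristoffel hp hv]
    ring
  rw [h5, h2, h3, h4]
  ring

/-- The nonlinear connection with its upper index lowered; the terms in the first derivatives of
`∂L/∂v` are skew-symmetric, all others symmetric. -/
lemma sum_gLow_mul_nonlinConn (H : IsCoordLagrangian T l) (hp : p ∈ T) (hv : v ≠ 0) (i j : Fin n) :
    ∑ a, gLow l i a p v * nonlinConn l a j p v =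
      1 / 2 * (∑ k, v k * partialX k (gLow l i j) p v - ∑ a, partialV a (gLow l i j) p v
        * spray l a p v + partialX j (partialV i l) p v - partialX i (partialV j l) p v) := by
  have hVi := H.smooth.partialV H.isOpen i
  have h := partialV_congr (f := fun p v => ∑ a, gLow l i a p v * spray l a p v)
    (g := fun p v => ∑ k, v k * partialX k (partialV i l) p v - partialX i l p v)
    (fun v hv => H.sum_gLow_mul_spray hp hv i) hv j
  rw [partialV_sum_mul H.isOpen (fun a => H.smooth_gLow i a) H.smooth_spray hp hv,
    partialV_sub H.isOpen
      (.sum fun k _ => (SmoothOnSlit.fibreCoord k).mul (hVi.partialX H.isOpen k))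
      (H.smooth.partialX H.isOpen i) hp hv,
    partialV_sum_fibreCoord_mul H.isOpen (fun k => hVi.partialX H.isOpen k) hp hv,
    partialV_partialX H.isOpen H.smooth hp hv, Finset.sum_add_distrib] at h
  have h2 : ∑ k, v k * partialV j (partialX k (partialV i l)) p v =
      ∑ k, v k * partialX k (gLow l i j) p v := by
    refine Finset.sum_congr rfl fun k _ => ?_
    rw [partialV_partialX H.isOpen hVi hp hv, H.partialX_gLow_symm hp hv i j k]
    rfl
  have h3 : ∑ a, partialV j (gLow l i a) p v * spray l a p v =
      ∑ a, partialV a (gLow l i j) p v * spray l a p v := by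
    refine Finset.sum_congr rfl fun a _ => ?_
    rw [H.partialV_gLow_symm hp hv i a j, H.partialV_gLow_comm hp hv a i j,
      H.partialV_gLow_symm hp hv j i a]
  have h4 : ∑ a, gLow l i a p v * nonlinConn l a j p v =
      1 / 2 * ∑ a, gLow l i a p v * partialV j (spray l a) p v := by
    rw [Finset.mul_sum]
    refine Finset.sum_congr rfl fun a _ => ?_
    rw [nonlinConn]
    ring
  rw [h2, h3] at h
  rw [h4]
  linarith

/-- Euler's identity for the spray, which is homogeneous of degree two. -/
lemma sum_nonlinConn_mul (H : IsCoordLagrangian T l) (hp : p ∈ T) (hv : v ≠ 0) (i : Fin n) :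
    ∑ j, nonlinConn l i j p v * v j = spray l i p v := by
  refine congrFun (f := fun i => ∑ j, nonlinConn l i j p v * v j) (g := fun i => spray l i p v)
    (H.eq_of_sum_gLow_mul_eq hp hv fun i => ?_) i
  have h1 : ∑ a, gLow l i a p v * ∑ j, nonlinConn l a j p v * v j =
      ∑ j, (∑ a, gLow l i a p v * nonlinConn l a j p v) * v j := by
    simp only [Finset.mul_sum, Finset.sum_mul]
    rw [Finset.sum_comm]
    exact Finset.sum_congr rfl fun j _ => Finset.sum_congr rfl fun a _ => by ring
  have h2 : ∑ j, (∑ k, v k * partialX k (gLow l i j) p v) * v j =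
      ∑ k, v k * partialX k (partialV i l) p v := by
    simp only [Finset.sum_mul]
    rw [Finset.sum_comm]
    refine Finset.sum_congr rfl fun k _ => ?_
    rw [← H.sum_mul_partialX_gLow hp hv i k, Finset.mul_sum]
    exact Finset.sum_congr rfl fun j _ => by ring
  have h3 : ∑ j, (∑ a, partialV a (gLow l i j) p v * spray l a p v) * v j = 0 := by
    simp only [Finset.sum_mul]
    rw [Finset.sum_comm]
    refine Finset.sum_eq_zero fun a _ => ?_
    rw [← mul_zero (spray l a p v), ← H.sum_mul_partialV_gLow hp hv i a, Finset.mul_sum]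
    exact Finset.sum_congr rfl fun j _ => by ring
  have h4 : ∑ j, partialX j (partialV i l) p v * v j =
      ∑ k, v k * partialX k (partialV i l) p v := Finset.sum_congr rfl fun j _ => mul_comm _ _
  have h5 : ∑ j, partialX i (partialV j l) p v * v j = 2 * partialX i l p v := by
    rw [← H.sum_mul_partialX_partialV hp hv i]
    exact Finset.sum_congr rfl fun j _ => mul_comm _ _
  have h6 : ∑ j, (∑ a, gLow l i a p v * nonlinConn l a j p v) * v j =
      1 / 2 * (∑ j, (∑ k, v k * partialX k (gLow l i j) p v) * v j
        - ∑ j, (∑ a, partialV a (gLow l i j) p v * spray l a p v) * v j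
        + ∑ j, partialX j (partialV i l) p v * v j
        - ∑ j, partialX i (partialV j l) p v * v j) := by
    rw [← Finset.sum_sub_distrib, ← Finset.sum_add_distrib, ← Finset.sum_sub_distrib,
      Finset.mul_sum]
    refine Finset.sum_congr rfl fun j _ => ?_
    rw [H.sum_gLow_mul_nonlinConn hp hv]
    ring
  rw [h1, h6, h2, h3, h4, h5, H.sum_gLow_mul_spray hp hv]
  ring

/-- Contracted with the reference vector, the Chern connection is the nonlinear connection. -/
lemma sum_chern_mul (H : IsCoordLagrangian T l) (hp : p ∈ T) (hv : v ≠ 0) (i j : Fin n) :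
    ∑ k, chern l i j k p v * v k = nonlinConn l i j p v := by
  refine congrFun (f := fun i => ∑ k, chern l i j k p v * v k)
    (g := fun i => nonlinConn l i j p v) (H.eq_of_sum_gLow_mul_eq hp hv fun i => ?_) i
  have hC : ∀ i k, ∑ b, gLow l i b p v * chern l b j k p v =
      1 / 2 * (partialX j (gLow l i k) p v + partialX k (gLow l j i) p v
        - partialX i (gLow l j k) p v)
      - 1 / 2 * ∑ m, (partialV m (gLow l i k) p v * nonlinConn l m j p v
        + partialV m (gLow l j i) p v * nonlinConn l m k p v
        - partialV m (gLow l j k) p v * nonlinConn l m i p v) := fun i k => by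
    rw [← H.sum_gLow_mul_formalChristoffel hp hv,
      ← H.sum_gLow_mul_sum_gUp_mul hp hv (fun a => ∑ m, (partialV m (gLow l a k) p v
        * nonlinConn l m j p v + partialV m (gLow l j a) p v * nonlinConn l m k p v
        - partialV m (gLow l j k) p v * nonlinConn l m a p v)) i, Finset.mul_sum,
      ← Finset.sum_sub_distrib]
    refine Finset.sum_congr rfl fun b _ => ?_
    rw [chern]
    simp only [Finset.mul_sum]
    ring_nf
    simp only [Finset.mul_sum]
    congr 1
    refine Finset.sum_congr rfl fun b _ => Finset.sum_congr rfl fun c _ => ?_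
    ring
  have h1 : ∑ a, gLow l i a p v * ∑ k, chern l a j k p v * v k =
      ∑ k, (∑ a, gLow l i a p v * chern l a j k p v) * v k := by
    simp only [Finset.mul_sum, Finset.sum_mul]
    rw [Finset.sum_comm]
    exact Finset.sum_congr rfl fun j _ => Finset.sum_congr rfl fun a _ => by ring
  have e1 : ∑ k, v k * partialX j (gLow l i k) p v = partialX j (partialV i l) p v :=
    H.sum_mul_partialX_gLow hp hv i j
  have e2 : ∑ k, v k * partialX i (gLow l j k) p v = partialX i (partialV j l) p v :=
    H.sum_mul_partialX_gLow hp hv j i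
  have e3 : ∑ k, v k * ∑ m, partialV m (gLow l i k) p v * nonlinConn l m j p v = 0 := by
    simp only [Finset.mul_sum]
    rw [Finset.sum_comm]
    refine Finset.sum_eq_zero fun a _ => ?_
    rw [← mul_zero (nonlinConn l a j p v), ← H.sum_mul_partialV_gLow hp hv i a, Finset.mul_sum]
    exact Finset.sum_congr rfl fun j _ => by ring
  have e4 : ∑ k, v k * ∑ m, partialV m (gLow l j k) p v * nonlinConn l m i p v = 0 := by
    simp only [Finset.mul_sum]
    rw [Finset.sum_comm]
    refine Finset.sum_eq_zero fun a _ => ?_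
    rw [← mul_zero (nonlinConn l a i p v), ← H.sum_mul_partialV_gLow hp hv j a, Finset.mul_sum]
    exact Finset.sum_congr rfl fun j _ => by ring
  have e5 : ∑ k, v k * ∑ m, partialV m (gLow l j i) p v * nonlinConn l m k p v =
      ∑ a, partialV a (gLow l i j) p v * spray l a p v := by
    simp only [Finset.mul_sum]
    rw [Finset.sum_comm]
    refine Finset.sum_congr rfl fun a _ => ?_
    rw [← H.sum_nonlinConn_mul hp hv, H.partialV_gLow_symm hp hv i j a, Finset.mul_sum]
    exact Finset.sum_congr rfl fun j _ => by ring
  have e6 : ∑ k, v k * partialX k (gLow l j i) p v = ∑ k, v k * partialX k (gLow l i j) p v :=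
    Finset.sum_congr rfl fun k _ => by rw [H.partialX_gLow_symm hp hv j i k]
  have h6 : ∑ k, (∑ a, gLow l i a p v * chern l a j k p v) * v k =
      1 / 2 * (∑ k, v k * partialX j (gLow l i k) p v + ∑ k, v k * partialX k (gLow l j i) p v
        - ∑ k, v k * partialX i (gLow l j k) p v)
      - 1 / 2 * (∑ k, v k * ∑ m, partialV m (gLow l i k) p v * nonlinConn l m j p v
        + ∑ k, v k * ∑ m, partialV m (gLow l j i) p v * nonlinConn l m k p v
        - ∑ k, v k * ∑ m, partialV m (gLow l j k) p v * nonlinConn l m i p v) := by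
    simp only [← Finset.sum_sub_distrib, ← Finset.sum_add_distrib, Finset.mul_sum]
    refine Finset.sum_congr rfl fun k _ => ?_
    rw [hC]
    simp only [mul_add, mul_sub, add_mul, sub_mul, Finset.mul_sum, Finset.sum_mul,
      Finset.sum_sub_distrib, Finset.sum_add_distrib]
    simp only [mul_comm, mul_left_comm, mul_assoc]
  rw [h1, h6, e1, e2, e3, e4, e5, e6, H.sum_gLow_mul_nonlinConn hp hv]
  ring

lemma sum_sum_chern_mul_mul (H : IsCoordLagrangian T l) (hp : p ∈ T) (hv : v ≠ 0) (i : Fin n) :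
    ∑ j, ∑ k, chern l i j k p v * v j * v k = spray l i p v := by
  rw [← H.sum_nonlinConn_mul hp hv]
  refine Finset.sum_congr rfl fun j _ => ?_
  rw [← H.sum_chern_mul hp hv, Finset.sum_mul]
  exact Finset.sum_congr rfl fun k _ => by ring

/-- The trace of the nonlinear connection: half the trace of the derivative of `g` along the
spray. -/
lemma sum_nonlinConn_diag (H : IsCoordLagrangian T l) (hp : p ∈ T) (hv : v ≠ 0) :
    ∑ i, nonlinConn l i i p v = 1 / 2 * ∑ i, ∑ j, gUp l i j p v *
      (∑ k, partialX k (gLow l j i) p v * v k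
        + ∑ k, partialV k (gLow l j i) p v * -spray l k p v) := by
  let A : Fin n → Fin n → ℝ := fun j i =>
    ∑ k, partialX k (gLow l j i) p v * v k + ∑ k, partialV k (gLow l j i) p v * -spray l k p v
  let B : Fin n → Fin n → ℝ := fun j i => partialX i (partialV j l) p v
  have h1 : ∀ i, nonlinConn l i i p v =
      ∑ j, gUp l i j p v * (1 / 2 * (A j i + (B j i - B i j))) := by
    intro i
    refine H.eq_sum_gUp_mul hp hv (a := fun a => nonlinConn l a i p v)
      (c := fun j => 1 / 2 * (A j i + (B j i - B i j))) (fun j => ?_) i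
    rw [H.sum_gLow_mul_nonlinConn hp hv]
    simp only [A, B, mul_neg, Finset.sum_neg_distrib, mul_comm (v _)]
    ring
  have h2 : ∑ i, ∑ j, gUp l i j p v * (B j i - B i j) = 0 := by
    have h3 : ∑ i, ∑ j, gUp l i j p v * (B j i - B i j) =
        -∑ i, ∑ j, gUp l i j p v * (B j i - B i j) := by
      conv_lhs => rw [Finset.sum_comm]
      simp only [← Finset.sum_neg_distrib]
      refine Finset.sum_congr rfl fun i _ => Finset.sum_congr rfl fun j _ => ?_
      rw [H.gUp_symm hp hv j i]
      ring
    linarith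
  have h4 : ∑ i, nonlinConn l i i p v = 1 / 2 * ∑ i, ∑ j, gUp l i j p v * A j i
      + 1 / 2 * ∑ i, ∑ j, gUp l i j p v * (B j i - B i j) := by
    simp only [Finset.mul_sum, ← Finset.sum_add_distrib]
    refine Finset.sum_congr rfl fun i _ => ?_
    rw [h1]
    exact Finset.sum_congr rfl fun j _ => by ring
  rw [h4, h2, mul_zero, add_zero]

end IsCoordLagrangian

end CoordinateIdentities

/-! ### Volume distortion and gradient fields in coordinates -/

section Determinant

variable {n : ℕ}

/-- Jacobi's formula for the derivative of the determinant along a curve of invertible matrices. -/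
lemma hasDerivAt_det {A : ℝ → Matrix (Fin n) (Fin n) ℝ} {A' : Matrix (Fin n) (Fin n) ℝ} {t : ℝ}
    (hA : ∀ i j, HasDerivAt (fun s => A s i j) (A' i j) t) (hdet : (A t).det ≠ 0) :
    HasDerivAt (fun s => (A s).det) ((A t).det * ∑ i, ∑ j, (A t)⁻¹ i j * A' j i) t := by
  let D : ContinuousMultilinearMap ℝ (fun _ : Fin n => Fin n → ℝ) ℝ :=
    ⟨(Matrix.detRowAlternating (R := ℝ) (n := Fin n)).toMultilinearMap,
      Continuous.matrix_det (A := fun M : Fin n → Fin n → ℝ => (M : Matrix (Fin n) (Fin n) ℝ))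
        continuous_id⟩
  have hA2 : HasDerivAt (fun s => (A s : Fin n → Fin n → ℝ)) A' t :=
    hasDerivAt_pi.2 fun i => hasDerivAt_pi.2 fun j => hA i j
  have h := (D.hasFDerivAt (x := (A t : Fin n → Fin n → ℝ))).comp_hasDerivAt t hA2
  have h2 : D.linearDeriv (A t) A' = (A t).det * ∑ i, ∑ j, (A t)⁻¹ i j * A' j i := by
    refine (ContinuousMultilinearMap.linearDeriv_apply D (A t : Fin n → Fin n → ℝ) A').trans ?_
    have h3 : ∀ i, D (Function.update (A t) i (A' i)) =
        ∑ j, (A t).det * ((A t)⁻¹ j i * A' i j) := fun i => by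
      have h4 : D (Function.update (A t) i (A' i)) = ((A t).updateRow i (A' i)).det := rfl
      rw [h4, ← Matrix.cramer_transpose_apply, Matrix.cramer_eq_adjugate_mulVec,
        ← Matrix.adjugate_transpose, Matrix.mulVec, dotProduct]
      refine Finset.sum_congr rfl fun j _ => ?_
      rw [Matrix.inv_def, Matrix.smul_apply, Ring.inverse_eq_inv', smul_eq_mul,
        Matrix.transpose_apply]
      field_simp
    simp only [h3]
    rw [Finset.sum_comm, Finset.mul_sum]
    exact Finset.sum_congr rfl fun i _ => by rw [Finset.mul_sum]
  rw [h2] at h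
  exact h

lemma hasDerivAt_log_sqrt_neg_det {A : ℝ → Matrix (Fin n) (Fin n) ℝ}
    {A' : Matrix (Fin n) (Fin n) ℝ} {t : ℝ}
    (hA : ∀ i j, HasDerivAt (fun s => A s i j) (A' i j) t) (hdet : (A t).det < 0) :
    HasDerivAt (fun s => Real.log (Real.sqrt (-(A s).det)))
      (1 / 2 * ∑ i, ∑ j, (A t)⁻¹ i j * A' j i) t := by
  have h := hasDerivAt_det hA hdet.ne
  have h2 := (h.neg.log (by simpa using hdet.ne)).div_const 2
  have h3 : (fun s => Real.log (Real.sqrt (-(A s).det))) =ᶠ[𝓝 t]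
      fun s => Real.log (-(A s).det) / 2 := by
    filter_upwards [h.continuousAt.eventually_lt_const hdet] with s hs
    rw [Real.log_sqrt (by linarith)]
  refine HasDerivAt.congr_of_eventuallyEq ?_ h3
  convert! h2 using 1
  simp only [Pi.neg_apply]
  have := hdet.ne
  field_simp

end Determinant

section CoordinateBochner

variable {n : ℕ} {T : Set (Coord n)} {l : Coord n → Coord n → ℝ} {p : Coord n}

lemma differentiableAt_fderiv_of_contDiffAt {E F : Type*} [NormedAddCommGroup E] [NormedSpace ℝ E]
    [NormedAddCommGroup F] [NormedSpace ℝ F] {f : E → F} {x : E} (hf : ContDiffAt ℝ 2 f x) :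
    DifferentiableAt ℝ (fderiv ℝ f) x :=
  (hf.fderiv_right (m := 1) (by norm_num)).differentiableAt (by simp)

lemma partialBase_partialBase_comm {u : Coord n → ℝ} (hu : ContDiffAt ℝ 2 u p) (i j : Fin n) :
    partialBase j (partialBase i u) p = partialBase i (partialBase j u) p := by
  have h2 := differentiableAt_fderiv_of_contDiffAt hu
  have h3 : ∀ i j, partialBase j (partialBase i u) p =
      fderiv ℝ (fderiv ℝ u) p (EuclideanSpace.single j 1) (EuclideanSpace.single i 1) :=
    fun i j => by
      show fderiv ℝ (fun q => fderiv ℝ u q (EuclideanSpace.single i 1)) p _ = _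
      rw [fderiv_clm_apply h2 (differentiableAt_const _)]
      simp
  rw [h3, h3]
  exact (hu.isSymmSndFDerivAt (by simp)) _ _

/-- The covariant derivative of a field with respect to itself, `∂_j W^i + N^i_j(W)`. -/
noncomputable def covMatrix (l : Coord n → Coord n → ℝ) (W : Coord n → Coord n) (p : Coord n) :
    Matrix (Fin n) (Fin n) ℝ :=
  Matrix.of fun i j => partialBase j (fun q => W q i) p + nonlinConn l i j p (W p)

lemma hasFDerivAt_coord {W : Coord n → Coord n} (hW : DifferentiableAt ℝ W p) (i : Fin n) :
    HasFDerivAt (fun q => W q i)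
      ((EuclideanSpace.proj i : Coord n →L[ℝ] ℝ).comp (fderiv ℝ W p)) p :=
  (EuclideanSpace.proj i : Coord n →L[ℝ] ℝ).hasFDerivAt.comp p hW.hasFDerivAt

lemma partialBase_coord {W : Coord n → Coord n} (hW : DifferentiableAt ℝ W p) (i j : Fin n) :
    partialBase j (fun q => W q i) p = fderiv ℝ W p (EuclideanSpace.single j 1) i := by
  rw [partialBase, (hasFDerivAt_coord hW i).fderiv]
  rfl

namespace SmoothOnSlit

lemma differentiableAt_comp_field {f : Coord n → Coord n → ℝ} (hT : IsOpen T)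
    (hf : SmoothOnSlit T f) {W : Coord n → Coord n} (hp : p ∈ T) (hv : W p ≠ 0)
    (hW : DifferentiableAt ℝ W p) : DifferentiableAt ℝ (fun q => f q (W q)) p := by
  obtain ⟨D, hD, -⟩ := hf.hasFDerivAt_comp hT (c := id) hp hv (hasFDerivAt_id p) hW.hasFDerivAt
  exact hD.differentiableAt

lemma partialBase_comp_field {f : Coord n → Coord n → ℝ} (hT : IsOpen T)
    (hf : SmoothOnSlit T f) {W : Coord n → Coord n} (hp : p ∈ T) (hv : W p ≠ 0)
    (hW : DifferentiableAt ℝ W p) (i : Fin n) : partialBase i (fun q => f q (W q)) p =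
      FinslerSpacetime.partialX i f p (W p)
        + ∑ k, FinslerSpacetime.partialV k f p (W p) * partialBase i (fun q => W q k) p := by
  obtain ⟨D, hD, hDw⟩ := hf.hasFDerivAt_comp hT (c := id) hp hv (hasFDerivAt_id p) hW.hasFDerivAt
  rw [partialBase, HasFDerivAt.fderiv (f := fun q => f q (W q)) hD, hDw]
  simp only [partialBase_coord hW]
  simp

end SmoothOnSlit

namespace IsCoordLagrangian

/-- Along a curve whose velocity satisfies the geodesic equation, the logarithmic volume
distortion changes by the trace of the nonlinear connection. -/
lemma hasDerivAt_log_sqrt_neg_det_geodesic (H : IsCoordLagrangian T l) {c u : ℝ → Coord n}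
    {u' : Coord n} {t : ℝ} (hp : c t ∈ T) (hv : u t ≠ 0) (hc : HasDerivAt c (u t) t)
    (hu : HasDerivAt u u' t) (hgeo : ∀ i, u' i = -spray l i (c t) (u t)) :
    HasDerivAt (fun s => Real.log (Real.sqrt (-(gMatrix l (c s) (u s)).det)))
      (∑ i, nonlinConn l i i (c t) (u t)) t := by
  have h := hasDerivAt_log_sqrt_neg_det (A := fun s => gMatrix l (c s) (u s))
    (A' := Matrix.of fun i j => ∑ k, partialX k (gLow l i j) (c t) (u t) * u t k
      + ∑ k, partialV k (gLow l i j) (c t) (u t) * u' k) (t := t)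
    (fun i j => (H.smooth_gLow i j).hasDerivAt_comp H.isOpen hp hv hc hu) (H.det_neg _ hp _ hv)
  rw [H.sum_nonlinConn_diag hp hv]
  simp only [hgeo] at h
  exact h

variable {W : Coord n → Coord n} {u : Coord n → ℝ}

/-- `g(W) H`, the Hessian with both indices lowered, is symmetric when `W` is a gradient field. -/
lemma sum_gLow_mul_covMatrix_symm (H : IsCoordLagrangian T l) (hp : p ∈ T) (hv : W p ≠ 0)
    (hW : DifferentiableAt ℝ W p) (hu : ContDiffAt ℝ 2 u p)
    (hleg : ∀ᶠ q in 𝓝 p, ∀ i, partialV i l q (W q) = partialBase i u q) (i j : Fin n) :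
    ∑ k, gLow l i k p (W p) * covMatrix l W p k j =
      ∑ k, gLow l j k p (W p) * covMatrix l W p k i := by
  have hder : ∀ i j, partialX j (partialV i l) p (W p)
      + ∑ k, gLow l i k p (W p) * partialBase j (fun q => W q k) p =
      partialBase j (partialBase i u) p := fun i j => by
    have h1 : partialBase j (fun q => partialV i l q (W q)) p =
        partialBase j (partialBase i u) p := by
      rw [partialBase, partialBase, Filter.EventuallyEq.fderiv_eq]
      filter_upwards [hleg] with q hq using hq i
    rw [← h1, (H.smooth.partialV H.isOpen i).partialBase_comp_field H.isOpen hp hv hW]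
    congr 1
    exact Finset.sum_congr rfl fun k _ => by rw [H.gLow_symm hp hv i k]; rfl
  have hexp : ∀ i j, ∑ k, gLow l i k p (W p) * covMatrix l W p k j =
      (partialBase j (partialBase i u) p - partialX j (partialV i l) p (W p)) +
      1 / 2 * (∑ k, W p k * partialX k (gLow l i j) p (W p)
        - ∑ a, partialV a (gLow l i j) p (W p) * spray l a p (W p)
        + partialX j (partialV i l) p (W p) - partialX i (partialV j l) p (W p)) := fun i j => by
    rw [← H.sum_gLow_mul_nonlinConn hp hv, ← hder i j]
    simp only [covMatrix, Matrix.of_apply, mul_add, Finset.sum_add_distrib]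
    ring
  rw [hexp i j, hexp j i, partialBase_partialBase_comm hu i j]
  have h4 : ∀ k, partialX k (gLow l i j) p (W p) = partialX k (gLow l j i) p (W p) :=
    fun k => H.partialX_gLow_symm hp hv i j k
  have h5 : ∀ k, partialV k (gLow l i j) p (W p) = partialV k (gLow l j i) p (W p) :=
    fun k => H.partialV_gLow_symm hp hv i j k
  simp only [h4, h5]
  ring

/-- The gradient of `-L(W)` with respect to `g_W`, for a gradient field `W`, is the negative
acceleration `-D_W W`. -/
lemma sum_gUp_mul_partialBase (H : IsCoordLagrangian T l) (hp : p ∈ T) (hv : W p ≠ 0)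
    (hW : DifferentiableAt ℝ W p) (hu : ContDiffAt ℝ 2 u p)
    (hleg : ∀ᶠ q in 𝓝 p, ∀ i, partialV i l q (W q) = partialBase i u q) (i : Fin n) :
    ∑ j, gUp l i j p (W p) * partialBase j (fun q => -l q (W q)) p =
      -(∑ j, partialBase j (fun q => W q i) p * W p j + spray l i p (W p)) := by
  have hval : ∀ j, partialBase j (fun q => -l q (W q)) p =
      -(partialX j l p (W p) + ∑ k, partialV k l p (W p) * partialBase j (fun q => W q k) p) := by
    intro j
    rw [← H.smooth.partialBase_comp_field H.isOpen hp hv hW, partialBase, fderiv_fun_neg]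
    rfl
  have hlow : ∀ j, ∑ k, gLow l j k p (W p) * ∑ a, covMatrix l W p k a * W p a =
      partialX j l p (W p) + ∑ k, partialV k l p (W p) * partialBase j (fun q => W q k) p := by
    intro j
    have h1 : ∑ k, gLow l j k p (W p) * ∑ a, covMatrix l W p k a * W p a =
        ∑ a, (∑ k, gLow l j k p (W p) * covMatrix l W p k a) * W p a := by
      simp only [Finset.mul_sum, Finset.sum_mul]
      rw [Finset.sum_comm]
      exact Finset.sum_congr rfl fun a _ => Finset.sum_congr rfl fun k _ => by ring
    have h2 : ∑ a, (∑ k, gLow l a k p (W p) * covMatrix l W p k j) * W p a =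
        ∑ k, partialV k l p (W p) * covMatrix l W p k j := by
      simp only [Finset.sum_mul]
      rw [Finset.sum_comm]
      refine Finset.sum_congr rfl fun k _ => ?_
      rw [← H.sum_mul_gLow hp hv k, Finset.sum_mul]
      refine Finset.sum_congr rfl fun a _ => ?_
      rw [H.gLow_symm hp hv a k]
      ring
    have h3 : ∑ k, partialV k l p (W p) * nonlinConn l k j p (W p) = partialX j l p (W p) := by
      have h4 : ∑ k, partialV k l p (W p) * nonlinConn l k j p (W p) =
          ∑ a, W p a * ∑ k, gLow l a k p (W p) * nonlinConn l k j p (W p) := by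
        simp only [Finset.mul_sum]
        rw [Finset.sum_comm]
        refine Finset.sum_congr rfl fun k _ => ?_
        rw [← H.sum_mul_gLow hp hv k, Finset.sum_mul]
        refine Finset.sum_congr rfl fun a _ => ?_
        rw [H.gLow_symm hp hv a k]
        ring
      have e1 : ∑ a, W p a * ∑ k, W p k * partialX k (gLow l a j) p (W p) =
          ∑ a, W p a * partialX a (partialV j l) p (W p) := by
        simp only [Finset.mul_sum]
        rw [Finset.sum_comm]
        refine Finset.sum_congr rfl fun k _ => ?_
        rw [← H.sum_mul_partialX_gLow hp hv j k, Finset.mul_sum]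
        refine Finset.sum_congr rfl fun a _ => ?_
        rw [H.partialX_gLow_symm hp hv a j k]
        ring
      have e2 : ∑ a, W p a * ∑ b, partialV b (gLow l a j) p (W p) * spray l b p (W p) = 0 := by
        simp only [Finset.mul_sum]
        rw [Finset.sum_comm]
        refine Finset.sum_eq_zero fun b _ => ?_
        rw [← mul_zero (spray l b p (W p)), ← H.sum_mul_partialV_gLow hp hv j b, Finset.mul_sum]
        refine Finset.sum_congr rfl fun a _ => ?_
        rw [H.partialV_gLow_symm hp hv a j b]
        ring
      have e3 := H.sum_mul_partialX_partialV hp hv j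
      have e4 : ∑ a, W p a * ∑ k, gLow l a k p (W p) * nonlinConn l k j p (W p) =
          1 / 2 * (∑ a, W p a * ∑ k, W p k * partialX k (gLow l a j) p (W p)
            - ∑ a, W p a * ∑ b, partialV b (gLow l a j) p (W p) * spray l b p (W p)
            + ∑ a, W p a * partialX j (partialV a l) p (W p)
            - ∑ a, W p a * partialX a (partialV j l) p (W p)) := by
        rw [← Finset.sum_sub_distrib, ← Finset.sum_add_distrib, ← Finset.sum_sub_distrib,
          Finset.mul_sum]
        refine Finset.sum_congr rfl fun a _ => ?_
        rw [H.sum_gLow_mul_nonlinConn hp hv]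
        ring
      rw [h4, e4, e1, e2, e3]
      ring
    rw [h1]
    simp only [H.sum_gLow_mul_covMatrix_symm hp hv hW hu hleg j]
    rw [h2]
    simp only [covMatrix, Matrix.of_apply, mul_add, Finset.sum_add_distrib]
    rw [h3]
    ring
  have hup := H.eq_sum_gUp_mul hp hv (a := fun k => ∑ a, covMatrix l W p k a * W p a) hlow i
  have hleft : ∑ j, gUp l i j p (W p) * partialBase j (fun q => -l q (W q)) p =
      -∑ a, covMatrix l W p i a * W p a := by
    rw [hup, ← Finset.sum_neg_distrib]
    refine Finset.sum_congr rfl fun j _ => ?_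
    rw [hval]
    ring
  rw [hleft, ← H.sum_nonlinConn_mul hp hv]
  simp only [covMatrix, Matrix.of_apply, add_mul, Finset.sum_add_distrib]

end IsCoordLagrangian

end CoordinateBochner

/-! ### The Bochner identity in coordinates -/

section CoordinateBochner

variable {n : ℕ} {T : Set (Coord n)} {l : Coord n → Coord n → ℝ} {p : Coord n}

lemma differentiableAt_partialBase {u : Coord n → ℝ} (hu : ContDiffAt ℝ 2 u p) (i : Fin n) :
    DifferentiableAt ℝ (partialBase i u) p :=
  (differentiableAt_fderiv_of_contDiffAt hu).clm_apply (differentiableAt_const _)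

lemma contDiffAt_coord {W : Coord n → Coord n} {m : ℕ∞ω} (hW : ContDiffAt ℝ m W p) (i : Fin n) :
    ContDiffAt ℝ m (fun q => W q i) p :=
  (EuclideanSpace.proj i : Coord n →L[ℝ] ℝ).contDiff.contDiffAt.comp p hW

lemma partialBase_neg (i : Fin n) (u : Coord n → ℝ) :
    partialBase i (fun q => -u q) p = -partialBase i u p := by
  rw [partialBase, fderiv_fun_neg]
  rfl

lemma partialBase_add {u w : Coord n → ℝ} (hu : DifferentiableAt ℝ u p)
    (hw : DifferentiableAt ℝ w p) (i : Fin n) :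
    partialBase i (fun q => u q + w q) p = partialBase i u p + partialBase i w p := by
  rw [partialBase, fderiv_fun_add hu hw]
  rfl

lemma partialBase_mul {u w : Coord n → ℝ} (hu : DifferentiableAt ℝ u p)
    (hw : DifferentiableAt ℝ w p) (i : Fin n) : partialBase i (fun q => u q * w q) p =
      partialBase i u p * w p + u p * partialBase i w p := by
  rw [partialBase, fderiv_fun_mul hu hw]
  simp only [add_apply, smul_apply, smul_eq_mul, partialBase]
  ring

lemma partialBase_sum {ι : Type*} {s : Finset ι} {u : ι → Coord n → ℝ}
    (hu : ∀ k ∈ s, DifferentiableAt ℝ (u k) p) (i : Fin n) :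
    partialBase i (fun q => ∑ k ∈ s, u k q) p = ∑ k ∈ s, partialBase i (u k) p := by
  rw [partialBase, fderiv_fun_sum hu, sum_apply]
  rfl

/-- The acceleration field `D_W W` in coordinates. -/
noncomputable def accel (l : Coord n → Coord n → ℝ) (W : Coord n → Coord n) (i : Fin n)
    (q : Coord n) : ℝ :=
  ∑ j, partialBase j (fun r => W r i) q * W q j + spray l i q (W q)

/-- The divergence of a field with respect to the density `e^Φ`. -/
noncomputable def coordDiv (Φ : Coord n → ℝ) (W : Coord n → Coord n) (q : Coord n) : ℝ :=
  ∑ i, (partialBase i (fun r => W r i) q + W q i * partialBase i Φ q)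

/-- The second derivative of the weight function along a geodesic, in coordinates: the derivative
along the spray of its first derivative `∑ N^i_i(v) - ∑ vⁱ ∂Φ/∂xⁱ`. -/
noncomputable def weightSecond (l : Coord n → Coord n → ℝ) (Φ : Coord n → ℝ) (p v : Coord n) : ℝ :=
  ∑ k, ∑ i, (partialX k (nonlinConn l i i) p v * v k
      - partialV k (nonlinConn l i i) p v * spray l k p v)
    - ∑ i, ∑ k, v i * v k * partialBase k (partialBase i Φ) p
    + ∑ i, spray l i p v * partialBase i Φ p

variable {W : Coord n → Coord n} {Φ : Coord n → ℝ}

lemma differentiableAt_coordDiv (hW : ContDiffAt ℝ 2 W p) (hΦ : ContDiffAt ℝ 2 Φ p) :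
    DifferentiableAt ℝ (coordDiv Φ W) p := by
  refine DifferentiableAt.fun_sum fun i _ => ?_
  exact (differentiableAt_partialBase (contDiffAt_coord hW i) i).fun_add
    ((hasFDerivAt_coord (hW.differentiableAt (by simp)) i).differentiableAt.fun_mul
      (differentiableAt_partialBase hΦ i))

lemma partialBase_coordDiv (hW : ContDiffAt ℝ 2 W p) (hΦ : ContDiffAt ℝ 2 Φ p) (k : Fin n) :
    partialBase k (coordDiv Φ W) p = ∑ i, (partialBase k (partialBase i (fun r => W r i)) p
      + (partialBase k (fun r => W r i) p * partialBase i Φ p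
        + W p i * partialBase k (partialBase i Φ) p)) := by
  have hd : ∀ j, DifferentiableAt ℝ (partialBase j fun r => W r j) p := fun j =>
    differentiableAt_partialBase (contDiffAt_coord hW j) j
  have hc : ∀ j, DifferentiableAt ℝ (fun q => W q j) p := fun j =>
    (hasFDerivAt_coord (hW.differentiableAt (by simp)) j).differentiableAt
  have hf : ∀ j, DifferentiableAt ℝ (partialBase j Φ) p := differentiableAt_partialBase hΦ
  show partialBase k (fun q => ∑ i, (partialBase i (fun r => W r i) q
    + W q i * partialBase i Φ q)) p = _
  rw [partialBase_sum fun i _ => (hd i).fun_add ((hc i).fun_mul (hf i))]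
  refine Finset.sum_congr rfl fun i _ => ?_
  rw [partialBase_add (hd i) ((hc i).fun_mul (hf i)), partialBase_mul (hc i) (hf i)]

namespace IsCoordLagrangian

lemma differentiableAt_accel (H : IsCoordLagrangian T l) (hp : p ∈ T) (hv : W p ≠ 0)
    (hW : ContDiffAt ℝ 2 W p) (i : Fin n) : DifferentiableAt ℝ (accel l W i) p := by
  have hW1 : DifferentiableAt ℝ W p := hW.differentiableAt (by simp)
  refine DifferentiableAt.fun_add (DifferentiableAt.fun_sum fun j _ => ?_)
    ((H.smooth_spray i).differentiableAt_comp_field H.isOpen hp hv hW1)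
  exact (differentiableAt_partialBase (contDiffAt_coord hW i) j).fun_mul
    (hasFDerivAt_coord hW1 j).differentiableAt

lemma partialBase_accel (H : IsCoordLagrangian T l) (hp : p ∈ T) (hv : W p ≠ 0)
    (hW : ContDiffAt ℝ 2 W p) (i k : Fin n) : partialBase k (accel l W i) p =
      ∑ j, (partialBase j (partialBase k (fun r => W r i)) p * W p j
        + partialBase j (fun r => W r i) p * partialBase k (fun r => W r j) p)
      + (partialX k (spray l i) p (W p)
        + ∑ j, 2 * nonlinConn l i j p (W p) * partialBase k (fun r => W r j) p) := by
  have hW1 : DifferentiableAt ℝ W p := hW.differentiableAt (by simp)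
  have hd : ∀ j, DifferentiableAt ℝ (partialBase j fun r => W r i) p := fun j =>
    differentiableAt_partialBase (contDiffAt_coord hW i) j
  have hc : ∀ j, DifferentiableAt ℝ (fun q => W q j) p := fun j =>
    (hasFDerivAt_coord hW1 j).differentiableAt
  show partialBase k (fun q => ∑ j, partialBase j (fun r => W r i) q * W q j
    + spray l i q (W q)) p = _
  rw [partialBase_add (DifferentiableAt.fun_sum fun j _ => (hd j).fun_mul (hc j))
    ((H.smooth_spray i).differentiableAt_comp_field H.isOpen hp hv hW1),
    partialBase_sum fun j _ => (hd j).fun_mul (hc j),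
    (H.smooth_spray i).partialBase_comp_field H.isOpen hp hv hW1]
  congr 1
  · refine Finset.sum_congr rfl fun j _ => ?_
    rw [partialBase_mul (hd j) (hc j),
      partialBase_partialBase_comm (contDiffAt_coord hW i) j k]
  · congr 1
    refine Finset.sum_congr rfl fun j _ => ?_
    rw [nonlinConn]
    ring

/-- The Bochner identity in coordinates, for an arbitrary non-vanishing field `W`: all terms cancel
after expanding, by the symmetry of the second derivatives of `W`. -/
theorem bochner_identity (H : IsCoordLagrangian T l) (hp : p ∈ T) (hv : W p ≠ 0)
    (hW : ContDiffAt ℝ 2 W p) (hΦ : ContDiffAt ℝ 2 Φ p) :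
    ∑ i, (-partialBase i (accel l W i) p + -accel l W i p * partialBase i Φ p)
      + ∑ k, partialBase k (coordDiv Φ W) p * W p k
      + (∑ i, curvature l i i p (W p) + weightSecond l Φ p (W p))
      + ∑ i, ∑ j, covMatrix l W p i j * covMatrix l W p j i = 0 := by
  simp only [H.partialBase_accel hp hv hW, partialBase_coordDiv hW hΦ]
  set N : Fin n → Fin n → ℝ := fun i j => nonlinConn l i j p (W p) with hN
  set D : Fin n → Fin n → ℝ := fun i j => partialBase j (fun r => W r i) p with hD
  set S : Fin n → Fin n → Fin n → ℝ := fun j k i =>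
    partialBase j (partialBase k (fun r => W r i)) p with hS
  set G : Fin n → ℝ := fun i => spray l i p (W p) with hG
  set f : Fin n → ℝ := fun i => partialBase i Φ p with hf
  set f2 : Fin n → Fin n → ℝ := fun k i => partialBase k (partialBase i Φ) p with hf2
  set XN : Fin n → Fin n → ℝ := fun k i => partialX k (nonlinConn l i i) p (W p) with hXN
  set VN : Fin n → Fin n → ℝ := fun k i => partialV k (nonlinConn l i i) p (W p) with hVN
  set XG : Fin n → ℝ := fun i => partialX i (spray l i) p (W p) with hXG
  have e1 : ∑ i, (-(∑ j, (S j i i * W p j + D i j * D j i) + (XG i + ∑ j, 2 * N i j * D j i))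
      + -accel l W i p * f i) =
      -∑ i, ∑ j, S j i i * W p j - ∑ i, ∑ j, D i j * D j i - ∑ i, XG i
        - ∑ i, ∑ j, 2 * N i j * D j i - ∑ i, ∑ j, D i j * W p j * f i - ∑ i, G i * f i := by
    simp only [← Finset.sum_sub_distrib, ← Finset.sum_neg_distrib]
    refine Finset.sum_congr rfl fun i _ => ?_
    rw [Finset.sum_add_distrib, ← Finset.sum_mul, Finset.sum_sub_distrib,
      Finset.sum_neg_distrib]
    simp only [accel, D, G]
    ring
  have e2 : ∑ k, (∑ i, (S k i i + (D i k * f i + W p i * f2 k i))) * W p k =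
      ∑ i, ∑ j, S j i i * W p j + ∑ i, ∑ j, D i j * W p j * f i
        + ∑ i, ∑ j, W p i * W p j * f2 j i := by
    simp only [← Finset.sum_add_distrib, Finset.sum_mul]
    rw [Finset.sum_comm]
    exact Finset.sum_congr rfl fun i _ => Finset.sum_congr rfl fun k _ => by ring
  have e3 : ∑ i, curvature l i i p (W p) = ∑ i, XG i - ∑ k, ∑ i, (XN k i * W p k - VN k i * G k)
      - ∑ i, ∑ j, N i j * N j i := by
    rw [Finset.sum_comm (s := Finset.univ) (f := fun k i => XN k i * W p k - VN k i * G k)]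
    simp only [← Finset.sum_sub_distrib]
    refine Finset.sum_congr rfl fun i _ => ?_
    rw [curvature, Finset.sum_add_distrib, Finset.sum_sub_distrib]
    simp only [XG, N]
    ring
  have e4 : ∑ i, ∑ j, covMatrix l W p i j * covMatrix l W p j i =
      ∑ i, ∑ j, D i j * D j i + ∑ i, ∑ j, 2 * N i j * D j i + ∑ i, ∑ j, N i j * N j i := by
    have h1 : ∑ i, ∑ j, D i j * N j i = ∑ i, ∑ j, N i j * D j i := by
      rw [Finset.sum_comm]
      exact Finset.sum_congr rfl fun i _ => Finset.sum_congr rfl fun k _ => by ring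
    have h2 : ∑ i, ∑ j, 2 * N i j * D j i =
        ∑ i, ∑ j, N i j * D j i + ∑ i, ∑ j, D i j * N j i := by
      rw [h1]
      simp only [← Finset.sum_add_distrib]
      exact Finset.sum_congr rfl fun i _ => Finset.sum_congr rfl fun k _ => by ring
    rw [h2]
    simp only [← Finset.sum_add_distrib]
    refine Finset.sum_congr rfl fun i _ => Finset.sum_congr rfl fun k _ => ?_
    simp only [covMatrix, Matrix.of_apply, D, N]
    ring
  rw [e1, e2, e3, e4, weightSecond]
  ring

end IsCoordLagrangian

end CoordinateBochner

/-! ### Lorentzian forms and charts -/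

section LorentzForms

variable {E : Type*} [NormedAddCommGroup E] [NormedSpace ℝ E]

lemma hasDerivAt_comp_line {F : Type*} [NormedAddCommGroup F] [NormedSpace ℝ F] {f : E → F}
    {f' : E →L[ℝ] F} {v : E} (hf : HasFDerivAt f f' v) (a : E) :
    HasDerivAt (fun s : ℝ => f (v + s • a)) (f' a) 0 := by
  have hline : HasDerivAt (fun s : ℝ => v + s • a) a 0 := by
    simpa using ((hasDerivAt_id (0 : ℝ)).smul_const a).const_add v
  exact HasFDerivAt.comp_hasDerivAt_of_eq (0 : ℝ) hf hline (by simp)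

/-- The iterated one-dimensional derivatives defining `g_v` compute the second derivative. -/
lemma deriv_deriv_eq_fderiv_fderiv {L : E → ℝ} {v : E} (hL : ContDiffAt ℝ 2 L v) (a b : E) :
    deriv (fun s : ℝ => deriv (fun t : ℝ => L (v + s • a + t • b)) 0) 0 =
      fderiv ℝ (fderiv ℝ L) v a b := by
  have h1 : ∀ᶠ w in 𝓝 v, DifferentiableAt ℝ L w :=
    (hL.eventually (by simp)).mono fun w hw => hw.differentiableAt (by simp)
  have hc : Filter.Tendsto (fun s : ℝ => v + s • a) (𝓝 0) (𝓝 v) := by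
    have : Continuous fun s : ℝ => v + s • a := by fun_prop
    simpa using this.tendsto 0
  have h2 : (fun s : ℝ => deriv (fun t : ℝ => L (v + s • a + t • b)) 0) =ᶠ[𝓝 0]
      fun s => fderiv ℝ L (v + s • a) b := by
    filter_upwards [hc.eventually h1] with s hs
    exact (hasDerivAt_comp_line hs.hasFDerivAt b).deriv
  rw [h2.deriv_eq]
  have h5 := hasDerivAt_comp_line (differentiableAt_fderiv_of_contDiffAt hL).hasFDerivAt a
  have h6 := h5.clm_apply (hasDerivAt_const (0 : ℝ) b)
  rw [h6.deriv, map_zero, add_zero]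

/-- The diagonal entries of the Lorentzian normal form. -/
def lorentzSign {n : ℕ} (i : Fin n) : ℝ := if (i : ℕ) = 0 then -1 else 1

variable {n : ℕ} {B : E →L[ℝ] E →L[ℝ] ℝ} {b : Module.Basis (Fin n) ℝ E}

lemma form_apply_eq (hB : ∀ i j, B (b i) (b j) = if i = j then lorentzSign i else 0) (v w : E) :
    B v w = ∑ i, lorentzSign i * b.repr v i * b.repr w i := by
  conv_lhs => rw [← b.sum_repr v, ← b.sum_repr w]
  simp only [map_sum, map_smul, sum_apply, smul_apply, smul_eq_mul, hB, Finset.mul_sum]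
  rw [Finset.sum_comm]
  refine Finset.sum_congr rfl fun i _ => ?_
  simp only [mul_ite, mul_zero, Finset.sum_ite_eq, Finset.mem_univ, if_true]
  ring

lemma form_nondegenerate (hB : ∀ i j, B (b i) (b j) = if i = j then lorentzSign i else 0) {v : E}
    (h : ∀ w, B v w = 0) : v = 0 := by
  refine b.repr.injective (Finsupp.ext fun i => ?_)
  have h1 := h (b i)
  rw [form_apply_eq hB] at h1
  simp only [Module.Basis.repr_self, Finsupp.single_apply, mul_ite, mul_one, mul_zero,
    Finset.sum_ite_eq, Finset.mem_univ, if_true] at h1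
  rw [map_zero, Finsupp.zero_apply]
  refine (mul_eq_zero.1 h1).resolve_left ?_
  unfold lorentzSign
  split_ifs <;> norm_num

/-- A Lorentzian form is positive on the orthogonal complement of a timelike vector. -/
lemma form_pos_of_orthogonal (hB : ∀ i j, B (b i) (b j) = if i = j then lorentzSign i else 0)
    {v w : E} (hv : B v v < 0) (hw : w ≠ 0) (hvw : B v w = 0) : 0 < B w w := by
  rw [form_apply_eq hB] at hv hvw ⊢
  obtain _ | m := n
  · simp at hv
  rw [Fin.sum_univ_succ] at hv hvw ⊢
  simp only [lorentzSign, Fin.val_zero, if_true, Fin.val_succ, Nat.add_eq_zero_iff, one_ne_zero,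
    and_false, if_false, one_mul, neg_mul] at hv hvw ⊢
  set v0 := b.repr v 0
  set w0 := b.repr w 0
  have hcs := Finset.sum_mul_sq_le_sq_mul_sq Finset.univ (fun i : Fin m => b.repr v i.succ)
    fun i => b.repr w i.succ
  have e1 : ∑ i : Fin m, b.repr v i.succ * b.repr w i.succ = v0 * w0 := by linarith
  rw [e1] at hcs
  simp only [← pow_two] at hv hvw ⊢
  set V := ∑ i : Fin m, b.repr v i.succ ^ 2
  set Q := ∑ i : Fin m, b.repr w i.succ ^ 2 with hQ
  have hV : 0 ≤ V := Finset.sum_nonneg fun i _ => sq_nonneg _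
  have hQ0 : 0 ≤ Q := Finset.sum_nonneg fun i _ => sq_nonneg _
  have hv0 : 0 < v0 ^ 2 := by linarith
  rcases hQ0.eq_or_lt with h0 | h0
  · exfalso
    have hw0 : w0 = 0 := by
      have h1 : (v0 * w0) ^ 2 ≤ 0 := by rw [← h0, mul_zero] at hcs; exact hcs
      have h2 : v0 * w0 = 0 := pow_eq_zero_iff two_ne_zero |>.1 (le_antisymm h1 (sq_nonneg _))
      exact (mul_eq_zero.1 h2).resolve_left fun h => by rw [h] at hv0; norm_num at hv0
    have hws : ∀ i : Fin m, b.repr w i.succ = 0 := fun i => by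
      have h1 := (Finset.sum_eq_zero_iff_of_nonneg
        (fun i (_ : i ∈ Finset.univ) => sq_nonneg (b.repr w i.succ))).1 h0.symm i
        (Finset.mem_univ i)
      exact pow_eq_zero_iff two_ne_zero |>.1 h1
    refine hw (b.repr.injective (Finsupp.ext fun i => ?_))
    rw [map_zero, Finsupp.zero_apply]
    exact Fin.cases hw0 hws i
  · have h1 : v0 ^ 2 * w0 ^ 2 < v0 ^ 2 * Q := by
      calc v0 ^ 2 * w0 ^ 2 = (v0 * w0) ^ 2 := by ring
        _ ≤ V * Q := hcs
        _ < v0 ^ 2 * Q := mul_lt_mul_of_pos_right (by linarith) h0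
    have h2 := lt_of_mul_lt_mul_left h1 hv0.le
    linarith

end LorentzForms

section ChartCalculus

variable {n : ℕ} {M : Type*} [TopologicalSpace M] [ChartedSpace (Coord n) M]
  [IsManifold 𝓘(ℝ, Coord n) ∞ M] {e : OpenPartialHomeomorph M (Coord n)}

lemma mdifferentiable_of_mem_maximalAtlas
    (he : e ∈ IsManifold.maximalAtlas 𝓘(ℝ, Coord n) ∞ M) :
    e.MDifferentiable 𝓘(ℝ, Coord n) 𝓘(ℝ, Coord n) :=
  ⟨fun _ hx => ((contMDiffOn_of_mem_maximalAtlas he).mdifferentiableOn (by simp)) _ hx,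
    fun _ hx => ((contMDiffOn_symm_of_mem_maximalAtlas he).mdifferentiableOn (by simp)) _ hx⟩

lemma toCoord_ofCoord (he : e ∈ IsManifold.maximalAtlas 𝓘(ℝ, Coord n) ∞ M) {p : Coord n}
    (hp : p ∈ e.target) (v : Coord n) : toCoord e (e.symm p) (ofCoord e p v) = v :=
  congrArg (fun T => T v) ((mdifferentiable_of_mem_maximalAtlas he).comp_symm_deriv hp)

lemma ofCoordAt_toCoord (he : e ∈ IsManifold.maximalAtlas 𝓘(ℝ, Coord n) ∞ M) {x : M}
    (hx : x ∈ e.source) (v : TangentSpace 𝓘(ℝ, Coord n) x) :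
    ofCoordAt e x (toCoord e x v) = v :=
  congrArg (fun T => T v) ((mdifferentiable_of_mem_maximalAtlas he).symm_comp_deriv hx)

lemma toCoord_ofCoordAt (he : e ∈ IsManifold.maximalAtlas 𝓘(ℝ, Coord n) ∞ M) {x : M}
    (hx : x ∈ e.source) (v : Coord n) : toCoord e x (ofCoordAt e x v) = v := by
  have h := toCoord_ofCoord he (e.map_source hx) v
  have h2 : ∀ y : M, y = x → ∀ w : Coord n, toCoord e y w = toCoord e x w := by
    rintro _ rfl _
    rfl
  exact (h2 _ (e.left_inv hx) _).symm.trans h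

lemma ofCoord_toCoord (he : e ∈ IsManifold.maximalAtlas 𝓘(ℝ, Coord n) ∞ M) {p : Coord n}
    (hp : p ∈ e.target) (v : TangentSpace 𝓘(ℝ, Coord n) (e.symm p)) :
    ofCoord e p (toCoord e (e.symm p) v) = v := by
  have h := ofCoordAt_toCoord he (e.map_target hp) v
  have h2 : ∀ q : Coord n, q = p → ∀ w : Coord n,
      (mfderiv 𝓘(ℝ, Coord n) 𝓘(ℝ, Coord n) e.symm q : Coord n → Coord n) w =
      (mfderiv 𝓘(ℝ, Coord n) 𝓘(ℝ, Coord n) e.symm p : Coord n → Coord n) w := by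
    rintro _ rfl _
    rfl
  exact (h2 _ (e.right_inv hp) _).symm.trans h

/-- The components of tangent vectors at `x`, as a linear isomorphism. -/
noncomputable def coordEquiv (he : e ∈ IsManifold.maximalAtlas 𝓘(ℝ, Coord n) ∞ M) {x : M}
    (hx : x ∈ e.source) : TangentSpace 𝓘(ℝ, Coord n) x ≃L[ℝ] Coord n :=
  ContinuousLinearEquiv.equivOfInverse (toCoord e x) (ofCoordAt e x) (ofCoordAt_toCoord he hx)
    (toCoord_ofCoordAt he hx)

lemma tangentBundle_mk_congr {x y : M} (h : y = x) (w : Coord n) :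
    (⟨y, w⟩ : TangentBundle 𝓘(ℝ, Coord n) M) = ⟨x, w⟩ := by
  subst h
  rfl

namespace LorentzFinsler

variable (S : LorentzFinsler n M)

/-- The restriction of `L` to the tangent space at `x`. -/
def fibreL (x : M) (v : Coord n) : ℝ := S.L ⟨x, (v : TangentSpace 𝓘(ℝ, Coord n) x)⟩

lemma coordL_toCoord (he : e ∈ IsManifold.maximalAtlas 𝓘(ℝ, Coord n) ∞ M) {x : M}
    (hx : x ∈ e.source) (v : TangentSpace 𝓘(ℝ, Coord n) x) :
    S.coordL e (e x) (toCoord e x v) = S.L ⟨x, v⟩ := by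
  have h := ofCoordAt_toCoord he hx v
  rw [coordL]
  refine congrArg S.L ?_
  refine (tangentBundle_mk_congr (e.left_inv hx) _).trans ?_
  exact congrArg (fun w => (⟨x, w⟩ : TangentBundle 𝓘(ℝ, Coord n) M)) h

lemma contMDiff_mk_tangentBundle : ContMDiff (𝓘(ℝ, Coord n × Coord n)) 𝓘(ℝ, Coord n).tangent ∞
    (fun z : Coord n × Coord n => (⟨z.1, z.2⟩ : TangentBundle 𝓘(ℝ, Coord n) (Coord n))) := by
  intro z
  apply Bundle.contMDiffAt_totalSpace.2
  refine ⟨contDiff_fst.contMDiff.contMDiffAt, ?_⟩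
  convert! (contDiff_snd (𝕜 := ℝ) (E := Coord n) (F := Coord n)).contMDiff.contMDiffAt with y
  simp
  rfl

/-- The coordinate expression of `L` is smooth on the slit tangent bundle. -/
lemma smooth_coordL (he : e ∈ IsManifold.maximalAtlas 𝓘(ℝ, Coord n) ∞ M) :
    SmoothOnSlit e.target (S.coordL e) := by
  have h1 : ContMDiffOn 𝓘(ℝ, Coord n).tangent 𝓘(ℝ, Coord n).tangent ∞
      (tangentMapWithin 𝓘(ℝ, Coord n) 𝓘(ℝ, Coord n) e.symm e.target)
      (Bundle.TotalSpace.proj ⁻¹' e.target) :=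
    (contMDiffOn_symm_of_mem_maximalAtlas he).contMDiffOn_tangentMapWithin (by simp)
      e.open_target.uniqueMDiffOn
  have h2 := h1.comp (contMDiff_mk_tangentBundle (n := n)).contMDiffOn
    (s := e.target ×ˢ {0}ᶜ) (fun z hz => hz.1)
  have h3 : ∀ z ∈ e.target ×ˢ ({0}ᶜ : Set (Coord n)),
      (tangentMapWithin 𝓘(ℝ, Coord n) 𝓘(ℝ, Coord n) e.symm e.target
        (⟨z.1, z.2⟩ : TangentBundle 𝓘(ℝ, Coord n) (Coord n))) =
      ⟨e.symm z.1, ofCoord e z.1 z.2⟩ := by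
    intro z hz
    rw [tangentMapWithin_eq_tangentMap (e.open_target.uniqueMDiffOn _ hz.1)
      (((mdifferentiable_of_mem_maximalAtlas he).2 _ hz.1).mdifferentiableAt
        (e.open_target.mem_nhds hz.1))]
    rfl
  refine contMDiffOn_iff_contDiffOn.1 ((S.smooth.comp h2 fun z hz => ?_).congr fun z hz => ?_)
  · show (tangentMapWithin 𝓘(ℝ, Coord n) 𝓘(ℝ, Coord n) e.symm e.target
        (⟨z.1, z.2⟩ : TangentBundle 𝓘(ℝ, Coord n) (Coord n))).2 ≠ 0
    rw [h3 z hz]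
    intro h0
    have h4 := toCoord_ofCoord he hz.1 z.2
    rw [show ofCoord e z.1 z.2 = 0 from h0, map_zero] at h4
    exact hz.2 h4.symm
  · show S.coordL e z.1 z.2 = S.L (tangentMapWithin 𝓘(ℝ, Coord n) 𝓘(ℝ, Coord n) e.symm e.target
        (⟨z.1, z.2⟩ : TangentBundle 𝓘(ℝ, Coord n) (Coord n)))
    rw [h3 z hz]
    rfl

lemma contDiffAt_coordL_fibre (he : e ∈ IsManifold.maximalAtlas 𝓘(ℝ, Coord n) ∞ M) {p v : Coord n}
    (hp : p ∈ e.target) (hv : v ≠ 0) : ContDiffAt ℝ ∞ (S.coordL e p) v :=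
  ContDiffAt.comp (f := fun w : Coord n => (p, w)) v
    ((S.smooth_coordL he).contDiffAt e.open_target hp hv) (contDiffAt_const.prodMk contDiffAt_id)

lemma fundamentalTensor_eq (he : e ∈ IsManifold.maximalAtlas 𝓘(ℝ, Coord n) ∞ M) {x : M}
    (hx : x ∈ e.source) {v : TangentSpace 𝓘(ℝ, Coord n) x} (hv : v ≠ 0)
    (a b : TangentSpace 𝓘(ℝ, Coord n) x) : fundamentalTensor S.L v a b =
      ∑ i, ∑ j, gLow (S.coordL e) i j (e x) (toCoord e x v) * toCoord e x a i
        * toCoord e x b j := by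
  have hv' : toCoord e x v ≠ 0 := fun h => hv ((coordEquiv he hx).map_eq_zero_iff.1 h)
  have hp := e.map_source hx
  have h1 : fundamentalTensor S.L v a b = fderiv ℝ (fderiv ℝ (S.coordL e (e x))) (toCoord e x v)
      (toCoord e x a) (toCoord e x b) := by
    rw [← deriv_deriv_eq_fderiv_fderiv ((S.contDiffAt_coordL_fibre he hp hv').of_le
      (by exact WithTop.coe_le_coe.2 le_top)), fundamentalTensor]
    simp only [← map_smul, ← map_add, S.coordL_toCoord he hx]
  have h2 : DifferentiableAt ℝ (fderiv ℝ (S.coordL e (e x))) (toCoord e x v) :=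
    ((S.contDiffAt_coordL_fibre he hp hv').fderiv_right (m := ∞) (by simp)).differentiableAt
      (by simp)
  have h3 : ∀ i j, gLow (S.coordL e) i j (e x) (toCoord e x v) =
      fderiv ℝ (fderiv ℝ (S.coordL e (e x))) (toCoord e x v) (EuclideanSpace.single i 1)
        (EuclideanSpace.single j 1) := fun i j => by
    show fderiv ℝ (fun w => fderiv ℝ (S.coordL e (e x)) w (EuclideanSpace.single j 1)) _ _ = _
    rw [fderiv_clm_apply h2 (differentiableAt_const _)]
    simp
  rw [h1]
  conv_lhs => rw [sum_single (toCoord e x a), sum_single (toCoord e x b)]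
  simp only [map_sum, map_smul, sum_apply, smul_apply, smul_eq_mul, h3, Finset.mul_sum]
  rw [Finset.sum_comm]
  exact Finset.sum_congr rfl fun i _ => Finset.sum_congr rfl fun j _ => by ring

lemma det_gMatrix_neg (hn : 0 < n) (he : e ∈ IsManifold.maximalAtlas 𝓘(ℝ, Coord n) ∞ M)
    {p v : Coord n} (hp : p ∈ e.target) (hv : v ≠ 0) : (gMatrix (S.coordL e) p v).det < 0 := by
  have hx := e.map_target hp
  have hw : ofCoord e p v ≠ 0 := fun h => hv (by
    rw [← toCoord_ofCoord he hp v, h, map_zero])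
  obtain ⟨b, hb⟩ := S.signature (e.symm p) (ofCoord e p v) hw
  let P : Matrix (Fin n) (Fin n) ℝ := Matrix.of fun i k => toCoord e (e.symm p) (b k) i
  have h1 : P.transpose * gMatrix (S.coordL e) p v * P = Matrix.diagonal lorentzSign := by
    ext k m
    have h2 := hb k m
    rw [S.fundamentalTensor_eq he hx hw, e.right_inv hp, toCoord_ofCoord he hp] at h2
    rw [Matrix.diagonal_apply]
    refine Eq.trans ?_ h2
    simp only [Matrix.mul_apply, Matrix.transpose_apply, P, Matrix.of_apply, gMatrix,
      Finset.sum_mul]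
    rw [Finset.sum_comm]
    exact Finset.sum_congr rfl fun i _ => Finset.sum_congr rfl fun j _ => by ring
  have h3 := congrArg Matrix.det h1
  rw [Matrix.det_mul, Matrix.det_mul, Matrix.det_transpose, Matrix.det_diagonal] at h3
  have h4 : ∏ i : Fin n, lorentzSign i = -1 := by
    obtain ⟨m, rfl⟩ := Nat.exists_eq_succ_of_ne_zero hn.ne'
    rw [Fin.prod_univ_succ]
    simp [lorentzSign]
  rw [h4] at h3
  by_contra h
  push Not at h
  have : 0 ≤ P.det * (gMatrix (S.coordL e) p v).det * P.det := by
    rw [mul_right_comm]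
    exact mul_nonneg (mul_self_nonneg _) h
  linarith

lemma isCoordLagrangian (hn : 0 < n) (he : e ∈ IsManifold.maximalAtlas 𝓘(ℝ, Coord n) ∞ M) :
    IsCoordLagrangian e.target (S.coordL e) where
  isOpen := e.open_target
  smooth := S.smooth_coordL he
  smul p _ v c hc := by
    rw [coordL, map_smul]
    exact S.homogeneous _ _ c hc
  det_neg p hp v hv := S.det_gMatrix_neg hn he hp hv

/-- A Lorentz–Finsler structure restricts to a Lorentz norm on each tangent space. -/
lemma isLorentzNorm_fibreL (x : M) : IsLorentzNorm (S.fibreL x) := by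
  have he := IsManifold.chart_mem_maximalAtlas (I := 𝓘(ℝ, Coord n)) (n := ∞) x
  have hx := mem_chart_source (Coord n) x
  set e := chartAt (Coord n) x
  let τ : Coord n →L[ℝ] Coord n := toCoord e x
  have hτ : ∀ v, v ≠ 0 → τ v ≠ 0 := fun v hv h =>
    hv ((coordEquiv he hx).map_eq_zero_iff.1 h)
  have hfun : S.fibreL x = fun v => S.coordL e (e x) (τ v) :=
    funext fun v => (S.coordL_toCoord he hx v).symm
  have hsm : ∀ v ≠ 0, ContDiffAt ℝ ∞ (S.fibreL x) v := fun v hv => by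
    rw [hfun]
    exact (S.contDiffAt_coordL_fibre he (e.map_source hx) (hτ v hv)).comp v τ.contDiff.contDiffAt
  have hsig : ∀ v ≠ 0, ∃ b : Module.Basis (Fin n) ℝ (Coord n), ∀ i j,
      fderiv ℝ (fderiv ℝ (S.fibreL x)) v (b i) (b j) = if i = j then lorentzSign i else 0 := by
    intro v hv
    obtain ⟨b, hb⟩ := S.signature x v hv
    refine ⟨b, fun i j => ?_⟩
    rw [← deriv_deriv_eq_fderiv_fderiv ((hsm v hv).of_le (by exact WithTop.coe_le_coe.2 le_top))]
    exact hb i j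
  have hsmul : ∀ v (c : ℝ), 0 < c → S.fibreL x (c • v) = c ^ 2 * S.fibreL x v :=
    fun v c hc => S.homogeneous x v c hc
  refine ⟨fun v hv => (hsm v hv).contDiffWithinAt, hsmul, fun v hv a ha => ?_,
    fun v hv w hw hvv hvw => ?_⟩
  · obtain ⟨b, hb⟩ := hsig v hv
    exact form_nondegenerate hb ha
  · obtain ⟨b, hb⟩ := hsig v hv
    exact form_pos_of_orthogonal hb hvv hw hvw

end LorentzFinsler

end ChartCalculus

/-! ### Regularity of the gradient -/

/-- Two points of a connected open set lie in a compact connected subset, namely a path. -/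
lemma exists_isCompact_isPreconnected {E : Type*} [NormedAddCommGroup E] [NormedSpace ℝ E]
    {s : Set E} (hs : IsOpen s) (hp : IsPreconnected s) {a b : E} (ha : a ∈ s) (hb : b ∈ s) :
    ∃ K ⊆ s, IsCompact K ∧ IsPreconnected K ∧ a ∈ K ∧ b ∈ K := by
  obtain ⟨γ, hγ⟩ := (hs.isConnected_iff_isPathConnected.1 ⟨⟨a, ha⟩, hp⟩).joinedIn a ha b hb
  exact ⟨Set.range γ, by rintro _ ⟨t, rfl⟩; exact hγ t, isCompact_range γ.continuous,
    isPreconnected_range γ.continuous, ⟨0, γ.source⟩, ⟨1, γ.target⟩⟩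

section Gradient

variable {n : ℕ} {M : Type*} [TopologicalSpace M] [ChartedSpace (Coord n) M]
  [IsManifold 𝓘(ℝ, Coord n) ∞ M] {e : OpenPartialHomeomorph M (Coord n)}

namespace Spacetime

variable (S : Spacetime n M)

lemma neg_of_mem_polarCone {x : M} {α : TangentSpace 𝓘(ℝ, Coord n) x →L[ℝ] ℝ}
    (hα : α ∈ S.polarCone x) : ∀ v ∈ causalCone (S.fibreL x) (S.X x), α v < 0 := fun v hv =>
  hα v ⟨(S.isLorentzNorm_fibreL x).causalCone_subset_closure hv,
    (IsLorentzNorm.causalCone_subset hv).2⟩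

/-- The Legendre transform of a covector of the polar cone is future-directed timelike and inverts
`v ↦ dL_v`. -/
lemma legendre_spec {x : M} {α : TangentSpace 𝓘(ℝ, Coord n) x →L[ℝ] ℝ} (hα : α ∈ S.polarCone x) :
    S.legendre α ∈ S.future x ∧ fderiv ℝ (S.fibreL x) (S.legendre α : Coord n) = α := by
  have hL := S.isLorentzNorm_fibreL x
  have hα' := S.neg_of_mem_polarCone hα
  obtain ⟨v, hv, h1, h2⟩ := hL.exists_legendre (S.timelike_X x) hα'
  have hex : ∃ v : TangentSpace 𝓘(ℝ, Coord n) x,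
      v ∈ S.future x ∧ S.L ⟨x, v⟩ = S.Lstar α ∧ S.Lstar α = α v / 2 := ⟨v, hv, h1, h2⟩
  obtain ⟨g1, g2, g3⟩ := Classical.epsilon_spec hex
  exact ⟨g1, hL.fderiv_eq_of_legendre (S.timelike_X x) hα' g1 g2 g3⟩

lemma eq_legendre {x : M} {α : TangentSpace 𝓘(ℝ, Coord n) x →L[ℝ] ℝ} (hα : α ∈ S.polarCone x)
    {v : TangentSpace 𝓘(ℝ, Coord n) x} (hv : v ∈ S.future x)
    (hvα : fderiv ℝ (S.fibreL x) (v : Coord n) = α) : v = S.legendre α :=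
  (S.isLorentzNorm_fibreL x).fderiv_injOn (S.neg_of_mem_polarCone hα) hv (S.legendre_spec hα).1 hvα
    (S.legendre_spec hα).2

lemma continuousOn_fieldCoord_X (he : e ∈ IsManifold.maximalAtlas 𝓘(ℝ, Coord n) ∞ M) :
    ContinuousOn (fieldCoord e S.X) e.target := by
  have h1 : ContinuousOn (tangentMapWithin 𝓘(ℝ, Coord n) 𝓘(ℝ, Coord n) e e.source)
      (Bundle.TotalSpace.proj ⁻¹' e.source) :=
    (contMDiffOn_of_mem_maximalAtlas he).continuousOn_tangentMapWithin (by simp)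
      e.open_source.uniqueMDiffOn
  have h2 : ContinuousOn (fun p => (⟨e.symm p, S.X (e.symm p)⟩ : TangentBundle 𝓘(ℝ, Coord n) M))
      e.target := S.smooth_X.continuous.comp_continuousOn e.continuousOn_symm
  have h3 := (contMDiff_snd_tangentBundle_modelSpace (n := ∞) (Coord n)
    𝓘(ℝ, Coord n)).continuous.comp_continuousOn (h1.comp h2 fun p hp => e.map_target hp)
  refine h3.congr fun p hp => ?_
  have hx := e.map_target hp
  show _ = (tangentMapWithin 𝓘(ℝ, Coord n) 𝓘(ℝ, Coord n) e e.source ⟨e.symm p, S.X (e.symm p)⟩).2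
  rw [tangentMapWithin_eq_tangentMap (e.open_source.uniqueMDiffOn _ hx)
    (((mdifferentiable_of_mem_maximalAtlas he).1 _ hx).mdifferentiableAt
      (e.open_source.mem_nhds hx))]
  rfl

/-- The future cones depend continuously on the base point: being future-directed timelike is an
open condition in coordinates of `TM`. A path of timelike vectors from `v₀` to `X` at one base
point remains timelike at nearby base points. -/
lemma eventually_mem_future (he : e ∈ IsManifold.maximalAtlas 𝓘(ℝ, Coord n) ∞ M)
    {p₀ v₀ : Coord n} (hp : p₀ ∈ e.target) (hv : ofCoord e p₀ v₀ ∈ S.future (e.symm p₀)) :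
    ∀ᶠ z in 𝓝 (p₀, v₀), ofCoord e z.1 z.2 ∈ S.future (e.symm z.1) := by
  have hsm := S.smooth_coordL he
  set l := S.coordL e with hl
  set X := fieldCoord e S.X with hX
  have hXof : ∀ p ∈ e.target, ofCoord e p (X p) = S.X (e.symm p) := fun p hp =>
    ofCoord_toCoord he hp _
  have hXneg : ∀ p ∈ e.target, l p (X p) < 0 := fun p hp => by
    rw [hl, LorentzFinsler.coordL, hXof p hp]
    exact S.timelike_X _
  have hzero : ∀ p v, l p v < 0 → v ≠ 0 := by
    rintro p v h rfl
    rw [hl, LorentzFinsler.coordL, map_zero] at h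
    exact (S.isLorentzNorm_fibreL (e.symm p)).ne_zero h rfl
  have hopen : ∀ v, l p₀ v < 0 → ∀ᶠ z in 𝓝 (p₀, v), l z.1 z.2 < 0 := fun v h =>
    (hsm.contDiffAt e.open_target hp (hzero _ _ h)).continuousAt.eventually_lt_const h
  have hL := S.isLorentzNorm_fibreL (e.symm p₀)
  -- a path of timelike vectors from `v₀` to `X`
  have hFopen : IsOpen (S.future (e.symm p₀)) := hL.isOpen_futureCone
  have hXf : S.X (e.symm p₀) ∈ S.future (e.symm p₀) := hL.mem_futureCone_self (S.timelike_X _)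
  have hFpre : IsPreconnected (S.future (e.symm p₀)) :=
    hL.isPreconnected_futureCone (S.timelike_X _)
  have hjoin : ∃ K : Set (Coord n), IsCompact K ∧ IsPreconnected K ∧ v₀ ∈ K ∧ X p₀ ∈ K ∧
      ∀ v ∈ K, l p₀ v < 0 := by
    obtain ⟨K, hKs, hKc, hKp, hvK, hXK⟩ := exists_isCompact_isPreconnected (E := Coord n)
      hL.isOpen_futureCone hFpre hv hXf
    let τ : Coord n →L[ℝ] Coord n := toCoord e (e.symm p₀)
    refine ⟨τ '' K, hKc.image τ.continuous, hKp.image τ τ.continuous.continuousOn,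
      ⟨_, hvK, toCoord_ofCoord he hp v₀⟩, ⟨_, hXK, rfl⟩, ?_⟩
    rintro _ ⟨w, hw, rfl⟩
    have h1 := S.coordL_toCoord he (e.map_target hp) w
    rw [e.right_inv hp] at h1
    exact h1.trans_lt (hKs hw).1
  obtain ⟨K, hKc, hKp, hvK, hXK, hKneg⟩ := hjoin
  have hK : ∀ᶠ p in 𝓝 p₀, ∀ v ∈ K, l p v < 0 :=
    hKc.eventually_forall_of_forall_eventually fun v hv => hopen v (hKneg v hv)
  obtain ⟨r, hr, hball⟩ := Metric.eventually_nhds_iff_ball.1 (hopen v₀ (hKneg v₀ hvK))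
  obtain ⟨s, hs, hball'⟩ := Metric.eventually_nhds_iff_ball.1 (hopen (X p₀) (hXneg p₀ hp))
  have hXc : ∀ᶠ p in 𝓝 p₀, X p ∈ Metric.ball (X p₀) s :=
    ((S.continuousOn_fieldCoord_X he).continuousAt (e.open_target.mem_nhds hp)).eventually
      (Metric.ball_mem_nhds _ hs)
  have hbase : ∀ᶠ p in 𝓝 p₀, p ∈ e.target ∧ p ∈ Metric.ball p₀ r ∧ p ∈ Metric.ball p₀ s ∧
      X p ∈ Metric.ball (X p₀) s ∧ ∀ v ∈ K, l p v < 0 := by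
    filter_upwards [e.open_target.mem_nhds hp, Metric.ball_mem_nhds p₀ hr,
      Metric.ball_mem_nhds p₀ hs, hXc, hK] with p h1 h2 h3 h4 h5 using ⟨h1, h2, h3, h4, h5⟩
  rw [nhds_prod_eq]
  filter_upwards [hbase.prod_mk (Metric.ball_mem_nhds v₀ hr)]
  rintro ⟨p, v⟩ ⟨⟨h1, h2, h3, h4, h5⟩, h6⟩
  set T : Set (Coord n) := (Metric.ball v₀ r ∪ K) ∪ Metric.ball (X p₀) s with hT
  have hTp : IsPreconnected T :=
    IsPreconnected.union (X p₀) (Or.inr hXK) (Metric.mem_ball_self hs)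
      (IsPreconnected.union v₀ (Metric.mem_ball_self hr) hvK (convex_ball v₀ r).isPreconnected hKp)
      (convex_ball (X p₀) s).isPreconnected
  have hTneg : ∀ w ∈ T, l p w < 0 := by
    rintro w ((hw | hw) | hw)
    · exact hball (p, w) (by rw [← ball_prod_same]; exact ⟨h2, hw⟩)
    · exact h5 w hw
    · exact hball' (p, w) (by rw [← ball_prod_same]; exact ⟨h3, hw⟩)
  let σ : Coord n →L[ℝ] Coord n := ofCoord e p
  have hsub := (S.isLorentzNorm_fibreL (e.symm p)).subset_futureCone (E := Coord n)
    (X := S.X (e.symm p)) (hTp.image σ σ.continuous.continuousOn)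
    (by rintro _ ⟨w, hw, rfl⟩; exact hTneg w hw)
    (v := S.X (e.symm p)) ⟨X p, Or.inr h4, hXof p h1⟩
    ((S.isLorentzNorm_fibreL (e.symm p)).mem_futureCone_self (S.timelike_X _))
  exact hsub ⟨v, Or.inl (Or.inl h6), rfl⟩

variable {U : Set M} {h : M → ℝ}

lemma diff_mem_polarCone (htemp : S.IsTemporalOn (fun y => -h y) U) {x : M} (hx : x ∈ U) :
    diff (n := n) h x ∈ S.polarCone x := by
  have h1 := htemp.2 x hx
  have h2 : -diff (n := n) (fun y => -h y) x = diff (n := n) h x := by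
    have h3 : (fun y => -h y) = -h := rfl
    rw [diff, diff, h3, mfderiv_neg]
    exact neg_neg (mfderiv 𝓘(ℝ, Coord n) 𝓘(ℝ, ℝ) h x)
  rwa [h2] at h1

lemma grad_mem_future (htemp : S.IsTemporalOn (fun y => -h y) U) {x : M} (hx : x ∈ U) :
    S.grad h x ∈ S.future x :=
  (S.legendre_spec (S.diff_mem_polarCone htemp hx)).1

lemma L_grad_neg (htemp : S.IsTemporalOn (fun y => -h y) U) {x : M} (hx : x ∈ U) :
    S.L ⟨x, S.grad h x⟩ < 0 := (S.grad_mem_future htemp hx).1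

lemma grad_ne_zero (htemp : S.IsTemporalOn (fun y => -h y) U) {x : M} (hx : x ∈ U) :
    S.grad h x ≠ 0 := (S.isLorentzNorm_fibreL x).ne_zero (S.L_grad_neg htemp hx)

lemma fieldCoord_grad_ne_zero (he : e ∈ IsManifold.maximalAtlas 𝓘(ℝ, Coord n) ∞ M)
    (htemp : S.IsTemporalOn (fun y => -h y) U) {p : Coord n} (hp : p ∈ e.target)
    (hpU : e.symm p ∈ U) : fieldCoord e (S.grad h) p ≠ 0 := fun h0 =>
  S.grad_ne_zero htemp hpU ((coordEquiv he (e.map_target hp)).map_eq_zero_iff.1 h0)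

lemma diff_ofCoord (he : e ∈ IsManifold.maximalAtlas 𝓘(ℝ, Coord n) ∞ M) {u : M → ℝ} {p : Coord n}
    (hp : p ∈ e.target) (hu : MDifferentiableAt 𝓘(ℝ, Coord n) 𝓘(ℝ, ℝ) u (e.symm p)) (w : Coord n) :
    diff u (e.symm p) (ofCoord e p w) = fderiv ℝ (fun q => u (e.symm q)) p w := by
  have h1 := mfderiv_comp (I := 𝓘(ℝ, Coord n)) (I' := 𝓘(ℝ, Coord n)) (I'' := 𝓘(ℝ, ℝ)) p hu
    (((mdifferentiable_of_mem_maximalAtlas he).2 _ hp).mdifferentiableAt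
      (e.open_target.mem_nhds hp))
  have h2 : fderiv ℝ (fun q => u (e.symm q)) p = mfderiv 𝓘(ℝ, Coord n) 𝓘(ℝ, ℝ) (u ∘ e.symm) p :=
    (mfderiv_eq_fderiv (f := u ∘ e.symm)).symm
  rw [h2, h1]
  rfl

lemma partialV_coordL (p v : Coord n) (hv : ofCoord e p v ≠ 0) (i : Fin n) :
    partialV i (S.coordL e) p v = fderiv ℝ (S.fibreL (e.symm p)) (ofCoord e p v)
      (ofCoord e p (EuclideanSpace.single i 1)) := by
  let σ : Coord n →L[ℝ] Coord n := ofCoord e p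
  have h1 : HasFDerivAt (S.fibreL (e.symm p)) (fderiv ℝ (S.fibreL (e.symm p)) (σ v)) (σ v) :=
    ((S.isLorentzNorm_fibreL (e.symm p)).differentiableAt hv).hasFDerivAt
  have h2 := (h1.comp v σ.hasFDerivAt).fderiv
  rw [partialV]
  exact congrArg (fun T => T (EuclideanSpace.single i (1 : ℝ))) h2

/-- The gradient in coordinates: `∂L/∂vⁱ (∇h) = ∂h/∂xⁱ`. -/
lemma partialV_coordL_grad (he : e ∈ IsManifold.maximalAtlas 𝓘(ℝ, Coord n) ∞ M)
    (htemp : S.IsTemporalOn (fun y => -h y) U) {p : Coord n} (hp : p ∈ e.target)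
    (hpU : e.symm p ∈ U) (hh : MDifferentiableAt 𝓘(ℝ, Coord n) 𝓘(ℝ, ℝ) h (e.symm p)) (i : Fin n) :
    partialV i (S.coordL e) p (fieldCoord e (S.grad h) p) =
      partialBase i (fun q => h (e.symm q)) p := by
  have hof : ofCoord e p (fieldCoord e (S.grad h) p) = S.grad h (e.symm p) :=
    ofCoord_toCoord he hp _
  have hne := S.grad_ne_zero htemp hpU
  rw [S.partialV_coordL _ _ (by rw [hof]; exact hne), hof]
  have h2 := (S.legendre_spec (S.diff_mem_polarCone htemp hpU)).2
  rw [partialBase, ← diff_ofCoord he hp hh]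
  exact congrArg (fun T => T (ofCoord e p (EuclideanSpace.single i (1 : ℝ)))) h2

lemma contDiffAt_comp_symm (he : e ∈ IsManifold.maximalAtlas 𝓘(ℝ, Coord n) ∞ M) (hU : IsOpen U)
    (hh : ContMDiffOn 𝓘(ℝ, Coord n) 𝓘(ℝ, ℝ) 3 h U) {p : Coord n} (hp : p ∈ e.target)
    (hpU : e.symm p ∈ U) : ContDiffAt ℝ 3 (fun q => h (e.symm q)) p := by
  have h1 := (hh.contMDiffAt (hU.mem_nhds hpU)).comp p
    ((contMDiffAt_symm_of_mem_maximalAtlas he hp).of_le (by exact WithTop.coe_le_coe.2 le_top))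
  exact contMDiffAt_iff_contDiffAt.1 h1

/-- The gradient of a `C³` function is `C²`: near a point, the inverse function theorem solves
`∂L/∂v (x, v) = dh(x)`, and by injectivity of `v ↦ dL_v` on the future cone the solution is the
gradient. -/
lemma contDiffAt_fieldCoord_grad (hn : 0 < n)
    (he : e ∈ IsManifold.maximalAtlas 𝓘(ℝ, Coord n) ∞ M) (hU : IsOpen U)
    (hh : ContMDiffOn 𝓘(ℝ, Coord n) 𝓘(ℝ, ℝ) 3 h U)
    (htemp : S.IsTemporalOn (fun y => -h y) U) {p₀ : Coord n} (hp : p₀ ∈ e.target)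
    (hpU : e.symm p₀ ∈ U) : ContDiffAt ℝ 2 (fieldCoord e (S.grad h)) p₀ := by
  have H := S.isCoordLagrangian hn he
  set l := S.coordL e with hl
  set W := fieldCoord e (S.grad h) with hW
  have hW0 : W p₀ ≠ 0 := S.fieldCoord_grad_ne_zero he htemp hp hpU
  set u : Coord n → ℝ := fun q => h (e.symm q) with hu_def
  have hu := contDiffAt_comp_symm he hU hh hp hpU
  let Ψ : Coord n × Coord n → Coord n × Coord n :=
    fun z => (z.1, WithLp.toLp 2 fun i => partialV i l z.1 z.2)
  have hΨ : ContDiffAt ℝ ∞ Ψ (p₀, W p₀) := by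
    refine contDiffAt_fst.prodMk ((contDiffAt_piLp 2).2 fun i => ?_)
    exact (H.smooth.partialV H.isOpen i).contDiffAt H.isOpen hp hW0
  have hinj : Function.Injective (fderiv ℝ Ψ (p₀, W p₀)) := by
    rw [injective_iff_map_eq_zero]
    rintro ⟨a, b⟩ hab
    have hd := (hΨ.differentiableAt (by simp)).hasFDerivAt
    have h1 : a = 0 := by
      have h2 := (ContinuousLinearMap.fst ℝ (Coord n) (Coord n)).hasFDerivAt.comp (p₀, W p₀) hd
      have h3 : HasFDerivAt (fun z : Coord n × Coord n => z.1)
        (ContinuousLinearMap.fst ℝ (Coord n) (Coord n)) (p₀, W p₀) := hasFDerivAt_fst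
      have h4 := congrArg (fun T => T (a, b)) (h2.unique h3)
      simp only [ContinuousLinearMap.comp_apply, hab] at h4
      simpa using h4.symm
    subst h1
    have h5 : ∀ i, ∑ k, gLow l i k p₀ (W p₀) * b k =
        ∑ k, gLow l i k p₀ (W p₀) * (0 : Coord n) k := by
      intro i
      have h2 := ((EuclideanSpace.proj i : Coord n →L[ℝ] ℝ).comp
        (ContinuousLinearMap.snd ℝ (Coord n) (Coord n))).hasFDerivAt.comp (p₀, W p₀) hd
      obtain ⟨D, hD, hDw⟩ := (H.smooth.partialV H.isOpen i).hasFDerivAt_comp H.isOpen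
        (c := Prod.fst) (u := Prod.snd) (q := (p₀, W p₀)) hp hW0 hasFDerivAt_fst hasFDerivAt_snd
      have h4 := congrArg (fun T => T ((0 : Coord n), b))
        (HasFDerivAt.unique (f := fun z : Coord n × Coord n => partialV i l z.1 z.2) h2 hD)
      simp only [ContinuousLinearMap.comp_apply, hab, hDw] at h4
      simp only [map_zero, ContinuousLinearMap.coe_fst', ContinuousLinearMap.coe_snd',
        PiLp.zero_apply, mul_zero, Finset.sum_const_zero, zero_add] at h4 ⊢
      rw [h4]
      exact Finset.sum_congr rfl fun k _ => by rw [H.gLow_symm hp hW0 i k]; rfl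
    have h6 := H.eq_of_sum_gLow_mul_eq hp hW0 h5
    have h7 : b = 0 := by
      ext i
      exact congrFun h6 i
    rw [h7]
    rfl
  let D : (Coord n × Coord n) ≃L[ℝ] (Coord n × Coord n) :=
    (LinearEquiv.ofInjectiveEndo (fderiv ℝ Ψ (p₀, W p₀) : _ →ₗ[ℝ] _) hinj).toContinuousLinearEquiv
  have hD : HasFDerivAt Ψ (D : (Coord n × Coord n) →L[ℝ] (Coord n × Coord n)) (p₀, W p₀) := by
    convert! (hΨ.differentiableAt (by simp)).hasFDerivAt
  have hΨ2 : ContDiffAt ℝ 2 Ψ (p₀, W p₀) := hΨ.of_le (by exact WithTop.coe_le_coe.2 le_top)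
  set inv := hΨ2.localInverse hD (by simp) with hinv
  have hinv_smooth : ContDiffAt ℝ 2 inv (Ψ (p₀, W p₀)) := hΨ2.to_localInverse hD (by simp)
  have hinv_self : inv (Ψ (p₀, W p₀)) = (p₀, W p₀) :=
    hΨ2.localInverse_apply_image hD (by simp)
  have hright : ∀ᶠ y in 𝓝 (Ψ (p₀, W p₀)), Ψ (inv y) = y :=
    (hΨ2.hasStrictFDerivAt' hD (by simp)).eventually_right_inverse
  have hmd : ∀ᶠ p in 𝓝 p₀, p ∈ e.target ∧ e.symm p ∈ U :=
    (e.open_target.eventually_mem hp).and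
      ((e.continuousAt_symm hp).eventually (hU.mem_nhds hpU))
  have hhd : ∀ p, e.symm p ∈ U → MDifferentiableAt 𝓘(ℝ, Coord n) 𝓘(ℝ, ℝ) h (e.symm p) :=
    fun p hp => (hh.contMDiffAt (hU.mem_nhds hp)).mdifferentiableAt (by simp)
  let β : Coord n → Coord n × Coord n := fun p => (p, WithLp.toLp 2 fun i => partialBase i u p)
  have hβ : ContDiffAt ℝ 2 β p₀ := by
    refine contDiffAt_id.prodMk ((contDiffAt_piLp 2).2 fun i => ?_)
    exact (hu.fderiv_right (m := 2) (by norm_num)).clm_apply contDiffAt_const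
  have hβ0 : β p₀ = Ψ (p₀, W p₀) := by
    refine Prod.ext rfl ?_
    show WithLp.toLp 2 _ = WithLp.toLp 2 _
    congr 1
    funext i
    exact (S.partialV_coordL_grad he htemp hp hpU (hhd p₀ hpU) i).symm
  rw [← hβ0] at hinv_smooth hright hinv_self
  have hV : ContDiffAt ℝ 2 (fun p => (inv (β p)).2) p₀ :=
    contDiffAt_snd.comp p₀ (hinv_smooth.comp p₀ hβ)
  refine hV.congr_of_eventuallyEq ?_
  have hfut : ∀ᶠ p in 𝓝 p₀, ofCoord e (inv (β p)).1 (inv (β p)).2 ∈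
      S.future (e.symm (inv (β p)).1) := by
    have h1 := S.eventually_mem_future he (v₀ := W p₀) hp (by
      rw [hW, fieldCoord, ofCoord_toCoord he hp]
      exact S.grad_mem_future htemp hpU)
    rw [← hinv_self] at h1
    exact (hinv_smooth.continuousAt.comp (f := β) hβ.continuousAt).eventually h1
  filter_upwards [hmd, hfut, hβ.continuousAt.eventually hright] with p hp1 hp2 hp3
  have h1 : (inv (β p)).1 = p := congrArg Prod.fst hp3
  have h2 : ∀ i, partialV i l (inv (β p)).1 (inv (β p)).2 = partialBase i u p := fun i =>
    congrArg (fun z : Coord n × Coord n => z.2 i) hp3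
  rw [h1] at h2 hp2
  set v := (inv (β p)).2
  have hvne : ofCoord e p v ≠ 0 := (S.isLorentzNorm_fibreL _).ne_zero hp2.1
  have h3 : ofCoord e p v = S.grad h (e.symm p) := by
    refine S.eq_legendre (S.diff_mem_polarCone htemp hp1.2) hp2 ?_
    let σ : Coord n →L[ℝ] Coord n := ofCoord e p
    have h4 : ∀ w, fderiv ℝ (S.fibreL (e.symm p)) (σ v) (σ w) = diff h (e.symm p) (σ w) := by
      intro w
      rw [show diff h (e.symm p) (σ w) = fderiv ℝ u p w from
        diff_ofCoord he hp1.1 (hhd p hp1.2) w, sum_single w]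
      simp only [map_sum, map_smul]
      refine Finset.sum_congr rfl fun i _ => ?_
      congr 1
      exact (S.partialV_coordL p v hvne i).symm.trans (h2 i)
    refine ContinuousLinearMap.ext fun w => ?_
    have h5 : σ (toCoord e (e.symm p) w) = w := ofCoord_toCoord he hp1.1 w
    have h6 := h4 (toCoord e (e.symm p) w)
    rw [h5] at h6
    exact h6
  show toCoord e (e.symm p) (S.grad h (e.symm p)) = v
  rw [← h3, toCoord_ofCoord he hp1.1]

end Spacetime

end Gradient

/-! ### Geodesics and the weight function -/

section SprayCurves

variable {n : ℕ} {T : Set (Coord n)} {l : Coord n → Coord n → ℝ}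

/-- Local existence for the geodesic equation, as a first order system for position and
velocity. -/
lemma IsCoordLagrangian.exists_spray_curve (H : IsCoordLagrangian T l) {p v : Coord n}
    (hp : p ∈ T) (hv : v ≠ 0) : ∃ c u : ℝ → Coord n, ∃ ε > 0, c 0 = p ∧ u 0 = v ∧
      ∀ t ∈ Set.Ioo (-ε) ε, c t ∈ T ∧ u t ≠ 0 ∧ HasDerivAt c (u t) t ∧
        HasDerivAt u (WithLp.toLp 2 fun i => -spray l i (c t) (u t)) t := by
  let f : Coord n × Coord n → Coord n × Coord n :=
    fun z => (z.2, WithLp.toLp 2 fun i => -spray l i z.1 z.2)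
  have hf : ContDiffAt ℝ 1 f (p, v) := by
    refine contDiffAt_snd.prodMk ((contDiffAt_piLp 2).2 fun i => ?_)
    exact (((H.smooth_spray i).contDiffAt H.isOpen hp hv).of_le
      (by exact WithTop.coe_le_coe.2 le_top)).neg
  obtain ⟨α, h0, ε, hε, hα⟩ :=
    hf.exists_forall_mem_closedBall_exists_eq_forall_mem_Ioo_hasDerivAt₀ 0
  have hα0 := hα 0 (by simp [hε])
  have hev : ∀ᶠ t in 𝓝 (0 : ℝ), (α t).1 ∈ T ∧ (α t).2 ≠ 0 := by
    have h1 : ∀ᶠ z in 𝓝 (α 0), z.1 ∈ T ∧ z.2 ≠ 0 := by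
      rw [h0, nhds_prod_eq]
      exact (H.isOpen.eventually_mem hp).prod_mk (isOpen_ne.eventually_mem hv)
    exact hα0.continuousAt.eventually h1
  obtain ⟨δ, hδ, hball⟩ := Metric.eventually_nhds_iff_ball.1 hev
  refine ⟨fun t => (α t).1, fun t => (α t).2, min ε δ, lt_min hε hδ,
    congrArg Prod.fst h0, congrArg Prod.snd h0, fun t ht => ?_⟩
  have ht1 : t ∈ Set.Ioo (0 - ε) (0 + ε) := by
    rw [zero_sub, zero_add]
    exact ⟨by linarith [ht.1, min_le_left ε δ], ht.2.trans_le (min_le_left _ _)⟩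
  have ht2 : t ∈ Metric.ball (0 : ℝ) δ := by
    rw [Real.ball_eq_Ioo, zero_sub, zero_add]
    exact ⟨by linarith [ht.1, min_le_right ε δ], ht.2.trans_le (min_le_right _ _)⟩
  have h := hα t ht1
  exact ⟨(hball t ht2).1, (hball t ht2).2,
    (ContinuousLinearMap.fst ℝ (Coord n) (Coord n)).hasFDerivAt.comp_hasDerivAt t h,
    (ContinuousLinearMap.snd ℝ (Coord n) (Coord n)).hasFDerivAt.comp_hasDerivAt t h⟩

end SprayCurves

section Geodesics

variable {n : ℕ} {M : Type*} [TopologicalSpace M] [ChartedSpace (Coord n) M]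
  [IsManifold 𝓘(ℝ, Coord n) ∞ M] {e : OpenPartialHomeomorph M (Coord n)}

lemma velocity_comp_symm (he : e ∈ IsManifold.maximalAtlas 𝓘(ℝ, Coord n) ∞ M) {c : ℝ → Coord n}
    {c' : Coord n} {t : ℝ} (hc : HasDerivAt c c' t) (ht : c t ∈ e.target) :
    velocity (n := n) (fun s => e.symm (c s)) t = ⟨e.symm (c t), ofCoord e (c t) c'⟩ := by
  have h1 : MDifferentiableAt 𝓘(ℝ, Coord n) 𝓘(ℝ, Coord n) e.symm (c t) :=
    ((mdifferentiable_of_mem_maximalAtlas he).2 _ ht).mdifferentiableAt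
      (e.open_target.mem_nhds ht)
  have h2 : MDifferentiableAt 𝓘(ℝ, ℝ) 𝓘(ℝ, Coord n) c t :=
    hc.differentiableAt.mdifferentiableAt
  have h3 := mfderiv_comp t h1 h2
  rw [mfderiv_eq_fderiv] at h3
  have h4 : mfderiv 𝓘(ℝ, ℝ) 𝓘(ℝ, Coord n) (e.symm ∘ c) t (1 : ℝ) = ofCoord e (c t) c' := by
    rw [h3]
    show mfderiv 𝓘(ℝ, Coord n) 𝓘(ℝ, Coord n) e.symm (c t) (fderiv ℝ c t 1) = _
    rw [hc.hasFDerivAt.fderiv]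
    rw [ContinuousLinearMap.toSpanSingleton_apply, one_smul]
    rfl
  exact congrArg (fun w : Coord n => (⟨e.symm (c t), w⟩ : TangentBundle 𝓘(ℝ, Coord n) M)) h4

lemma toCoord_velocity (he : e ∈ IsManifold.maximalAtlas 𝓘(ℝ, Coord n) ∞ M) {η : ℝ → M} {t : ℝ}
    (hη : MDifferentiableAt 𝓘(ℝ, ℝ) 𝓘(ℝ, Coord n) η t) (ht : η t ∈ e.source) :
    toCoord e (velocity (n := n) η t).1 (velocity (n := n) η t).2 = deriv (fun s => e (η s)) t := by
  have h1 : MDifferentiableAt 𝓘(ℝ, Coord n) 𝓘(ℝ, Coord n) e (η t) :=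
    ((mdifferentiable_of_mem_maximalAtlas he).1 _ ht).mdifferentiableAt
      (e.open_source.mem_nhds ht)
  have h3 := mfderiv_comp t h1 hη
  rw [mfderiv_eq_fderiv] at h3
  rw [← fderiv_apply_one_eq_deriv]
  exact (congrArg (fun T => T (1 : ℝ)) h3).symm

namespace LorentzFinsler

variable (S : LorentzFinsler n M)

lemma exists_geodesic (hn : 0 < n) (he : e ∈ IsManifold.maximalAtlas 𝓘(ℝ, Coord n) ∞ M) {x : M}
    (hx : x ∈ e.source) {v : TangentSpace 𝓘(ℝ, Coord n) x} (hv : v ≠ 0) :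
    ∃ η : ℝ → M, ∃ ε : ℝ, 0 < ε ∧ S.IsGeodesicIn e η ε ∧ velocity (n := n) η 0 = ⟨x, v⟩ := by
  have H := S.isCoordLagrangian hn he
  have hv' : toCoord e x v ≠ 0 := fun h => hv ((coordEquiv he hx).map_eq_zero_iff.1 h)
  obtain ⟨c, u, ε, hε, hc0, hu0, hcu⟩ := H.exists_spray_curve (e.map_source hx) hv'
  have hopen : IsOpen (Set.Ioo (-ε) ε) := isOpen_Ioo
  have hcd : Set.EqOn (deriv c) u (Set.Ioo (-ε) ε) := fun t ht => (hcu t ht).2.2.1.deriv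
  have hud : Set.EqOn (deriv u) (fun t => WithLp.toLp 2 fun i => -spray (S.coordL e) i (c t) (u t))
      (Set.Ioo (-ε) ε) := fun t ht => (hcu t ht).2.2.2.deriv
  have hu1 : ContDiffOn ℝ 1 u (Set.Ioo (-ε) ε) := by
    rw [show (1 : ℕ∞ω) = 0 + 1 from (zero_add _).symm, contDiffOn_succ_iff_deriv_of_isOpen hopen]
    refine ⟨fun t ht => (hcu t ht).2.2.2.differentiableAt.differentiableWithinAt, by simp, ?_⟩
    rw [contDiffOn_zero]
    refine ContinuousOn.congr (fun t ht => ContinuousAt.continuousWithinAt ?_) hud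
    obtain ⟨h1, h2, h3, h4⟩ := hcu t ht
    refine (PiLp.continuous_toLp 2 _).continuousAt.comp (continuousAt_pi.2 fun i => ?_)
    exact (((H.smooth_spray i).contDiffAt H.isOpen h1 h2).continuousAt.comp
      (f := fun s => (c s, u s)) (h3.continuousAt.prodMk h4.continuousAt)).neg
  have hc2 : ContDiffOn ℝ 2 c (Set.Ioo (-ε) ε) := by
    rw [show (2 : ℕ∞ω) = 1 + 1 from one_add_one_eq_two.symm,
      contDiffOn_succ_iff_deriv_of_isOpen hopen]
    exact ⟨fun t ht => (hcu t ht).2.2.1.differentiableAt.differentiableWithinAt, by simp,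
      hu1.congr hcd⟩
  have h0 : (0 : ℝ) ∈ Set.Ioo (-ε) ε := by simp [hε]
  refine ⟨fun t => e.symm (c t), ε, hε, ⟨?_, fun t ht => ⟨e.map_target (hcu t ht).1, fun i => ?_⟩⟩,
    ?_⟩
  · exact ((contMDiffOn_symm_of_mem_maximalAtlas he).of_le
      (by exact WithTop.coe_le_coe.2 le_top)).comp hc2.contMDiffOn fun t ht => (hcu t ht).1
  · obtain ⟨h1, h2, h3, h4⟩ := hcu t ht
    have e0 : ∀ s ∈ Set.Ioo (-ε) ε, e (e.symm (c s)) = c s := fun s hs => e.right_inv (hcu s hs).1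
    have e1 : ∀ s ∈ Set.Ioo (-ε) ε, deriv (fun r => e (e.symm (c r))) s = u s := fun s hs => by
      rw [Filter.EventuallyEq.deriv_eq (f := c), hcd hs]
      filter_upwards [hopen.mem_nhds hs] with r hr using e0 r hr
    have e2 : deriv (deriv fun r => e (e.symm (c r))) t = deriv u t := by
      apply Filter.EventuallyEq.deriv_eq
      filter_upwards [hopen.mem_nhds ht] with r hr using e1 r hr
    rw [e2, hud ht, e1 t ht, e0 t ht, H.sum_sum_chern_mul_mul h1 h2]
    simp
  · rw [velocity_comp_symm he (hcu 0 h0).2.2.1 (hcu 0 h0).1, hc0, hu0]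
    have h1 := ofCoordAt_toCoord he hx v
    refine (tangentBundle_mk_congr (e.left_inv hx) _).trans ?_
    exact congrArg (fun w : Coord n => (⟨x, w⟩ : TangentBundle 𝓘(ℝ, Coord n) M)) h1

/-- The geodesic with initial velocity `v`, in coordinates: it solves the second order equation
given by the spray. -/
lemma geodesic_spec (hn : 0 < n) (he : e ∈ IsManifold.maximalAtlas 𝓘(ℝ, Coord n) ∞ M) {x : M}
    (hx : x ∈ e.source) {v : TangentSpace 𝓘(ℝ, Coord n) x} (hv : v ≠ 0) :
    ∃ c u : ℝ → Coord n, c 0 = e x ∧ u 0 = toCoord e x v ∧ ∀ᶠ t in 𝓝 (0 : ℝ),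
      e (velocity (n := n) (S.geodesic e ⟨x, v⟩) t).1 = c t ∧
      toCoord e (velocity (n := n) (S.geodesic e ⟨x, v⟩) t).1
        (velocity (n := n) (S.geodesic e ⟨x, v⟩) t).2 = u t ∧
      c t ∈ e.target ∧ u t ≠ 0 ∧ HasDerivAt c (u t) t ∧
      ∃ u', HasDerivAt u u' t ∧ ∀ i, u' i = -spray (S.coordL e) i (c t) (u t) := by
  have H := S.isCoordLagrangian hn he
  obtain ⟨ε, hε, ⟨hη2, hη⟩, hvel⟩ := Classical.epsilon_spec (S.exists_geodesic hn he hx hv)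
  change ContMDiffOn 𝓘(ℝ, ℝ) 𝓘(ℝ, Coord n) 2 (S.geodesic e ⟨x, v⟩) _ at hη2
  change ∀ t ∈ Set.Ioo (-ε) ε, S.geodesic e ⟨x, v⟩ t ∈ e.source ∧ ∀ i : Fin n,
      deriv (deriv fun s => e (S.geodesic e ⟨x, v⟩ s)) t i
        + ∑ j, ∑ k, chern (S.coordL e) i j k (e (S.geodesic e ⟨x, v⟩ t))
            (deriv (fun s => e (S.geodesic e ⟨x, v⟩ s)) t)
            * deriv (fun s => e (S.geodesic e ⟨x, v⟩ s)) t j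
            * deriv (fun s => e (S.geodesic e ⟨x, v⟩ s)) t k = 0 at hη
  change velocity (n := n) (S.geodesic e ⟨x, v⟩) 0 = _ at hvel
  set η := S.geodesic e ⟨x, v⟩
  have hopen : IsOpen (Set.Ioo (-ε) ε) := isOpen_Ioo
  have h0 : (0 : ℝ) ∈ Set.Ioo (-ε) ε := by simp [hε]
  have hmd : ∀ t ∈ Set.Ioo (-ε) ε, MDifferentiableAt 𝓘(ℝ, ℝ) 𝓘(ℝ, Coord n) η t := fun t ht =>
    (hη2.contMDiffAt (hopen.mem_nhds ht)).mdifferentiableAt (by simp)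
  have hc2 : ContDiffOn ℝ 2 (fun s => e (η s)) (Set.Ioo (-ε) ε) :=
    contMDiffOn_iff_contDiffOn.1 (((contMDiffOn_of_mem_maximalAtlas he).of_le
      (by exact WithTop.coe_le_coe.2 le_top)).comp hη2 fun t ht => (hη t ht).1)
  have hc1 : ContDiffOn ℝ 1 (deriv fun s => e (η s)) (Set.Ioo (-ε) ε) := by
    rw [show (2 : ℕ∞ω) = 1 + 1 from one_add_one_eq_two.symm,
      contDiffOn_succ_iff_deriv_of_isOpen hopen] at hc2
    exact hc2.2.2
  have hu0 : deriv (fun s => e (η s)) 0 = toCoord e x v := by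
    rw [← toCoord_velocity he (hmd 0 h0) (hη 0 h0).1]
    exact congrArg (fun z : TangentBundle 𝓘(ℝ, Coord n) M => (toCoord e z.1 z.2 : Coord n)) hvel
  have hne : ∀ᶠ t in 𝓝 (0 : ℝ), deriv (fun s => e (η s)) t ≠ 0 := by
    refine ((hc1.continuousOn.continuousAt (hopen.mem_nhds h0)).eventually_ne ?_)
    rw [hu0]
    exact fun h => hv ((coordEquiv he hx).map_eq_zero_iff.1 h)
  refine ⟨fun s => e (η s), deriv fun s => e (η s), ?_, hu0, ?_⟩
  · exact congrArg (fun z : TangentBundle 𝓘(ℝ, Coord n) M => e z.1) hvel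
  · filter_upwards [hne, hopen.mem_nhds h0] with t htne ht
    refine ⟨rfl, toCoord_velocity he (hmd t ht) (hη t ht).1, e.map_source (hη t ht).1, htne,
      ((hc2.differentiableOn (by simp)).differentiableAt (hopen.mem_nhds ht)).hasDerivAt, _,
      ((hc1.differentiableOn (by simp)).differentiableAt (hopen.mem_nhds ht)).hasDerivAt,
      fun i => ?_⟩
    have h1 := (hη t ht).2 i
    rw [H.sum_sum_chern_mul_mul (e.map_source (hη t ht).1) htne] at h1
    linarith

end LorentzFinsler

namespace WeightedSpacetime

variable [MeasurableSpace M] (S : WeightedSpacetime n M)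

lemma contDiffOn_logDensity (he : e ∈ IsManifold.maximalAtlas 𝓘(ℝ, Coord n) ∞ M) :
    ContDiffOn ℝ ∞ (logDensity e S) e.target := by
  have h := Classical.epsilon_spec (S.smooth_m e he)
  exact h.1.log fun p hp => (h.2.1 p hp).ne'

lemma contDiffAt_logDensity (he : e ∈ IsManifold.maximalAtlas 𝓘(ℝ, Coord n) ∞ M) {p : Coord n}
    (hp : p ∈ e.target) : ContDiffAt ℝ 2 (logDensity e S) p :=
  ((contDiffOn_logDensity S he).contDiffAt (e.open_target.mem_nhds hp)).of_le
    (by exact WithTop.coe_le_coe.2 le_top)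

lemma fderiv_apply_eq_sum {u : Coord n → ℝ} {p : Coord n} (w : Coord n) :
    fderiv ℝ u p w = ∑ i, w i * partialBase i u p := by
  conv_lhs => rw [sum_single w]
  simp only [map_sum, map_smul, smul_eq_mul, partialBase]

/-- The first two derivatives of the weight function along a geodesic. -/
lemma weightAlong_derivs (hn : 0 < n) (he : e ∈ IsManifold.maximalAtlas 𝓘(ℝ, Coord n) ∞ M) {x : M}
    (hx : x ∈ e.source) {v : TangentSpace 𝓘(ℝ, Coord n) x} (hv : v ≠ 0) :
    deriv (weightAlong e S ⟨x, v⟩) 0 = ∑ i, nonlinConn (S.coordL e) i i (e x) (toCoord e x v)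
      - ∑ i, toCoord e x v i * partialBase i (logDensity e S) (e x) ∧
    deriv (deriv (weightAlong e S ⟨x, v⟩)) 0 =
      weightSecond (S.coordL e) (logDensity e S) (e x) (toCoord e x v) := by
  have H := S.isCoordLagrangian hn he
  set l := S.coordL e
  set Φ := logDensity e S
  obtain ⟨c, u, hc0, hu0, hcu⟩ := S.geodesic_spec hn he hx hv
  have hfun : ∀ᶠ t in 𝓝 (0 : ℝ), weightAlong e S ⟨x, v⟩ t =
      Real.log (Real.sqrt (-(gMatrix l (c t) (u t)).det)) - Φ (c t) := by
    filter_upwards [hcu] with t ht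
    rw [weightAlong, weight, ht.1, ht.2.1]
  have hder : ∀ᶠ t in 𝓝 (0 : ℝ), deriv (weightAlong e S ⟨x, v⟩) t =
      ∑ i, nonlinConn l i i (c t) (u t) - ∑ i, u t i * partialBase i Φ (c t) := by
    filter_upwards [hcu, hfun.eventually_nhds] with t ht hft
    obtain ⟨-, -, h1, h2, h3, u', h4, h5⟩ := ht
    have h6 := (((contDiffAt_logDensity S he h1).differentiableAt
      (by simp)).hasFDerivAt.comp_hasDerivAt t h3)
    have h7 := (H.hasDerivAt_log_sqrt_neg_det_geodesic h1 h2 h3 h4 h5).sub h6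
    rw [Filter.EventuallyEq.deriv_eq hft, ← fderiv_apply_eq_sum]
    exact h7.deriv
  constructor
  · rw [hder.self_of_nhds, hc0, hu0]
  · rw [Filter.EventuallyEq.deriv_eq hder]
    obtain ⟨-, -, h1, h2, h3, u', h4, h5⟩ := hcu.self_of_nhds
    change ∀ i, u' i = -spray l i (c 0) (u 0) at h5
    have hN : HasDerivAt (fun t => ∑ i, nonlinConn l i i (c t) (u t)) _ 0 :=
      HasDerivAt.fun_sum fun i (_ : i ∈ Finset.univ) =>
        (H.smooth_nonlinConn i i).hasDerivAt_comp H.isOpen h1 h2 h3 h4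
    have hP : ∀ i, HasDerivAt (fun t => partialBase i Φ (c t)) _ 0 := fun i =>
      ((differentiableAt_partialBase (contDiffAt_logDensity S he h1)
        i).hasFDerivAt.comp_hasDerivAt 0 h3)
    have hu : ∀ i, HasDerivAt (fun t => u t i) (u' i) 0 := fun i =>
      (EuclideanSpace.proj i : Coord n →L[ℝ] ℝ).hasFDerivAt.comp_hasDerivAt 0 h4
    have hQ : HasDerivAt (fun t => ∑ i, u t i * partialBase i Φ (c t)) _ 0 :=
      HasDerivAt.fun_sum fun i (_ : i ∈ Finset.univ) => (hu i).fun_mul (hP i)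
    rw [(hN.fun_sub hQ).deriv, ← hc0, ← hu0, weightSecond]
    simp only [fderiv_apply_eq_sum, h5]
    rw [Finset.sum_comm (s := Finset.univ) (f := fun k i =>
      (partialX k (nonlinConn l i i) (c 0) (u 0) * u 0 k
        - partialV k (nonlinConn l i i) (c 0) (u 0) * spray l k (c 0) (u 0)))]
    have e1 : ∀ i, ∑ k, partialX k (nonlinConn l i i) (c 0) (u 0) * u 0 k
        + ∑ k, partialV k (nonlinConn l i i) (c 0) (u 0) * -spray l k (c 0) (u 0) =
        ∑ k, (partialX k (nonlinConn l i i) (c 0) (u 0) * u 0 k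
        - partialV k (nonlinConn l i i) (c 0) (u 0) * spray l k (c 0) (u 0)) := fun i => by
      rw [← Finset.sum_add_distrib]
      exact Finset.sum_congr rfl fun k _ => by ring
    have e2 : ∑ i, (-spray l i (c 0) (u 0) * partialBase i Φ (c 0)
        + u 0 i * ∑ k, u 0 k * partialBase k (partialBase i Φ) (c 0)) =
        ∑ i, ∑ k, u 0 i * u 0 k * partialBase k (partialBase i Φ) (c 0)
          - ∑ i, spray l i (c 0) (u 0) * partialBase i Φ (c 0) := by
      rw [← Finset.sum_sub_distrib]
      refine Finset.sum_congr rfl fun i _ => ?_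
      simp only [Finset.mul_sum, mul_assoc]
      ring
    rw [e2]
    simp only [e1]
    ring

end WeightedSpacetime

end Geodesics

/-! ### Orthonormal bases and traces -/

section OrthonormalBases

variable {V : Type*} [AddCommGroup V] [Module ℝ V] {n : ℕ} {B : LinearMap.BilinForm ℝ V}

/-- The trace of the square of an endomorphism which is self-adjoint with respect to an indefinite
form, in an orthonormal basis. -/
lemma trace_comp_self_eq {b : Module.Basis (Fin n) ℝ V} (horth : ∀ i j, i ≠ j → B (b i) (b j) = 0)
    (hnorm : ∀ i, |B (b i) (b i)| = 1) {A : V →ₗ[ℝ] V} (hA : ∀ v w, B (A v) w = B (A w) v) :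
    LinearMap.trace ℝ V (A ∘ₗ A) =
      ∑ i, ∑ j, B (A (b i)) (b j) ^ 2 * B (b i) (b i) * B (b j) (b j) := by
  have hsq : ∀ i, B (b i) (b i) * B (b i) (b i) = 1 := fun i => by
    rw [← abs_mul_abs_self, hnorm, one_mul]
  have hrepr : ∀ v i, b.repr v i = B v (b i) * B (b i) (b i) := fun v i => by
    have h1 : B v (b i) = b.repr v i * B (b i) (b i) := by
      conv_lhs => rw [← b.sum_repr v]
      simp only [map_sum, map_smul, LinearMap.sum_apply, LinearMap.smul_apply, smul_eq_mul]
      rw [Finset.sum_eq_single i (fun j _ hj => by rw [horth j i hj, mul_zero]) (by simp)]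
    rw [h1, mul_assoc, hsq, mul_one]
  rw [LinearMap.trace_eq_matrix_trace ℝ b, LinearMap.toMatrix_comp b b b, Matrix.trace]
  refine Finset.sum_congr rfl fun i _ => ?_
  rw [Matrix.diag_apply, Matrix.mul_apply]
  refine Finset.sum_congr rfl fun j _ => ?_
  rw [LinearMap.toMatrix_apply, LinearMap.toMatrix_apply, hrepr, hrepr, hA (b j) (b i)]
  ring

/-- An orthonormal basis can be reflected to one which begins with a given unit timelike vector `a`.
The sign condition makes the difference of `a` and the first basis vector non-null. -/
lemma exists_basis_of_inner_nonneg (hB : ∀ v w, B v w = B w v) {m : ℕ}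
    {b : Module.Basis (Fin (m + 1)) ℝ V}
    (hb : ∀ i j, B (b i) (b j) = if i = j then lorentzSign i else 0) {a : V} (ha : B a a = -1)
    (hab : 0 ≤ B a (b 0)) : ∃ b' : Module.Basis (Fin (m + 1)) ℝ V,
      (∀ i j, B (b' i) (b' j) = if i = j then lorentzSign i else 0) ∧ b' 0 = a := by
  -- the reflection along the timelike vector `a - b 0` exchanges `a` and `b 0`
  have hb0 : B (b 0) (b 0) = -1 := by rw [hb]; simp [lorentzSign]
  set d := a - b 0 with hd
  have hdd : B d d = -2 - 2 * B a (b 0) := by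
    simp only [hd, map_sub, LinearMap.sub_apply, ha, hb0, hB (b 0) a]
    ring
  have hdne : B d d ≠ 0 := by rw [hdd]; linarith
  have hd2 : ((2 / B d d) • B d) d = 2 := by
    rw [LinearMap.smul_apply, smul_eq_mul, div_mul_cancel₀ _ hdne]
  refine ⟨b.map (Module.reflection hd2), fun i j => ?_, ?_⟩
  · rw [← hb i j]
    simp only [Module.Basis.map_apply, Module.reflection_apply, map_sub, map_smul,
      LinearMap.sub_apply, LinearMap.smul_apply, smul_eq_mul, hB _ d]
    field_simp
    ring
  · rw [Module.Basis.map_apply, Module.reflection_apply, LinearMap.smul_apply, smul_eq_mul]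
    have h1 : 2 / B d d * B d (b 0) = -1 := by
      have h2 : B d (b 0) = B a (b 0) + 1 := by
        rw [hd, map_sub, LinearMap.sub_apply, hb0]
        ring
      rw [h2, div_mul_eq_mul_div, div_eq_iff hdne, hdd]
      ring
    rw [h1, neg_one_smul, sub_neg_eq_add, hd, add_sub_cancel]

/-- A unit timelike vector is the first member of an orthonormal basis. -/
lemma exists_basis_apply_zero_eq (hn : 0 < n) (hB : ∀ v w, B v w = B w v)
    {b : Module.Basis (Fin n) ℝ V}
    (hb : ∀ i j, B (b i) (b j) = if i = j then lorentzSign i else 0) {a : V} (ha : B a a = -1) :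
    ∃ b' : Module.Basis (Fin n) ℝ V,
      (∀ i j, B (b' i) (b' j) = if i = j then lorentzSign i else 0) ∧
      ∀ i : Fin n, (i : ℕ) = 0 → b' i = a := by
  obtain ⟨m, rfl⟩ := Nat.exists_eq_succ_of_ne_zero hn.ne'
  have key : ∃ b' : Module.Basis (Fin (m + 1)) ℝ V,
      (∀ i j, B (b' i) (b' j) = if i = j then lorentzSign i else 0) ∧ b' 0 = a := by
    rcases le_total 0 (B a (b 0)) with h | h
    · exact exists_basis_of_inner_nonneg hB hb ha h
    -- the basis `-b` is orthonormal as well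
    · refine exists_basis_of_inner_nonneg (b := b.map (LinearEquiv.neg ℝ)) hB (fun i j => ?_) ha ?_
      · simp [hb]
      · simpa using h
  obtain ⟨b', h1, h2⟩ := key
  refine ⟨b', h1, fun i hi => ?_⟩
  rw [← h2]
  congr 1
  exact Fin.ext hi

end OrthonormalBases

section FieldComponents

variable {n : ℕ} {M : Type*} [TopologicalSpace M] [ChartedSpace (Coord n) M]
  {e : OpenPartialHomeomorph M (Coord n)}

lemma fieldCoord_apply (V : ∀ x : M, TangentSpace 𝓘(ℝ, Coord n) x) {x : M} (hx : x ∈ e.source) :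
    fieldCoord e V (e x) = toCoord e x (V x) := by
  have h : ∀ y : M, y = x → (toCoord e y (V y) : Coord n) = toCoord e x (V x) := by
    rintro _ rfl
    rfl
  exact h _ (e.left_inv hx)

end FieldComponents

section TraceFormulas

variable {n : ℕ} {M : Type*} [TopologicalSpace M] [ChartedSpace (Coord n) M]
  [IsManifold 𝓘(ℝ, Coord n) ∞ M] {e : OpenPartialHomeomorph M (Coord n)}

lemma trace_endOfMatrix (he : e ∈ IsManifold.maximalAtlas 𝓘(ℝ, Coord n) ∞ M) {x : M}
    (hx : x ∈ e.source) (A : Matrix (Fin n) (Fin n) ℝ) :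
    LinearMap.trace ℝ (TangentSpace 𝓘(ℝ, Coord n) x) (endOfMatrix e x A) = A.trace := by
  have h1 : endOfMatrix e x A =
      (coordEquiv he hx).toLinearEquiv.symm.conj (Matrix.toEuclideanLin A) := rfl
  rw [h1, LinearMap.trace_conj']
  change LinearMap.trace ℝ (Coord n) (Matrix.toLpLin 2 2 A) = _
  rw [Matrix.toLpLin_eq_toLin, Matrix.trace_toLin_eq]

lemma endOfMatrix_comp (he : e ∈ IsManifold.maximalAtlas 𝓘(ℝ, Coord n) ∞ M) {x : M}
    (hx : x ∈ e.source) (A B : Matrix (Fin n) (Fin n) ℝ) :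
    endOfMatrix e x A ∘ₗ endOfMatrix e x B = endOfMatrix e x (A * B) := by
  refine LinearMap.ext fun v => ?_
  show ofCoordAt e x (Matrix.toEuclideanLin A (toCoord e x (ofCoordAt e x
    (Matrix.toEuclideanLin B (toCoord e x v))))) = ofCoordAt e x _
  rw [toCoord_ofCoordAt he hx]
  congr 1
  simp [Matrix.toLpLin_apply]

lemma toCoord_endOfMatrix (he : e ∈ IsManifold.maximalAtlas 𝓘(ℝ, Coord n) ∞ M) {x : M}
    (hx : x ∈ e.source) (A : Matrix (Fin n) (Fin n) ℝ) (v : TangentSpace 𝓘(ℝ, Coord n) x)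
    (i : Fin n) : toCoord e x (endOfMatrix e x A v) i = ∑ j, A i j * toCoord e x v j := by
  show toCoord e x (ofCoordAt e x (Matrix.toEuclideanLin A (toCoord e x v))) i = _
  rw [toCoord_ofCoordAt he hx]
  rfl

namespace LorentzFinsler

variable (S : LorentzFinsler n M)

/-- `g_v` is a symmetric bilinear form with `g_v(v, v) = 2L(v)`. -/
lemma exists_bilinForm_eq_g (hn : 0 < n) (x : M) {v : TangentSpace 𝓘(ℝ, Coord n) x} (hv : v ≠ 0) :
    ∃ B : LinearMap.BilinForm ℝ (TangentSpace 𝓘(ℝ, Coord n) x), (∀ a b, S.g v a b = B a b) ∧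
      (∀ a b, B a b = B b a) ∧ B v v = 2 * S.L ⟨x, v⟩ := by
  have he := IsManifold.chart_mem_maximalAtlas (I := 𝓘(ℝ, Coord n)) (n := ∞) x
  have hx := mem_chart_source (Coord n) x
  set e := chartAt (Coord n) x
  have H := S.isCoordLagrangian hn he
  have hp := e.map_source hx
  have hv' : toCoord e x v ≠ 0 := fun h => hv ((coordEquiv he hx).map_eq_zero_iff.1 h)
  let B : LinearMap.BilinForm ℝ (TangentSpace 𝓘(ℝ, Coord n) x) := LinearMap.mk₂ ℝ
    (fun a b => ∑ i, ∑ j, gLow (S.coordL e) i j (e x) (toCoord e x v) * toCoord e x a i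
      * toCoord e x b j)
    (fun a b c => by
      simp only [map_add, PiLp.add_apply, mul_add, add_mul, Finset.sum_add_distrib])
    (fun r a b => by
      simp only [map_smul, PiLp.smul_apply, smul_eq_mul, Finset.mul_sum]
      exact Finset.sum_congr rfl fun i _ => Finset.sum_congr rfl fun j _ => by ring)
    (fun a b c => by
      simp only [map_add, PiLp.add_apply, mul_add, Finset.sum_add_distrib])
    (fun r a b => by
      simp only [map_smul, PiLp.smul_apply, smul_eq_mul, Finset.mul_sum]
      exact Finset.sum_congr rfl fun i _ => Finset.sum_congr rfl fun j _ => by ring)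
  have hB : ∀ a b, B a b = ∑ i, ∑ j, gLow (S.coordL e) i j (e x) (toCoord e x v)
      * toCoord e x a i * toCoord e x b j := fun _ _ => rfl
  refine ⟨B, fun a b => S.fundamentalTensor_eq he hx hv a b, fun a b => ?_, ?_⟩
  · rw [hB, hB, Finset.sum_comm]
    refine Finset.sum_congr rfl fun i _ => Finset.sum_congr rfl fun j _ => ?_
    rw [H.gLow_symm hp hv' j i]
    ring
  · rw [hB, ← S.coordL_toCoord he hx, ← H.sum_mul_partialV hp hv']
    refine Finset.sum_congr rfl fun i _ => ?_
    rw [← H.sum_mul_gLow hp hv' i, Finset.mul_sum]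
    refine Finset.sum_congr rfl fun j _ => ?_
    rw [H.gLow_symm hp hv' i j]
    ring

lemma ricci_eq (he : e ∈ IsManifold.maximalAtlas 𝓘(ℝ, Coord n) ∞ M) {x : M} (hx : x ∈ e.source)
    (v : TangentSpace 𝓘(ℝ, Coord n) x) :
    S.ricci e x v = ∑ i, curvature (S.coordL e) i i (e x) (toCoord e x v) := by
  rw [ricci, curvatureEnd, trace_endOfMatrix he hx]
  rfl

end LorentzFinsler

namespace Spacetime

variable (S : Spacetime n M) {U : Set M} {h : M → ℝ}

lemma hessian_eq (hn : 0 < n) (he : e ∈ IsManifold.maximalAtlas 𝓘(ℝ, Coord n) ∞ M) {x : M}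
    (hx : x ∈ e.source) (hne : S.grad h x ≠ 0) : S.hessian e h x =
      endOfMatrix e x (covMatrix (S.coordL e) (fieldCoord e (S.grad h)) (e x)) := by
  have H := S.isCoordLagrangian hn he
  have hv : toCoord e x (S.grad h x) ≠ 0 := fun h => hne ((coordEquiv he hx).map_eq_zero_iff.1 h)
  rw [hessian, LorentzFinsler.covDeriv]
  congr 1
  ext i j
  simp only [covMatrix, Matrix.of_apply, fieldCoord_apply _ hx,
    H.sum_chern_mul (e.map_source hx) hv]

lemma exists_isAdaptedBasis (hn : 0 < n) (htemp : S.IsTemporalOn (fun y => -h y) U) {x : M}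
    (hx : x ∈ U) : ∃ b, S.IsAdaptedBasis h x b := by
  have hne := S.grad_ne_zero htemp hx
  have hneg := S.L_grad_neg htemp hx
  obtain ⟨B, hgB, hsymm, hBv⟩ := S.exists_bilinForm_eq_g hn x hne
  obtain ⟨b₀, hb₀⟩ := S.signature x (S.grad h x) hne
  have hF2 : S.F ⟨x, S.grad h x⟩ ^ 2 = -2 * S.L ⟨x, S.grad h x⟩ :=
    Real.sq_sqrt (by linarith)
  have hFne : S.F ⟨x, S.grad h x⟩ ≠ 0 := fun h0 => by rw [h0] at hF2; linarith
  have ha : B ((S.F ⟨x, S.grad h x⟩)⁻¹ • S.grad h x) ((S.F ⟨x, S.grad h x⟩)⁻¹ • S.grad h x) =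
      -1 := by
    simp only [map_smul, LinearMap.smul_apply, smul_eq_mul, hBv]
    field_simp
    rw [hF2]
    ring
  obtain ⟨b, hb, hb0⟩ := exists_basis_apply_zero_eq hn hsymm (b := b₀)
    (fun i j => (hgB _ _).symm.trans (hb₀ i j)) ha
  refine ⟨b, fun i j hij => ?_, fun i => ?_, hb0⟩
  · rw [hgB, hb, if_neg hij]
  · rw [hgB, hb, if_pos rfl, lorentzSign]
    split_ifs <;> simp

end Spacetime

end TraceFormulas

/-! ### The terms of the Bochner identity -/

lemma eventually_mem_target_and_mem {n : ℕ} {M : Type*} [TopologicalSpace M]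
    {e : OpenPartialHomeomorph M (Coord n)} {U : Set M} (hU : IsOpen U) {p : Coord n}
    (hp : p ∈ e.target) (hpU : e.symm p ∈ U) : ∀ᶠ q in 𝓝 p, q ∈ e.target ∧ e.symm q ∈ U :=
  (e.open_target.eventually_mem hp).and
    ((e.continuousAt_symm hp).eventually (hU.mem_nhds hpU))

section BochnerTerms

variable {n : ℕ} {M : Type*} [TopologicalSpace M] [ChartedSpace (Coord n) M]
  [IsManifold 𝓘(ℝ, Coord n) ∞ M] {e : OpenPartialHomeomorph M (Coord n)} {U : Set M} {h : M → ℝ}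
  {x : M}

namespace Spacetime

variable (S : Spacetime n M)

lemma eventually_partialV_coordL_grad (he : e ∈ IsManifold.maximalAtlas 𝓘(ℝ, Coord n) ∞ M)
    (hU : IsOpen U) (hh : ContMDiffOn 𝓘(ℝ, Coord n) 𝓘(ℝ, ℝ) 3 h U)
    (htemp : S.IsTemporalOn (fun y => -h y) U) {p : Coord n} (hp : p ∈ e.target)
    (hpU : e.symm p ∈ U) : ∀ᶠ q in 𝓝 p, ∀ i, partialV i (S.coordL e) q
      (fieldCoord e (S.grad h) q) = partialBase i (fun q => h (e.symm q)) q := by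
  filter_upwards [eventually_mem_target_and_mem hU hp hpU] with q hq i
  exact S.partialV_coordL_grad he htemp hq.1 hq.2
    ((hh.contMDiffAt (hU.mem_nhds hq.2)).mdifferentiableAt (by simp)) i

/-- The gradient of `F(∇h)² / 2` with respect to `g_{∇h}` is the negative acceleration of `∇h`. -/
lemma fieldCoord_linGrad (hn : 0 < n) (he : e ∈ IsManifold.maximalAtlas 𝓘(ℝ, Coord n) ∞ M)
    (hU : IsOpen U) (hh : ContMDiffOn 𝓘(ℝ, Coord n) 𝓘(ℝ, ℝ) 3 h U)
    (htemp : S.IsTemporalOn (fun y => -h y) U) {p : Coord n} (hp : p ∈ e.target)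
    (hpU : e.symm p ∈ U) (i : Fin n) :
    fieldCoord e (S.linGrad e (S.grad h) fun y => S.F ⟨y, S.grad h y⟩ ^ 2 / 2) p i =
      -accel (S.coordL e) (fieldCoord e (S.grad h)) i p := by
  have H := S.isCoordLagrangian hn he
  rw [fieldCoord, LorentzFinsler.linGrad, toCoord_ofCoordAt he (e.map_target hp)]
  have hF : (fun q => S.F ⟨e.symm q, S.grad h (e.symm q)⟩ ^ 2 / 2) =ᶠ[𝓝 p]
      fun q => -S.coordL e q (fieldCoord e (S.grad h) q) := by
    filter_upwards [eventually_mem_target_and_mem hU hp hpU] with q hq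
    have h1 := S.L_grad_neg htemp hq.2
    have h2 : S.coordL e q (fieldCoord e (S.grad h) q) = S.L ⟨e.symm q, S.grad h (e.symm q)⟩ := by
      rw [LorentzFinsler.coordL, fieldCoord, ofCoord_toCoord he hq.1]
    have h3 : S.F ⟨e.symm q, S.grad h (e.symm q)⟩ ^ 2 = -2 * S.L ⟨e.symm q, S.grad h (e.symm q)⟩ :=
      Real.sq_sqrt (by linarith)
    rw [h2, h3]
    ring
  have hW := (S.contDiffAt_fieldCoord_grad hn he hU hh htemp hp hpU).differentiableAt (by simp)
  have h4 := H.sum_gUp_mul_partialBase hp (S.fieldCoord_grad_ne_zero he htemp hp hpU) hW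
    ((contDiffAt_comp_symm he hU hh hp hpU).of_le (by norm_num))
    (S.eventually_partialV_coordL_grad he hU hh htemp hp hpU) i
  rw [accel, ← h4, PiLp.toLp_apply]
  refine Finset.sum_congr rfl fun j _ => ?_
  rw [e.right_inv hp]
  congr 1
  rw [partialBase, hF.fderiv_eq]
  rfl

lemma differentiableAt_fieldCoord_linGrad (hn : 0 < n)
    (he : e ∈ IsManifold.maximalAtlas 𝓘(ℝ, Coord n) ∞ M)
    (hU : IsOpen U) (hh : ContMDiffOn 𝓘(ℝ, Coord n) 𝓘(ℝ, ℝ) 3 h U)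
    (htemp : S.IsTemporalOn (fun y => -h y) U) {p : Coord n} (hp : p ∈ e.target)
    (hpU : e.symm p ∈ U) : DifferentiableAt ℝ (fieldCoord e
      (S.linGrad e (S.grad h) fun y => S.F ⟨y, S.grad h y⟩ ^ 2 / 2)) p := by
  rw [differentiableAt_piLp 2]
  intro i
  refine ((S.isCoordLagrangian hn he).differentiableAt_accel hp
    (S.fieldCoord_grad_ne_zero he htemp hp hpU)
    (S.contDiffAt_fieldCoord_grad hn he hU hh htemp hp hpU) i).fun_neg.congr_of_eventuallyEq ?_
  filter_upwards [eventually_mem_target_and_mem hU hp hpU] with q hq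
  exact S.fieldCoord_linGrad hn he hU hh htemp hq.1 hq.2 i

/-- `HS_{∇h}(∇²h)` is the trace of the square of the Hessian. -/
lemma HS_eq (hn : 0 < n) (he : e ∈ IsManifold.maximalAtlas 𝓘(ℝ, Coord n) ∞ M)
    (hU : IsOpen U) (hh : ContMDiffOn 𝓘(ℝ, Coord n) 𝓘(ℝ, ℝ) 3 h U)
    (htemp : S.IsTemporalOn (fun y => -h y) U) (hxU : x ∈ U) (hx : x ∈ e.source)
    {b : Module.Basis (Fin n) ℝ (TangentSpace 𝓘(ℝ, Coord n) x)} (hb : S.IsAdaptedBasis h x b) :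
    S.HS e h x b = ∑ i, ∑ j, covMatrix (S.coordL e) (fieldCoord e (S.grad h)) (e x) i j
      * covMatrix (S.coordL e) (fieldCoord e (S.grad h)) (e x) j i := by
  have H := S.isCoordLagrangian hn he
  have hp := e.map_source hx
  have hpU : e.symm (e x) ∈ U := by rwa [e.left_inv hx]
  have hne := S.grad_ne_zero htemp hxU
  set W := fieldCoord e (S.grad h) with hW
  set A := covMatrix (S.coordL e) W (e x)
  have hWx : W (e x) = toCoord e x (S.grad h x) := fieldCoord_apply _ hx
  have hsymmA := H.sum_gLow_mul_covMatrix_symm hp (S.fieldCoord_grad_ne_zero he htemp hp hpU)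
    ((S.contDiffAt_fieldCoord_grad hn he hU hh htemp hp hpU).differentiableAt (by simp))
    ((contDiffAt_comp_symm he hU hh hp hpU).of_le (by norm_num))
    (S.eventually_partialV_coordL_grad he hU hh htemp hp hpU)
  obtain ⟨B, hgB, -, -⟩ := S.exists_bilinForm_eq_g hn x hne
  have hHess := S.hessian_eq hn he hx hne
  have hadj : ∀ v w, B (S.hessian e h x v) w = B (S.hessian e h x w) v := by
    have h1 : ∀ v w, B (S.hessian e h x v) w = ∑ j, ∑ k,
        (∑ i, gLow (S.coordL e) j i (e x) (W (e x)) * A i k) * toCoord e x v k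
          * toCoord e x w j := fun v w => by
      rw [← hgB, LorentzFinsler.g, S.fundamentalTensor_eq he hx hne, ← hWx, hHess]
      simp only [toCoord_endOfMatrix he hx]
      rw [Finset.sum_comm]
      refine Finset.sum_congr rfl fun j _ => ?_
      simp only [Finset.mul_sum, Finset.sum_mul]
      rw [Finset.sum_comm]
      refine Finset.sum_congr rfl fun k _ => Finset.sum_congr rfl fun i _ => ?_
      rw [H.gLow_symm hp (S.fieldCoord_grad_ne_zero he htemp hp hpU) i j]
      ring
    intro v w
    rw [h1, h1, Finset.sum_comm]
    refine Finset.sum_congr rfl fun k _ => Finset.sum_congr rfl fun j _ => ?_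
    rw [hsymmA j k]
    ring
  rw [HS]
  simp only [hgB]
  rw [← trace_comp_self_eq (fun i j hij => by rw [← hgB]; exact hb.1 i j hij)
    (fun i => by rw [← hgB]; exact hb.2.1 i) hadj, hHess, endOfMatrix_comp he hx,
    trace_endOfMatrix he hx]
  exact Finset.sum_congr rfl fun i _ => by rw [Matrix.diag_apply, Matrix.mul_apply]

end Spacetime

namespace WeightedSpacetime

variable [MeasurableSpace M] (S : WeightedSpacetime n M)

/-- The weighted d'Alembertian is the divergence of the gradient. -/
lemma wDAlembertian_eq (hn : 0 < n) (he : e ∈ IsManifold.maximalAtlas 𝓘(ℝ, Coord n) ∞ M)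
    (hx : x ∈ e.source) (hne : S.grad h x ≠ 0) : wDAlembertian e S h x =
      coordDiv (logDensity e S) (fieldCoord e (S.grad h)) (e x) := by
  rw [wDAlembertian, (weightAlong_derivs S hn he hx hne).1, Spacetime.dAlembertian,
    S.hessian_eq hn he hx hne, trace_endOfMatrix he hx, coordDiv, Matrix.trace]
  simp only [Matrix.diag_apply, covMatrix, Matrix.of_apply, fieldCoord_apply _ hx,
    Finset.sum_add_distrib]
  ring

lemma eventually_wDAlembertian_eq (hn : 0 < n)
    (he : e ∈ IsManifold.maximalAtlas 𝓘(ℝ, Coord n) ∞ M) (hU : IsOpen U)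
    (htemp : S.IsTemporalOn (fun y => -h y) U) (hxU : x ∈ U) (hx : x ∈ e.source) :
    wDAlembertian e S h =ᶠ[𝓝 x]
      coordDiv (logDensity e S) (fieldCoord e (S.grad h)) ∘ e := by
  filter_upwards [hU.mem_nhds hxU, e.open_source.mem_nhds hx] with y hyU hy
  exact wDAlembertian_eq S hn he hy (S.grad_ne_zero htemp hyU)

/-- The weighted d'Alembertian is differentiable, and its derivative along the gradient has the
expected coordinate expression. -/
lemma mdifferentiableAt_wDAlembertian (hn : 0 < n)
    (he : e ∈ IsManifold.maximalAtlas 𝓘(ℝ, Coord n) ∞ M) (hU : IsOpen U)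
    (hh : ContMDiffOn 𝓘(ℝ, Coord n) 𝓘(ℝ, ℝ) 3 h U)
    (htemp : S.IsTemporalOn (fun y => -h y) U) (hxU : x ∈ U) (hx : x ∈ e.source) :
    MDifferentiableAt 𝓘(ℝ, Coord n) 𝓘(ℝ, ℝ) (wDAlembertian e S h) x ∧
    Spacetime.diff (wDAlembertian e S h) x (S.grad h x) =
      ∑ k, partialBase k (coordDiv (logDensity e S) (fieldCoord e (S.grad h))) (e x)
        * fieldCoord e (S.grad h) (e x) k := by
  have hp := e.map_source hx
  have hpU : e.symm (e x) ∈ U := by rwa [e.left_inv hx]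
  have hev := eventually_wDAlembertian_eq S hn he hU htemp hxU hx
  have hd : DifferentiableAt ℝ (coordDiv (logDensity e S) (fieldCoord e (S.grad h))) (e x) :=
    differentiableAt_coordDiv (S.contDiffAt_fieldCoord_grad hn he hU hh htemp hp hpU)
      (contDiffAt_logDensity S he hp)
  have hex : MDifferentiableAt 𝓘(ℝ, Coord n) 𝓘(ℝ, Coord n) e x :=
    ((mdifferentiable_of_mem_maximalAtlas he).1 _ hx).mdifferentiableAt
      (e.open_source.mem_nhds hx)
  refine ⟨(hd.mdifferentiableAt.comp x hex).congr_of_eventuallyEq hev, ?_⟩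
  have h1 := mfderiv_comp x hd.mdifferentiableAt hex
  rw [mfderiv_eq_fderiv] at h1
  rw [Spacetime.diff, hev.mfderiv_eq, h1]
  show fderiv ℝ (coordDiv (logDensity e S) (fieldCoord e (S.grad h))) (e x)
    (toCoord e x (S.grad h x)) = _
  rw [← fieldCoord_apply (S.grad h) hx, fderiv_apply_eq_sum]
  exact Finset.sum_congr rfl fun k _ => mul_comm _ _

end WeightedSpacetime

end BochnerTerms

end FinslerSpacetime

theorem proposition4p3 {n : ℕ} (hn : 2 ≤ n) {M : Type*} [TopologicalSpace M]
    [ChartedSpace (FinslerSpacetime.Coord n) M]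
    [IsManifold 𝓘(ℝ, FinslerSpacetime.Coord n) ∞ M]
    [ConnectedSpace M] [T2Space M] [SecondCountableTopology M] [MeasurableSpace M] [BorelSpace M]
    (S : FinslerSpacetime.WeightedSpacetime n M)
    (U : Set M) (hU : IsOpen U) (h : M → ℝ)
    (hh : ContMDiffOn 𝓘(ℝ, FinslerSpacetime.Coord n) 𝓘(ℝ, ℝ) 3 h U)
    (htemp : S.IsTemporalOn (fun y => -h y) U)
    -- an arbitrary local coordinate system and an arbitrary point of `U` in its domain
    (e : OpenPartialHomeomorph M (FinslerSpacetime.Coord n))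
    (he : e ∈ IsManifold.maximalAtlas 𝓘(ℝ, FinslerSpacetime.Coord n) ∞ M)
    (x : M) (hxU : x ∈ U) (hxe : x ∈ e.source) :
    -- the outer derivatives in the identity exist
    DifferentiableAt ℝ (FinslerSpacetime.fieldCoord e
      (S.linGrad e (S.grad h) fun y => S.F ⟨y, S.grad h y⟩ ^ 2 / 2)) (e x) ∧
    MDifferentiableAt 𝓘(ℝ, FinslerSpacetime.Coord n) 𝓘(ℝ, ℝ) (S.wDAlembertian e h) x ∧
    -- adapted orthonormal bases exist
    (∃ b, S.IsAdaptedBasis h x b) ∧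
    -- the identity, whichever adapted orthonormal basis is used to compute `HS`
    ∀ b, S.IsAdaptedBasis h x b →
      S.divergence e (S.linGrad e (S.grad h) fun y => S.F ⟨y, S.grad h y⟩ ^ 2 / 2) x
        + FinslerSpacetime.Spacetime.diff (S.wDAlembertian e h) x (S.grad h x)
        + S.ricciInfty e x (S.grad h x)
        + S.HS e h x b = 0 := by
  have hn0 : 0 < n := by omega
  have hp := e.map_source hxe
  have hpU : e.symm (e x) ∈ U := by rwa [e.left_inv hxe]
  have hne := S.grad_ne_zero htemp hxU
  have hbox := S.mdifferentiableAt_wDAlembertian hn0 he hU hh htemp hxU hxe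
  refine ⟨S.differentiableAt_fieldCoord_linGrad hn0 he hU hh htemp hp hpU, hbox.1,
    S.exists_isAdaptedBasis hn0 htemp hxU, fun b hb => ?_⟩
  rw [hbox.2, S.HS_eq hn0 he hU hh htemp hxU hxe hb, FinslerSpacetime.WeightedSpacetime.ricciInfty,
    S.ricci_eq he hxe, (S.weightAlong_derivs hn0 he hxe hne).2,
    ← FinslerSpacetime.fieldCoord_apply (S.grad h) hxe,
    ← (S.isCoordLagrangian hn0 he).bochner_identity hp
      (S.fieldCoord_grad_ne_zero he htemp hp hpU)
      (S.contDiffAt_fieldCoord_grad hn0 he hU hh htemp hp hpU) (S.contDiffAt_logDensity he hp)]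
  congr 3
  rw [FinslerSpacetime.WeightedSpacetime.divergence]
  refine Finset.sum_congr rfl fun i _ => ?_
  rw [S.fieldCoord_linGrad hn0 he hU hh htemp hp hpU, ← FinslerSpacetime.partialBase_neg]
  congr 1
  rw [FinslerSpacetime.partialBase, FinslerSpacetime.partialBase,
    Filter.EventuallyEq.fderiv_eq]
  filter_upwards [FinslerSpacetime.eventually_mem_target_and_mem hU hp hpU] with q hq
  exact S.fieldCoord_linGrad hn0 he hU hh htemp hq.1 hq.2 i
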